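/- **Conventions.** Let $k$ be a perfect field of characteristic $p>0$ and let $d\ge 2$. A *graded pair* $(S,I)$ of dimension $d$ over $k$ consists of an $\mathbb N$-graded domain $S=\bigoplus_{m\ge 0}S_m$ with $S_0=k$, of finite type over $k$ and of Krull dimension $d$, and a proper graded ideal $I\subset S$ with $\ell(S/I)<\infty$. Put $m_0=\gcd\{m\mid S_m\ne 0\}$. For $q=p^n$ let $I^{[q]}$ be the ideal generated by the $q$-th powers of the elements of $I$ and, for $x\ge 0$, let $$f_n(x)=\frac1{q^{d-1}}\sum_{i=0}^{m_0-1}\ell\big((S/I^{[q]})_{\lfloor xq\rfloor m_0+i}\big),\qquad g_n(x)=(1-t)f_n(x)+t\,f_n\!\left(x+\tfrac1q\right),\quad t=xq-\lfloor xq\rfloor .$$ The Hilbert–Kunz density function of $(S,I)$ is $f_{S,I}(x)=\lim_{n\to\infty}g_n(x)$, $x\ge 0$. A function on $[0,\infty)$ is *piecewise polynomial of degree $e$* if there are $0=a_0<a_1<\dots<a_N$ such that it coincides with a polynomial on each of $[a_0,a_1],\dots,[a_{N-1},a_N],[a_N,\infty)$ and $e$ is the largest degree of these polynomials. **Statement.**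 Let $(S,I)$ be a graded pair of dimension $d$ over $k$, and let $R=\bigoplus_{m\ge0}R_m$ be a commutative graded ring with an injective degree-preserving ring homomorphism $S\to R$ that makes $R$ a finite $S$-module, such that $\operatorname{proj\,dim}_R(R/IR)<\infty$. Then: 1. $g_n$ converges uniformly on $[0,\infty)$ to $f_{S,I}$, and $f_{S,I}$ is piecewise polynomial of degree $d-1$. 2. The limit $c=\lim_{m\to\infty}\dim_k S_{m_0m}/m^{d-1}$ exists and is positive, and for every finite graded free resolution $0\to F_r\to\cdots\to F_1\to F_0\to IR\to 0$ over $R$ (with degree-preserving maps), $F_i=\bigoplus_{j\in\mathbb Z}R(-j)^{\beta_{i,j}}$ of finite rank, $$f_{S,I}(x)=c\Big(x^{d-1}-\sum_{i,j}(-1)^i\beta_{i,j}\,\max\big(x-\tfrac{j}{m_0},0\big)^{d-1}\Big)\qquad(x\ge0).$$ 3. If the ring $R_0$ is local (for example if $R$ is a domain), then $IR$ has a finite minimal graded free resolution; so then $f_{S,I}$ is given by the formula in 2 with $\beta_{i,j}$ the graded Betti numbers of $IR$. In particular, let $R=k[X_1,\dots,X_d]$ with the standard grading, let $G$ be a finite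 group, or a finite group scheme over $k$, acting linearly on $R$, let $R^G\subset R$ be the ring of invariants with the induced grading, and let $I\subset R^G$ be a proper graded ideal of finite colength. Then $(R^G,I)$ is a graded pair of dimension $d$, $IR$ has a finite minimal graded free resolution over $R$, and the conclusions 1 and 2 hold for $S=R^G$; thus $f_{R^G,I}$ is piecewise polynomial of degree $d-1$, given by the graded Betti numbers of $IR$. -/

import Mathlib

open Filter Topology
open scoped TensorProduct

noncomputable section

/-! ### The Hilbert-Kunz density function of a graded algebra -/

section Density

variable {k S : Type*} [Field k] [CommRing S] [Algebra k S]

/-- The Frobenius power `I^[q]`, `q = p ^ n`: the ideal generated by the `q`-th powers of the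
elements of `I`. -/
def frobeniusPower (p n : ℕ) (I : Ideal S) : Ideal S :=
  Ideal.span ((fun s : S => s ^ p ^ n) '' (I : Set S))

/-- The length of the degree `m` piece `(S/J)_m` of `S/J`, that is, the `k`-dimension of the
image of `S_m` in `S/J`. -/
def quotientLength (𝒮 : ℕ → Submodule k S) (J : Ideal S) (m : ℕ) : ℕ :=
  Module.finrank k ((𝒮 m).map (Ideal.Quotient.mkₐ k J).toLinearMap)

/-- `gcd {n | S_n ≠ 0}`. -/
def degreeGcd (𝒮 : ℕ → Submodule k S) : ℕ :=
  Nat.setGcd {n | 𝒮 n ≠ ⊥}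

/-- The step function `f_n(S, I)`; with `q = p ^ n` and `n₀ = gcd {n | S_n ≠ 0}`,
`f_n(x) = (ℓ(S/I^[q])_{⌊xq⌋ n₀} + ⋯ + ℓ(S/I^[q])_{⌊xq⌋ n₀ + n₀ - 1}) / q ^ (d - 1)`. -/
def hkStep (p d : ℕ) (𝒮 : ℕ → Submodule k S) (I : Ideal S) (n : ℕ) (x : ℝ) : ℝ :=
  (∑ i ∈ Finset.range (degreeGcd 𝒮),
      (quotientLength 𝒮 (frobeniusPower p n I)
        (⌊x * (p : ℝ) ^ n⌋₊ * degreeGcd 𝒮 + i) : ℝ)) / ((p : ℝ) ^ n) ^ (d - 1)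

/-- The piecewise linear function `g_n(S, I)`: the interpolation
`g_n(x) = (1 - t) f_n(x) + t f_n(x + 1/q)`, where `xq = ⌊xq⌋ + t`. -/
def hkSeq (p d : ℕ) (𝒮 : ℕ → Submodule k S) (I : Ideal S) (n : ℕ) (x : ℝ) : ℝ :=
  (1 - Int.fract (x * (p : ℝ) ^ n)) * hkStep p d 𝒮 I n x +
    Int.fract (x * (p : ℝ) ^ n) * hkStep p d 𝒮 I n (x + 1 / (p : ℝ) ^ n)

/-- The Hilbert-Kunz density function `f_{S,I}(x) = lim_n g_n(S, I)(x)`, for `x ≥ 0`. -/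
def hkDensity (p d : ℕ) (𝒮 : ℕ → Submodule k S) (I : Ideal S) (x : ℝ) : ℝ :=
  limUnder atTop (fun n : ℕ => hkSeq p d 𝒮 I n x)

/-- The ideal `I` has finite colength: `ℓ(S/I) < ∞`. -/
def HasFiniteColength (I : Ideal S) : Prop :=
  IsFiniteLength S (S ⧸ I)

/-- `(S, I)` is a graded pair of dimension `d` over `k`: `S = ⊕ S_m` is a graded domain of finite
type over the field `k = S_0`, of Krull dimension `d`, and `I` is a proper graded ideal of finite
colength. (The remaining requirements, `d ≥ 2` and `k` perfect of characteristic `p`, are stated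
where this is used.) -/
structure IsGradedPair (𝒮 : ℕ → Submodule k S) [GradedAlgebra 𝒮] (I : Ideal S) (d : ℕ) :
    Prop where
  isDomain : IsDomain S
  finiteType : Algebra.FiniteType k S
  degree_zero : 𝒮 0 = 1
  dim_eq : ringKrullDim S = d
  isHomogeneous : I.IsHomogeneous 𝒮
  ne_top : I ≠ ⊤
  finite_colength : HasFiniteColength I

end Density

/-- On `[0, ∞)` the function `f` is piecewise polynomial of degree `n`: there are breakpoints
`0 = a 0 < a 1 < ⋯ < a N` and polynomials `P 0, …, P N` such that `f = P i` on `[a i, a (i+1)]`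
for `i < N` and `f = P N` on `[a N, ∞)`, and `n` is the largest of the degrees of the `P i`. -/
def IsPiecewisePolynomialOfDegree (f : ℝ → ℝ) (n : ℕ) : Prop :=
  ∃ (N : ℕ) (a : Fin (N + 1) → ℝ) (P : Fin (N + 1) → Polynomial ℝ),
    StrictMono a ∧ a 0 = 0 ∧
    (∀ (i : Fin (N + 1)) (x : ℝ), a i ≤ x → (∀ j, i < j → x ≤ a j) → f x = (P i).eval x) ∧
    (∀ i, (P i).natDegree ≤ n) ∧ ∃ i, (P i).natDegree = n

/-! ### Graded free resolutions and graded Betti numbers -/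

section Resolution

variable {k R : Type*} [Field k] [CommRing R] [Algebra k R]

/-- The degree `j` piece of an `ℕ`-graded ring for an integer `j` (zero if `j < 0`). -/
def intPiece (ℛ : ℕ → Submodule k R) (j : ℤ) : Submodule k R :=
  if 0 ≤ j then ℛ j.toNat else ⊥

/-- A finite graded free resolution
`0 → F_{len-1} → ⋯ → F_1 → F_0 → J → 0`, `F_i = ⊕_b R(-deg i b)`, of the ideal `J` of the graded
ring `R`, with maps homogeneous of degree zero. It is given by homogeneous generators `gen b` of
`J` of degrees `deg 0 b` and matrices `d i` of the maps `F_{i+1} → F_i`. -/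
structure GradedFreeResolution (ℛ : ℕ → Submodule k R) (J : Ideal R) where
  len : ℕ
  rank : ℕ → ℕ
  deg : (i : ℕ) → Fin (rank i) → ℤ
  gen : Fin (rank 0) → R
  d : (i : ℕ) → Matrix (Fin (rank i)) (Fin (rank (i + 1))) R
  rank_eq_zero : ∀ i, len ≤ i → rank i = 0
  gen_mem : ∀ b, gen b ∈ intPiece ℛ (deg 0 b)
  d_mem : ∀ i a b, d i a b ∈ intPiece ℛ (deg (i + 1) b - deg i a)
  span_gen : Ideal.span (Set.range gen) = J
  exact_zero : Function.Exact (d 0).mulVecLin (Fintype.linearCombination R gen)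
  exact_succ : ∀ i, Function.Exact (d (i + 1)).mulVecLin (d i).mulVecLin

namespace GradedFreeResolution

variable {ℛ : ℕ → Submodule k R} {J : Ideal R}

/-- The number of summands `R(-j)` of `F_i`. For a minimal resolution these are the graded Betti
numbers of `J`. -/
def betti (F : GradedFreeResolution ℛ J) (i : ℕ) (j : ℤ) : ℕ :=
  Fintype.card {b : Fin (F.rank i) // F.deg i b = j}

/-- When `R_0` is a local ring (for example a field), a graded resolution is minimal when its
matrices have all their entries in the homogeneous maximal ideal; as the entries are homogeneous,
this says that no entry is a unit. -/
def IsMinimal (F : GradedFreeResolution ℛ J) : Prop :=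
  ∀ i a b, ¬ IsUnit (F.d i a b)

/-- `x ^ (d-1) - ∑_{i,j} (-1)^i β_{i,j} (max (x - j/m) 0) ^ (d-1)`, where the `β_{i,j}` are the
Betti numbers of the resolution. -/
def bettiSum (F : GradedFreeResolution ℛ J) (d m : ℕ) (x : ℝ) : ℝ :=
  x ^ (d - 1) - ∑ i ∈ Finset.range F.len, (-1 : ℝ) ^ i *
    ∑ᶠ j : ℤ, (F.betti i j : ℝ) * (max (x - (j : ℝ) / (m : ℝ)) 0) ^ (d - 1)

end GradedFreeResolution

/-- The Hilbert-Kunz density function of `(S, I)` is given on `[0, ∞)` by the graded Betti numbers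
of any finite graded free resolution of the extended ideal `IR`: with `m₀ = gcd {n | S_n ≠ 0}` and
`c = lim_m dim_k S_{m₀ m} / m ^ (d-1) > 0`,
`f_{S,I}(x) = c (x ^ (d-1) - ∑_{i,j} (-1)^i β_{i,j} (max (x - j/m₀) 0) ^ (d-1))`. -/
def DensityGivenByBetti {S : Type*} [CommRing S] [Algebra k S] [Algebra S R] (p d : ℕ)
    (𝒮 : ℕ → Submodule k S) (I : Ideal S) (ℛ : ℕ → Submodule k R) : Prop :=
  ∃ c : ℝ, 0 < c ∧
    Tendsto (fun m : ℕ => (Module.finrank k (𝒮 (degreeGcd 𝒮 * m)) : ℝ) / (m : ℝ) ^ (d - 1))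
      atTop (𝓝 c) ∧
    ∀ F : GradedFreeResolution ℛ (I.map (algebraMap S R)), ∀ x : ℝ, 0 ≤ x →
      hkDensity p d 𝒮 I x = c * F.bettiSum d (degreeGcd 𝒮) x

end Resolution

/-! ### Rings of invariants of linear actions on a polynomial ring -/

section Invariants

open MvPolynomial

variable {k : Type*} [Field k] {d : ℕ}

/-- The grading by polynomial degree on a subalgebra of `k[X_1, …, X_d]`. -/
def inducedGrading (B : Subalgebra k (MvPolynomial (Fin d) k)) (n : ℕ) : Submodule k B :=
  (homogeneousSubmodule (Fin d) k n).comap B.val.toLinearMap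

/-- A subalgebra that contains the homogeneous components of its elements is graded. -/
abbrev inducedGradedAlgebra (B : Subalgebra k (MvPolynomial (Fin d) k))
    (hB : ∀ f ∈ B, ∀ n, homogeneousComponent n f ∈ B) : GradedAlgebra (inducedGrading B) :=
  have one_mem : (1 : B) ∈ inducedGrading B 0 := isHomogeneous_one (Fin d) k
  have mul_mem : ∀ ⦃i j : ℕ⦄ {f g : B}, f ∈ inducedGrading B i → g ∈ inducedGrading B j →
      f * g ∈ inducedGrading B (i + j) := fun _ _ _ _ hf hg => IsHomogeneous.mul hf hg
  have key : ∀ (x : DirectSum ℕ fun n => inducedGrading B n) (n : ℕ),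
      homogeneousComponent n ((DirectSum.coeAddMonoidHom (inducedGrading B) x : B) :
        MvPolynomial (Fin d) k) = ((x n : B) : MvPolynomial (Fin d) k) := by
    intro x n
    induction x using DirectSum.induction_on with
    | zero => simp
    | of i y =>
      rw [DirectSum.coeAddMonoidHom_of]
      have hy : ((y : B) : MvPolynomial (Fin d) k) ∈ homogeneousSubmodule (Fin d) k i := y.2
      rw [homogeneousComponent_of_mem hy]
      by_cases h : n = i
      · subst h; simp
      · simp [h, DirectSum.of_eq_of_ne _ _ _ h]
    | add x y hx hy => simp [hx, hy]
  let dec : B → DirectSum ℕ fun n => inducedGrading B n := fun f =>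
    ∑ n ∈ Finset.range ((f : MvPolynomial (Fin d) k).totalDegree + 1),
      DirectSum.of (fun n => inducedGrading B n) n
        ⟨⟨homogeneousComponent n (f : MvPolynomial (Fin d) k), hB f f.2 n⟩,
          homogeneousComponent_isHomogeneous n (f : MvPolynomial (Fin d) k)⟩
  have left : ∀ f : B, DirectSum.coeAddMonoidHom (inducedGrading B) (dec f) = f := by
    intro f
    apply Subtype.ext
    conv_rhs => rw [← sum_homogeneousComponent (f : MvPolynomial (Fin d) k)]
    simp only [dec, map_sum, DirectSum.coeAddMonoidHom_of, AddSubmonoidClass.coe_finsetSum]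
  { one_mem := one_mem
    mul_mem := mul_mem
    decompose' := dec
    left_inv := left
    right_inv := by
      intro x
      refine DFinsupp.ext fun n => Subtype.ext (Subtype.ext ?_)
      rw [← key x n, ← key _ n, left] }

/-- The linear action of a group element on `k[X_1, …, X_d]`: the matrix `M` acts by
`X_i ↦ ∑_j M_{ji} X_j`. -/
def linearSubst (M : Matrix (Fin d) (Fin d) k) :
    MvPolynomial (Fin d) k →ₐ[k] MvPolynomial (Fin d) k :=
  aeval fun i => ∑ j, C (M j i) * X j

/-- The ring of invariants `k[X_1, …, X_d]^G` of a group `G` acting linearly. -/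
def groupInvariants {G : Type*} [Group G] (ρ : G →* Matrix.GeneralLinearGroup (Fin d) k) :
    Subalgebra k (MvPolynomial (Fin d) k) :=
  ⨅ g : G, AlgHom.equalizer (linearSubst (ρ g : Matrix (Fin d) (Fin d) k))
    (AlgHom.id k (MvPolynomial (Fin d) k))

variable {A : Type*} [CommRing A]

/-- A linear action of the affine group scheme `G = Spec A` on affine space, i.e. a homomorphism
of group schemes `G → GL_d`: a `d × d` matrix `a` over the Hopf algebra `A` with
`Δ(a_{ji}) = ∑_l a_{jl} ⊗ a_{li}` and `ε(a_{ji}) = δ_{ji}`. -/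
structure IsLinearCoaction [HopfAlgebra k A] (a : Matrix (Fin d) (Fin d) A) : Prop where
  comul : ∀ i j, Coalgebra.comul (R := k) (a j i) = ∑ l, a j l ⊗ₜ[k] a l i
  counit : ∀ i j, Coalgebra.counit (R := k) (a j i) = if j = i then 1 else 0

/-- The coaction `k[X_1, …, X_d] → k[X_1, …, X_d] ⊗ A`, `X_i ↦ ∑_j X_j ⊗ a_{ji}`, of the linear
action with matrix `a`. -/
def coaction (k : Type*) [Field k] [Algebra k A] (a : Matrix (Fin d) (Fin d) A) :
    MvPolynomial (Fin d) k →ₐ[k] MvPolynomial (Fin d) k ⊗[k] A :=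
  aeval fun i => ∑ j, (X j : MvPolynomial (Fin d) k) ⊗ₜ[k] a j i

/-- The ring of invariants `{f | coaction f = f ⊗ 1}` of `G = Spec A`. -/
def schemeInvariants (k : Type*) [Field k] [Algebra k A] (a : Matrix (Fin d) (Fin d) A) :
    Subalgebra k (MvPolynomial (Fin d) k) :=
  AlgHom.equalizer (coaction k a) Algebra.TensorProduct.includeLeft

theorem linearSubst_homogeneousComponent (M : Matrix (Fin d) (Fin d) k)
    (f : MvPolynomial (Fin d) k) (n : ℕ) :
    linearSubst M (homogeneousComponent n f) = homogeneousComponent n (linearSubst M f) := by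
  have h : ∀ (m : ℕ) (g : MvPolynomial (Fin d) k), g.IsHomogeneous m →
      (linearSubst M g).IsHomogeneous m := by
    intro m g hg
    have := hg.aeval (fun i => ∑ j, C (M j i) * X j) (n := 1) fun i =>
      IsHomogeneous.sum _ _ _ fun j _ => (isHomogeneous_X k j).C_mul _
    simpa [linearSubst] using this
  conv_rhs => rw [← sum_homogeneousComponent f, map_sum, map_sum]
  have e : ∀ i, homogeneousComponent n (linearSubst M (homogeneousComponent i f)) =
      if n = i then linearSubst M (homogeneousComponent i f) else 0 := fun i =>
    homogeneousComponent_of_mem (h i _ (homogeneousComponent_isHomogeneous i f))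
  simp only [e, Finset.sum_ite_eq, Finset.mem_range]
  split_ifs with hn
  · rfl
  · rw [homogeneousComponent_eq_zero n f (by omega), map_zero]

instance groupInvariants.gradedAlgebra {G : Type*} [Group G] (ρ : G →* Matrix.GeneralLinearGroup (Fin d) k) :
    GradedAlgebra (inducedGrading (groupInvariants ρ)) :=
  inducedGradedAlgebra _ fun f hf n => by
    simp only [groupInvariants, Algebra.mem_iInf, AlgHom.mem_equalizer, AlgHom.coe_id,
      id_eq] at hf ⊢
    intro g
    rw [linearSubst_homogeneousComponent, hf g]

/-- The `k`-span of the tensors `f ⊗ a` with `f` homogeneous of degree `n`. -/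
def tensorPiece (k : Type*) [Field k] (d : ℕ) (A : Type*) [CommRing A] [Algebra k A] (n : ℕ) :
    Submodule k (MvPolynomial (Fin d) k ⊗[k] A) :=
  Submodule.span k {t | ∃ f : MvPolynomial (Fin d) k, f.IsHomogeneous n ∧ ∃ a : A, f ⊗ₜ[k] a = t}

instance tensorPiece.gradedMonoid [Algebra k A] : SetLike.GradedMonoid (tensorPiece k d A) where
  one_mem := Submodule.subset_span ⟨1, isHomogeneous_one _ _, 1, rfl⟩
  mul_mem i j x y hx hy := by
    have h := Submodule.mul_mem_mul hx hy
    rw [tensorPiece, tensorPiece, Submodule.span_mul_span] at h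
    refine Submodule.span_mono ?_ h
    rintro _ ⟨_, ⟨f, hf, a, rfl⟩, _, ⟨g, hg, b, rfl⟩, rfl⟩
    exact ⟨f * g, hf.mul hg, a * b, by simp⟩

theorem coaction_homogeneousComponent [Algebra k A] (a : Matrix (Fin d) (Fin d) A)
    (f : MvPolynomial (Fin d) k) (n : ℕ) :
    coaction k a (homogeneousComponent n f) =
      (homogeneousComponent n).rTensor A (coaction k a f) := by
  have hX : ∀ i, (∑ j, (X j : MvPolynomial (Fin d) k) ⊗ₜ[k] a j i) ∈ tensorPiece k d A 1 :=
    fun i => Submodule.sum_mem _ fun j _ =>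
      Submodule.subset_span ⟨X j, isHomogeneous_X _ _, a j i, rfl⟩
  have hmon : ∀ (s : Fin d →₀ ℕ) (c : k),
      coaction k a (monomial s c) ∈ tensorPiece k d A s.degree := by
    intro s c
    rw [coaction, aeval_monomial, ← Algebra.smul_def]
    refine Submodule.smul_mem _ _ ?_
    have := SetLike.prod_pow_mem_graded (tensorPiece k d A) (F := s.support) (fun _ => 1)
      (fun i => ∑ j, (X j : MvPolynomial (Fin d) k) ⊗ₜ[k] a j i) s (fun i _ => hX i)
    simpa [Finsupp.prod, Finsupp.degree_apply] using this
  have hcomp : ∀ (m : ℕ) (t : MvPolynomial (Fin d) k ⊗[k] A), t ∈ tensorPiece k d A m →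
      (homogeneousComponent n).rTensor A t = if n = m then t else 0 := by
    intro m t ht
    induction ht using Submodule.span_induction with
    | mem t ht =>
      obtain ⟨g, hg, b, rfl⟩ := ht
      rw [LinearMap.rTensor_tmul, homogeneousComponent_of_mem hg]
      split_ifs <;> simp
    | zero => simp
    | add x y _ _ hx hy => rw [map_add, hx, hy]; split_ifs <;> simp
    | smul c x _ hx => rw [map_smul, hx]; split_ifs <;> simp
  have hm : ∀ (s : Fin d →₀ ℕ) (c : k), coaction k a (homogeneousComponent n (monomial s c)) =
      (homogeneousComponent n).rTensor A (coaction k a (monomial s c)) := by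
    intro s c
    rw [hcomp _ _ (hmon s c),
      homogeneousComponent_of_mem (isHomogeneous_monomial (R := k) c rfl)]
    split_ifs <;> simp
  rw [f.as_sum]
  simp only [map_sum, hm]

instance schemeInvariants.gradedAlgebra [Algebra k A] (a : Matrix (Fin d) (Fin d) A) :
    GradedAlgebra (inducedGrading (schemeInvariants k a)) :=
  inducedGradedAlgebra _ fun f hf n => by
    simp only [schemeInvariants, AlgHom.mem_equalizer] at hf ⊢
    rw [coaction_homogeneousComponent, hf]
    simp

end Invariants
end

/-!
The density function is computed over the extension ring `R`. Three ingredients are needed.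

*Frobenius powers of `IR`.* Suppose that `R_0` is local and let `F` be a minimal graded free
resolution of `IR`. By `Ideal.exists_minimalComplex_rank_eq_zero` it is finite, as `R/IR` has
finite projective dimension. Raising the entries of the matrices of `F` to their `q`-th powers
gives, by a theorem of Peskine and Szpiro (`exactAt_frobenius`), a resolution of
`(IR)^[q] = I^[q]R`. Indeed, every prime that contains `IR` contains all entries of the matrices
(`IsGradedPair.homogeneousMaximalIdeal_le`); this implies, as in the formula of Auslander and
Buchsbaum, that `IR` contains a regular sequence as long as the resolution of `R/IR`
(`exists_isWeaklyRegular`). The elements of `IR` act on this resolution as zero up to homotopy,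
hence so do their `q`-th powers on its Frobenius pullback, which is exact by the acyclicity lemma
(`exactAt_of_isWeaklyRegular`). So the Hilbert function of `I^[q]R` in degree `t` is
`∑ (-1)^i β_{i,j} H_R(t - qj)` (`GradedFreeResolution.idealHilbertFn_frobeniusPower`).

*Comparison of `S` and `R`.* A maximal set of homogeneous elements of `R` that are linearly
independent over `S` (`HomogeneousFrame`) embeds a direct sum of `r` shifted copies of `S` into
`R`, and a nonzero element of `S` multiplies `R` back into this direct sum. So, summed over `m₀`
consecutive degrees, the Hilbert functions of `I^[q]R` and `R` are `r` times those of `I^[q]` and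
`S`, up to shifts of the degree that do not depend on `q`; these contribute errors of lower order.
A Noether normalization by elements of one degree shows that `dim S_{m₀ m}` grows as `c m^(d-1)`
with `c > 0` (`exists_hasGrowth`). Dividing by `q^(d-1)` gives the uniform limit
`c (x^(d-1) - ∑ (-1)^i β_{i,j} max(x - j/m₀, 0)^(d-1))` (`IsGradedPair.exists_density`). This is a
piecewise polynomial, equal to `c x^(d-1)` for small `x` since `I^[q]` has no elements of degree
less than `q`. Two resolutions of `IR` have the same alternating sums of degrees, because these
are determined by the Hilbert functions of `IR` and `R` (`GradedFreeResolution.altSum_eq_altSum`),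
so any finite resolution can be used in the formula.

*Reduction to local `R_0`.* In general `R_0` is a finite-dimensional `k`-algebra. As `S` is a
domain, some primitive idempotent `e` of `R_0` is annihilated by no nonzero element of `S`, and
`R` may be replaced by its direct factor `eR`
(`IsGradedPair.density_of_projectiveDimension_lt_top`).

For rings of invariants it remains to see that the polynomial ring is integral over them, since
ideals of the polynomial ring have finite minimal resolutions
(`exists_minimal_resolution_mvPolynomial`). For a group, `f` is a root of `∏ (T - g f)`. For a
group scheme `Spec A`, it is a root of the characteristic polynomial of the multiplication by the
coaction of `f` on `k[X] ⊗ A`, whose coefficients are invariant (`IsLinearCoaction.isIntegral`).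
-/

open Filter Topology
open scoped TensorProduct

universe u

noncomputable section

/-! ### Complexes of free modules, acyclicity and depth -/

section MatrixAction

variable {R : Type*} [CommRing R] {l m n : Type*} [Fintype n]

/-- The map `M^n → M^m` given by an `m × n` matrix over `R`, for any `R`-module `M`; this is
`A.mulVecLin ⊗ M`. -/
def matrixAction (M : Type*) [AddCommGroup M] [Module R M] (A : Matrix m n R) :
    (n → M) →ₗ[R] (m → M) where
  toFun v a := ∑ b, A a b • v b
  map_add' v w := by ext a; simp [Finset.sum_add_distrib]
  map_smul' r v := by ext a; simp [Finset.smul_sum, smul_comm r]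

variable {M N : Type*} [AddCommGroup M] [Module R M] [AddCommGroup N] [Module R N]

theorem matrixAction_apply (A : Matrix m n R) (v : n → M) (a : m) :
    matrixAction M A v a = ∑ b, A a b • v b := rfl

theorem matrixAction_self (A : Matrix m n R) : matrixAction R A = A.mulVecLin := by
  ext v a; simp [matrixAction_apply, Matrix.mulVec, dotProduct]

theorem matrixAction_mul [Fintype m] (A : Matrix l m R) (B : Matrix m n R) (v : n → M) :
    matrixAction M (A * B) v = matrixAction M A (matrixAction M B v) := by
  ext a
  simp only [matrixAction_apply, Matrix.mul_apply, Finset.sum_smul, Finset.smul_sum, smul_smul]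
  rw [Finset.sum_comm]

theorem matrixAction_add (A B : Matrix m n R) (v : n → M) :
    matrixAction M (A + B) v = matrixAction M A v + matrixAction M B v := by
  ext a; simp [matrixAction_apply, add_smul, Finset.sum_add_distrib]

theorem matrixAction_zero (v : n → M) : matrixAction M (0 : Matrix m n R) v = 0 := by
  ext a; simp [matrixAction_apply]

theorem matrixAction_smul_one [DecidableEq n] (x : R) (v : n → M) :
    matrixAction M (x • (1 : Matrix n n R)) v = x • v := by
  ext a; simp [matrixAction_apply, Matrix.one_apply, ite_smul]

theorem matrixAction_map (f : M →ₗ[R] N) (A : Matrix m n R) (v : n → M) :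
    matrixAction N A (fun b => f (v b)) = fun a => f (matrixAction M A v a) := by
  ext a; simp [matrixAction_apply]

end MatrixAction

section Complexes

open scoped Pointwise

variable {R : Type*} [CommRing R] {c : ℕ → ℕ}

/-- Exactness of `M ⊗ (⋯ → R^{c (i+2)} → R^{c (i+1)} → R^{c i} → ⋯)` in position `i + 1`. -/
def ExactAt (D : ∀ i, Matrix (Fin (c i)) (Fin (c (i + 1))) R) (M : Type*) [AddCommGroup M]
    [Module R M] (i : ℕ) : Prop :=
  Function.Exact (matrixAction M (D (i + 1))) (matrixAction M (D i))

theorem ExactAt.mul_eq_zero {D : ∀ i, Matrix (Fin (c i)) (Fin (c (i + 1))) R} {i : ℕ}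
    (h : ExactAt D R i) : D i * D (i + 1) = 0 := by
  ext a b
  have := (h _).2 ⟨Pi.single b 1, rfl⟩
  rw [← matrixAction_mul] at this
  simpa [matrixAction_apply, Pi.single_apply] using congrFun this a

theorem exactAt_of_eq_zero (D : ∀ i, Matrix (Fin (c i)) (Fin (c (i + 1))) R) (M : Type*)
    [AddCommGroup M] [Module R M] (i : ℕ) (h : c (i + 1) = 0) : ExactAt D M i := by
  intro v
  have : IsEmpty (Fin (c (i + 1))) := by rw [h]; infer_instance
  have hv : v = 0 := Subsingleton.elim _ _
  subst hv
  simp only [map_zero, true_iff]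
  exact ⟨0, map_zero _⟩

variable {D : ∀ i, Matrix (Fin (c i)) (Fin (c (i + 1))) R}
  {M : Type*} [AddCommGroup M] [Module R M]

theorem QuotSMulTop.exists_lift (x : R) {n : Type*} (v : n → QuotSMulTop x M) :
    ∃ w : n → M, v = fun i => Submodule.mkQ (x • (⊤ : Submodule R M)) (w i) := by
  choose w hw using fun i => Submodule.mkQ_surjective (x • (⊤ : Submodule R M)) (v i)
  exact ⟨w, funext fun i => (hw i).symm⟩

theorem QuotSMulTop.exists_smul (x : R) {n : Type*} (w : n → M)
    (h : (fun i => Submodule.mkQ (x • (⊤ : Submodule R M)) (w i)) = 0) : ∃ u : n → M, w = x • u := by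
  have : ∀ i, ∃ u, w i = x • u := fun i => by
    have := congrFun h i
    rw [Submodule.mkQ_apply, Pi.zero_apply, Submodule.Quotient.mk_eq_zero,
      Submodule.mem_smul_pointwise_iff_exists] at this
    obtain ⟨u, -, hu⟩ := this
    exact ⟨u, hu.symm⟩
  choose u hu using this
  exact ⟨u, funext hu⟩

theorem IsSMulRegular.pi_eq_zero {x : R} (hx : IsSMulRegular M x) {n : Type*} {v : n → M}
    (h : x • v = 0) : v = 0 :=
  funext fun i => hx.right_eq_zero_of_smul (congrFun h i)

/-- Part of the long exact homology sequence of `0 → M → M → M/xM → 0`. -/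
theorem ExactAt.quotSMulTop (hD : ∀ i, D i * D (i + 1) = 0) {x : R} (hx : IsSMulRegular M x)
    {i : ℕ} (h₀ : ExactAt D M i) (h₁ : ExactAt D M (i + 1)) :
    ExactAt D (QuotSMulTop x M) (i + 1) := by
  intro v
  constructor
  · intro hv
    obtain ⟨w, rfl⟩ := QuotSMulTop.exists_lift x v
    rw [matrixAction_map] at hv
    obtain ⟨u, hu⟩ := QuotSMulTop.exists_smul x _ hv
    have h1 : matrixAction M (D i) u = 0 := by
      apply hx.pi_eq_zero
      rw [← map_smul, ← hu, ← matrixAction_mul, hD, matrixAction_zero]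
    obtain ⟨t, rfl⟩ := (h₀ u).1 h1
    obtain ⟨z, hz⟩ := (h₁ (w - x • t)).1 (by rw [map_sub, map_smul, hu, sub_self])
    refine ⟨fun b => Submodule.mkQ _ (z b), ?_⟩
    rw [matrixAction_map, hz]
    funext a
    rw [Submodule.mkQ_apply, Submodule.mkQ_apply, Submodule.Quotient.eq]
    rw [Submodule.mem_smul_pointwise_iff_exists]
    exact ⟨-t a, trivial, by simp⟩
  · rintro ⟨u, rfl⟩
    rw [← matrixAction_mul, hD, matrixAction_zero]

/-- If `M/xM ⊗ F` is exact in position `i + 1`, then `x` acts injectively on the homology of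
`M ⊗ F` in position `i`. -/
theorem mem_range_of_smul_mem_range (hD : ∀ i, D i * D (i + 1) = 0) {x : R}
    (hx : IsSMulRegular M x) {i : ℕ} (h : ExactAt D (QuotSMulTop x M) (i + 1))
    {v : Fin (c (i + 1)) → M}
    (hxv : x • v ∈ LinearMap.range (matrixAction M (D (i + 1)))) :
    v ∈ LinearMap.range (matrixAction M (D (i + 1))) := by
  obtain ⟨u, hu⟩ := hxv
  obtain ⟨z, hz⟩ := (h (fun b => Submodule.mkQ _ (u b))).1 (by
    rw [matrixAction_map, hu]
    funext a
    rw [Submodule.mkQ_apply, Pi.zero_apply, Submodule.Quotient.mk_eq_zero,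
      Submodule.mem_smul_pointwise_iff_exists]
    exact ⟨v a, trivial, rfl⟩)
  obtain ⟨z, rfl⟩ := QuotSMulTop.exists_lift x z
  rw [matrixAction_map] at hz
  obtain ⟨w, hw⟩ := QuotSMulTop.exists_smul x (u - matrixAction M (D (i + 1 + 1)) z) (by
    funext a
    have := congrFun hz a
    rw [Pi.sub_apply, map_sub, this, sub_self, Pi.zero_apply])
  refine ⟨w, ?_⟩
  have h2 : x • (matrixAction M (D (i + 1)) w - v) = 0 := by
    rw [smul_sub, ← map_smul, ← hw, map_sub, hu, ← matrixAction_mul, hD, matrixAction_zero]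
    simp
  exact sub_eq_zero.1 (hx.pi_eq_zero h2)

theorem mem_range_of_pow_smul_mem_range (hD : ∀ i, D i * D (i + 1) = 0) {x : R}
    (hx : IsSMulRegular M x) {i : ℕ} (h : ExactAt D (QuotSMulTop x M) (i + 1)) (N : ℕ)
    {v : Fin (c (i + 1)) → M}
    (hxv : x ^ N • v ∈ LinearMap.range (matrixAction M (D (i + 1)))) :
    v ∈ LinearMap.range (matrixAction M (D (i + 1))) := by
  induction N with
  | zero => simpa using hxv
  | succ N ih =>
    rw [pow_succ', mul_smul] at hxv
    exact ih (mem_range_of_smul_mem_range hD hx h hxv)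

/-- Multiplication by `y` is homotopic to zero on the complex with differentials `D`, in positions
`≥ 1`. -/
def IsNullHomotopic (D : ∀ i, Matrix (Fin (c i)) (Fin (c (i + 1))) R) (y : R) : Prop :=
  ∃ h : ∀ i, Matrix (Fin (c (i + 1))) (Fin (c i)) R,
    ∀ i, h i * D i + D (i + 1) * h (i + 1) = y • 1

theorem IsNullHomotopic.smul_mem_range {y : R} (h : IsNullHomotopic D y) {i : ℕ}
    {v : Fin (c (i + 1)) → M} (hv : matrixAction M (D i) v = 0) :
    y • v ∈ LinearMap.range (matrixAction M (D (i + 1))) := by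
  obtain ⟨h, hh⟩ := h
  refine ⟨matrixAction M (h (i + 1)) v, ?_⟩
  rw [← matrixAction_mul, ← matrixAction_smul_one, ← hh i, matrixAction_add, matrixAction_mul (h i), hv,
    map_zero, zero_add]

/-- The acyclicity lemma of Peskine and Szpiro: if a complex of free modules has length at most
the length of an `M`-regular sequence whose members have powers that act on the complex as zero up
to homotopy, then `M ⊗ F` is exact in positive positions. The induction on the sequence gives
exactness in all positions above the difference of the lengths. -/
theorem exactAt_of_isWeaklyRegular {R : Type*} [CommRing R] {c : ℕ → ℕ}
    {D : ∀ i, Matrix (Fin (c i)) (Fin (c (i + 1))) R} (hD : ∀ i, D i * D (i + 1) = 0) {r : ℕ}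
    (hr : ∀ i, r < i → c i = 0) (rs : List R) :
    ∀ (M : Type*) [AddCommGroup M] [Module R M] (_ : RingTheory.Sequence.IsWeaklyRegular M rs)
      (_ : ∀ x ∈ rs, ∃ N : ℕ, IsNullHomotopic D (x ^ N)) (i : ℕ), r < i + 1 + rs.length →
      ExactAt D M i := by
  induction rs with
  | nil =>
    intro M _ _ _ _ i hi
    exact exactAt_of_eq_zero D M i (hr _ (by simpa using hi))
  | cons x rs ih =>
    intro M _ _ hreg hnull i hi
    rw [RingTheory.Sequence.isWeaklyRegular_cons_iff] at hreg
    have h1 := ih (QuotSMulTop x M) hreg.2 (fun y hy => hnull y (List.mem_cons_of_mem _ hy)) (i + 1)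
      (by rw [List.length_cons] at hi; omega)
    obtain ⟨N, hN⟩ := hnull x List.mem_cons_self
    intro v
    constructor
    · intro hv
      exact mem_range_of_pow_smul_mem_range hD hreg.1 h1 N (hN.smul_mem_range hv)
    · rintro ⟨u, rfl⟩
      rw [← matrixAction_mul, hD, matrixAction_zero]

/-- An ideal `J` contains an `M`-regular element if `M` has no nonzero element killed by an ideal
`𝔪` that lies in all primes containing `J`. -/
theorem exists_isSMulRegular_mem {R : Type*} [CommRing R] [IsNoetherianRing R] (M : Type*)
    [AddCommGroup M] [Module R M] [Module.Finite R M] (J 𝔪 : Ideal R)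
    (hJ : ∀ P : Ideal R, P.IsPrime → J ≤ P → 𝔪 ≤ P)
    (h𝔪 : ∀ m : M, (∀ a ∈ 𝔪, a • m = 0) → m = 0) : ∃ x ∈ J, IsSMulRegular M x := by
  by_contra! hcon
  have hsub : (J : Set R) ⊆ ⋃ P ∈ associatedPrimes R M, ((id P : Ideal R) : Set R) := by
    intro x hx
    have := biUnion_associatedPrimes_eq_compl_regular R M
    have h2 : x ∈ {r : R | IsSMulRegular M r}ᶜ := hcon x hx
    rw [← this] at h2
    simpa using h2
  obtain ⟨P, hP, hJP⟩ := (Ideal.subset_union_prime_finite (associatedPrimes.finite R M) (f := id)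
    0 0 (fun P hP _ _ => hP.isPrime)).1 hsub
  have h1 := hJ P hP.isPrime hJP
  obtain ⟨hprime, m, hm⟩ := (isAssociatedPrime_iff).1 hP
  have : m = 0 := h𝔪 m fun a ha => by
    have := h1 ha
    rw [hm] at this
    simpa using this
  subst this
  apply hprime.ne_top
  rw [hm, Ideal.eq_top_iff_one]
  simp

/-- The depth estimate of Auslander and Buchsbaum: if `M ⊗ F` is exact in positions above `t`, and
the last differential of `F` is minimal, then `J` contains an `M`-regular sequence whose length is
the length of `F` minus `t`. -/
theorem exists_isWeaklyRegular {R : Type u} [CommRing R] [IsNoetherianRing R] {c : ℕ → ℕ}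
    {D : ∀ i, Matrix (Fin (c i)) (Fin (c (i + 1))) R} (hD : ∀ i, D i * D (i + 1) = 0) {r : ℕ}
    (hr : ∀ i, r < i → c i = 0) (hcr : c r ≠ 0) (J 𝔪 : Ideal R)
    (hJ : ∀ P : Ideal R, P.IsPrime → J ≤ P → 𝔪 ≤ P) (hmin : ∀ i a b, D i a b ∈ 𝔪) (s : ℕ) :
    ∀ (M : Type u) [AddCommGroup M] [Module R M] [Module.Finite R M] (t : ℕ), t + s = r →
      (∀ i, t < i + 1 → ExactAt D M i) →
      ∃ rs : List R, rs.length = s ∧ (∀ x ∈ rs, x ∈ J) ∧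
        RingTheory.Sequence.IsWeaklyRegular M rs := by
  induction s with
  | zero => intro M _ _ _ t _ _; exact ⟨[], rfl, by simp, RingTheory.Sequence.IsWeaklyRegular.nil R M⟩
  | succ s ih =>
    intro M _ _ _ t hts hex
    obtain ⟨x, hxJ, hx⟩ := exists_isSMulRegular_mem M J 𝔪 hJ (fun m hm => by
      obtain ⟨j, rfl⟩ : ∃ j, r = j + 1 := ⟨t + s, by omega⟩
      have h1 := (hex j (by omega) (fun _ => m)).1 (by
        ext a
        rw [matrixAction_apply]
        exact Finset.sum_eq_zero fun b _ => hm _ (hmin _ _ _))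
      obtain ⟨u, hu⟩ := h1
      have : IsEmpty (Fin (c (j + 1 + 1))) := by rw [hr _ (by omega)]; infer_instance
      have hu0 : u = 0 := Subsingleton.elim _ _
      rw [hu0, map_zero] at hu
      exact (congrFun hu ⟨0, Nat.pos_of_ne_zero hcr⟩).symm)
    obtain ⟨rs, h1, h2, h3⟩ := ih (QuotSMulTop x M) (t + 1) (by omega) (fun i hi => by
      obtain ⟨j, rfl⟩ : ∃ j, i = j + 1 := ⟨i - 1, by omega⟩
      exact (hex j (by omega)).quotSMulTop hD hx (hex (j + 1) (by omega)))
    exact ⟨x :: rs, by simp [h1], by simpa using ⟨hxJ, h2⟩,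
      RingTheory.Sequence.IsWeaklyRegular.cons hx h3⟩

/-- A free module lifts through an exact sequence, in matrix form. -/
theorem exists_matrix_mul_eq {l m n p : Type*} [Fintype m]
    [Fintype n] (A : Matrix l m R) (B : Matrix m n R)
    (hex : Function.Exact (matrixAction R B) (matrixAction R A)) (C : Matrix m p R)
    (hC : A * C = 0) : ∃ X : Matrix n p R, B * X = C := by
  have : ∀ j, ∃ x : n → R, matrixAction R B x = fun i => C i j := fun j => (hex _).1 (by
    ext a
    have := congrFun (congrFun hC a) j
    rw [Matrix.mul_apply] at this
    simpa [matrixAction_apply] using this)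
  choose x hx using this
  refine ⟨Matrix.of fun i j => x j i, ?_⟩
  ext i j
  have := congrFun (hx j) i
  rw [Matrix.mul_apply]
  simpa [matrixAction_apply] using this

/-- Multiplication by an element of `J` is homotopic to zero on a free resolution of `R/J`. -/
theorem isNullHomotopic_of_mem (hD : ∀ i, D i * D (i + 1) = 0) (hex : ∀ i, ExactAt D R i) {y : R}
    (h₀ : ∃ h : Matrix (Fin (c 1)) (Fin (c 0)) R, D 0 * h = y • 1) : IsNullHomotopic D y := by
  classical
  let P (i : ℕ) (h : Matrix (Fin (c (i + 1))) (Fin (c i)) R) : Prop := D i * (y • 1 - h * D i) = 0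
  have step : ∀ i (h : Matrix (Fin (c (i + 1))) (Fin (c i)) R), P i h →
      ∃ h' : Matrix (Fin (c (i + 1 + 1))) (Fin (c (i + 1))) R,
        h * D i + D (i + 1) * h' = y • 1 ∧ P (i + 1) h' := by
    intro i h hP
    obtain ⟨X, hX⟩ := exists_matrix_mul_eq (D i) (D (i + 1)) (hex i) _ hP
    refine ⟨X, by rw [hX]; abel, ?_⟩
    change D (i + 1) * (y • 1 - X * D (i + 1)) = 0
    rw [Matrix.mul_sub, ← Matrix.mul_assoc, hX, Matrix.sub_mul, Matrix.mul_assoc h, hD]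
    simp
  obtain ⟨h0, hh0⟩ := h₀
  have hP0 : P 0 h0 := by
    change D 0 * (y • 1 - h0 * D 0) = 0
    rw [Matrix.mul_sub, ← Matrix.mul_assoc, hh0]
    simp
  let H : ∀ i, {h : Matrix (Fin (c (i + 1))) (Fin (c i)) R // P i h} := fun i =>
    Nat.rec ⟨h0, hP0⟩ (fun i h => ⟨(step i h.1 h.2).choose, (step i h.1 h.2).choose_spec.2⟩) i
  exact ⟨fun i => (H i).1, fun i => (step i (H i).1 (H i).2).choose_spec.1⟩

theorem IsNullHomotopic.map {R' : Type*} [CommRing R'] (f : R →+* R') {y : R}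
    (h : IsNullHomotopic D y) : IsNullHomotopic (fun i => (D i).map f) (f y) := by
  obtain ⟨h, hh⟩ := h
  refine ⟨fun i => (h i).map f, fun i => ?_⟩
  have := congrArg (fun A => Matrix.map A f) (hh i)
  simp only [Matrix.map_add f (map_add f), Matrix.map_mul] at this
  rw [this]
  ext a b
  simp only [Matrix.map_apply, Matrix.smul_apply, Matrix.one_apply, smul_eq_mul, map_mul]
  split_ifs <;> simp

/-- A theorem of Peskine and Szpiro: the Frobenius pullback of a finite minimal free resolution of
`R/J` is exact in positive positions. -/
theorem exactAt_frobenius {R : Type*} [CommRing R] [IsNoetherianRing R] (p : ℕ) [ExpChar R p]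
    {c : ℕ → ℕ} {D : ∀ i, Matrix (Fin (c i)) (Fin (c (i + 1))) R} (hex : ∀ i, ExactAt D R i)
    {r : ℕ} (hr : ∀ i, r < i → c i = 0) (J 𝔪 : Ideal R)
    (hJ : ∀ P : Ideal R, P.IsPrime → J ≤ P → 𝔪 ≤ P) (hmin : ∀ i a b, D i a b ∈ 𝔪)
    (h₀ : ∀ y ∈ J, ∃ h : Matrix (Fin (c 1)) (Fin (c 0)) R, D 0 * h = y • 1) (n i : ℕ) :
    ExactAt (fun i => (D i).map (iterateFrobenius R p n)) R i := by
  have hD : ∀ i, D i * D (i + 1) = 0 := fun i => (hex i).mul_eq_zero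
  have hD' : ∀ i, (D i).map (iterateFrobenius R p n) * (D (i + 1)).map (iterateFrobenius R p n) = 0 :=
    fun i => by rw [← Matrix.map_mul, hD]; ext; simp
  -- the length of the complex, if it is not zero
  by_cases hc : ∃ i, c i ≠ 0
  · obtain ⟨r', hr', hcr'⟩ : ∃ r', (∀ i, r' < i → c i = 0) ∧ c r' ≠ 0 := by
      obtain ⟨i₀, hi₀⟩ := hc
      classical
      refine ⟨Nat.findGreatest (fun i => c i ≠ 0) r, fun i hi => ?_, ?_⟩
      · by_cases hir : i ≤ r
        · by_contra h
          exact absurd (Nat.le_findGreatest (P := fun i => c i ≠ 0) hir h) (not_le.2 hi)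
        · exact hr i (by omega)
      · have : i₀ ≤ r := by by_contra h; exact hi₀ (hr _ (by omega))
        exact Nat.findGreatest_spec (P := fun i => c i ≠ 0) this hi₀
    obtain ⟨rs, h1, h2, h3⟩ := exists_isWeaklyRegular hD hr' hcr' J 𝔪 hJ hmin r' R 0 (by simp)
      (fun i _ => hex i)
    refine exactAt_of_isWeaklyRegular hD' hr' rs R h3 (fun x hx => ⟨p ^ n, ?_⟩) i (by omega)
    have := (isNullHomotopic_of_mem hD hex (h₀ x (h2 x hx))).map (iterateFrobenius R p n)
    rwa [iterateFrobenius_def] at this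
  · push Not at hc
    exact exactAt_of_eq_zero _ _ _ (hc _)

end Complexes

/-! ### Graded free complexes and their Hilbert functions -/

section GradedComplexes

variable {k R : Type*} [Field k] [CommRing R] [Algebra k R] (ℛ : ℕ → Submodule k R)

theorem intPiece_of_nonneg {j : ℤ} (h : 0 ≤ j) : intPiece ℛ j = ℛ j.toNat := if_pos h

theorem intPiece_of_neg {j : ℤ} (h : j < 0) : intPiece ℛ j = ⊥ := if_neg (not_le.2 h)

@[simp] theorem intPiece_natCast (n : ℕ) : intPiece ℛ (n : ℤ) = ℛ n := by
  rw [intPiece_of_nonneg ℛ (Int.natCast_nonneg n), Int.toNat_natCast]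

/-- The Hilbert function of a graded ring, extended by zero to negative degrees. -/
def hilbertFn (j : ℤ) : ℕ := Module.finrank k (intPiece ℛ j)

theorem hilbertFn_of_neg {j : ℤ} (h : j < 0) : hilbertFn ℛ j = 0 := by
  rw [hilbertFn, intPiece_of_neg ℛ h, finrank_bot]

theorem hilbertFn_natCast (n : ℕ) : hilbertFn ℛ n = Module.finrank k (ℛ n) := by
  rw [hilbertFn, intPiece_natCast]

instance intPiece.finite [∀ n, Module.Finite k (ℛ n)] (j : ℤ) : Module.Finite k (intPiece ℛ j) := by
  by_cases h : 0 ≤ j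
  · rw [intPiece_of_nonneg ℛ h]; infer_instance
  · rw [intPiece_of_neg ℛ (not_le.1 h)]; infer_instance

variable [GradedAlgebra ℛ]

theorem mul_mem_intPiece {i j : ℤ} {x y : R} (hx : x ∈ intPiece ℛ i) (hy : y ∈ intPiece ℛ j) :
    x * y ∈ intPiece ℛ (i + j) := by
  rcases lt_or_ge i 0 with hi | hi
  · rw [intPiece_of_neg ℛ hi, Submodule.mem_bot] at hx
    rw [hx, zero_mul]; exact zero_mem _
  rcases lt_or_ge j 0 with hj | hj
  · rw [intPiece_of_neg ℛ hj, Submodule.mem_bot] at hy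
    rw [hy, mul_zero]; exact zero_mem _
  rw [intPiece_of_nonneg ℛ hi] at hx
  rw [intPiece_of_nonneg ℛ hj] at hy
  rw [intPiece_of_nonneg ℛ (by omega), Int.toNat_add hi hj]
  exact SetLike.mul_mem_graded hx hy

theorem pow_mem_intPiece {j : ℤ} {x : R} (hx : x ∈ intPiece ℛ j) (n : ℕ) :
    x ^ n ∈ intPiece ℛ (n * j) := by
  induction n with
  | zero =>
    have : (1 : R) ∈ intPiece ℛ ((0 : ℕ) : ℤ) := by
      rw [intPiece_natCast]; exact SetLike.one_mem_graded ℛ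
    simpa using this
  | succ n ih =>
    rw [pow_succ, Nat.cast_succ, add_mul, one_mul]
    exact mul_mem_intPiece ℛ ih hx

/-- The projection to the component of degree `j`, for an integer `j`. -/
def projZ (j : ℤ) : R →ₗ[k] R := if 0 ≤ j then GradedAlgebra.proj ℛ j.toNat else 0

theorem projZ_of_nonneg {j : ℤ} (h : 0 ≤ j) (x : R) :
    projZ ℛ j x = (DirectSum.decompose ℛ x j.toNat : R) := by
  rw [projZ, if_pos h, GradedAlgebra.proj_apply]

theorem projZ_of_neg {j : ℤ} (h : j < 0) (x : R) : projZ ℛ j x = 0 := by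
  rw [projZ, if_neg (not_le.2 h), LinearMap.zero_apply]

theorem projZ_mem (j : ℤ) (x : R) : projZ ℛ j x ∈ intPiece ℛ j := by
  rcases lt_or_ge j 0 with h | h
  · rw [projZ_of_neg ℛ h]; exact zero_mem _
  · rw [projZ_of_nonneg ℛ h, intPiece_of_nonneg ℛ h]; exact SetLike.coe_mem _

theorem projZ_of_mem {j : ℤ} {x : R} (hx : x ∈ intPiece ℛ j) : projZ ℛ j x = x := by
  rcases lt_or_ge j 0 with h | h
  · rw [intPiece_of_neg ℛ h, Submodule.mem_bot] at hx
    rw [hx, map_zero]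
  · rw [intPiece_of_nonneg ℛ h] at hx
    rw [projZ_of_nonneg ℛ h, DirectSum.decompose_of_mem_same ℛ hx]

theorem projZ_of_mem_ne {i j : ℤ} {x : R} (hx : x ∈ intPiece ℛ i) (hij : i ≠ j) :
    projZ ℛ j x = 0 := by
  rcases lt_or_ge j 0 with h | h
  · exact projZ_of_neg ℛ h x
  rcases lt_or_ge i 0 with h' | h'
  · rw [intPiece_of_neg ℛ h', Submodule.mem_bot] at hx
    rw [hx, map_zero]
  · rw [intPiece_of_nonneg ℛ h'] at hx
    rw [projZ_of_nonneg ℛ h, DirectSum.decompose_of_mem_ne ℛ hx (by omega)]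

theorem projZ_mul {i : ℤ} {a : R} (ha : a ∈ intPiece ℛ i) (j : ℤ) (b : R) :
    projZ ℛ j (a * b) = a * projZ ℛ (j - i) b := by
  rcases lt_or_ge i 0 with hi | hi
  · rw [intPiece_of_neg ℛ hi, Submodule.mem_bot] at ha
    rw [ha, zero_mul, map_zero, zero_mul]
  rw [intPiece_of_nonneg ℛ hi] at ha
  rcases lt_or_ge j 0 with hj | hj
  · rw [projZ_of_neg ℛ hj, projZ_of_neg ℛ (by omega), mul_zero]
  rw [projZ_of_nonneg ℛ hj]
  rcases lt_or_ge (j - i) 0 with h | h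
  · rw [projZ_of_neg ℛ h, mul_zero, DirectSum.coe_decompose_mul_of_left_mem_of_not_le ℛ ha (by omega)]
  · rw [projZ_of_nonneg ℛ h, DirectSum.coe_decompose_mul_of_left_mem_of_le ℛ ha (by omega),
      show (j - i).toNat = j.toNat - i.toNat by omega]

theorem exists_sum_projZ (x : R) :
    ∃ s : Finset ℤ, ∀ t : Finset ℤ, s ⊆ t → ∑ j ∈ t, projZ ℛ j x = x := by
  classical
  refine ⟨(DirectSum.decompose ℛ x).support.map ⟨Int.ofNat, Int.ofNat_injective⟩, fun t ht => ?_⟩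
  rw [← Finset.sum_subset ht]
  · rw [Finset.sum_map]
    conv_rhs => rw [← DirectSum.sum_support_decompose ℛ x]
    refine Finset.sum_congr rfl fun n _ => ?_
    exact projZ_of_nonneg ℛ (Int.natCast_nonneg n) x
  · intro j _ hj
    rcases lt_or_ge j 0 with h | h
    · exact projZ_of_neg ℛ h x
    · rw [projZ_of_nonneg ℛ h]
      by_contra hne
      apply hj
      rw [Finset.mem_map]
      refine ⟨j.toNat, ?_, by simp [h]⟩
      rw [DFinsupp.mem_support_iff]
      intro h0
      exact hne (by rw [h0]; rfl)

theorem eq_zero_of_projZ {x : R} (h : ∀ j, projZ ℛ j x = 0) : x = 0 := by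
  obtain ⟨s, hs⟩ := exists_sum_projZ ℛ x
  rw [← hs s subset_rfl]
  exact Finset.sum_eq_zero fun j _ => h j

variable {ι κ : Type*}

/-- The component of degree `t` of an element of `⊕_a R(-deg a)`. -/
def vecProj (deg : ι → ℤ) (t : ℤ) : (ι → R) →ₗ[k] (ι → R) :=
  LinearMap.pi fun a => projZ ℛ (t - deg a) ∘ₗ LinearMap.proj a

@[simp] theorem vecProj_apply (deg : ι → ℤ) (t : ℤ) (v : ι → R) (a : ι) :
    vecProj ℛ deg t v a = projZ ℛ (t - deg a) (v a) := rfl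

omit [GradedAlgebra ℛ] in
/-- The piece of degree `t` of `⊕_a R(-deg a)`. -/
def vecPiece (deg : ι → ℤ) (t : ℤ) : Submodule k (ι → R) :=
  Submodule.pi Set.univ fun a => intPiece ℛ (t - deg a)

omit [GradedAlgebra ℛ] in
theorem mem_vecPiece {deg : ι → ℤ} {t : ℤ} {v : ι → R} :
    v ∈ vecPiece ℛ deg t ↔ ∀ a, v a ∈ intPiece ℛ (t - deg a) := by
  simp [vecPiece, Submodule.mem_pi]

theorem vecProj_mem (deg : ι → ℤ) (t : ℤ) (v : ι → R) :
    vecProj ℛ deg t v ∈ vecPiece ℛ deg t :=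
  (mem_vecPiece ℛ).2 fun _ => projZ_mem ℛ _ _

theorem vecProj_of_mem {deg : ι → ℤ} {t : ℤ} {v : ι → R} (hv : v ∈ vecPiece ℛ deg t) :
    vecProj ℛ deg t v = v :=
  funext fun a => projZ_of_mem ℛ ((mem_vecPiece ℛ).1 hv a)

theorem exists_sum_vecProj [Finite ι] (deg : ι → ℤ) (v : ι → R) :
    ∃ s : Finset ℤ, ∑ t ∈ s, vecProj ℛ deg t v = v := by
  classical
  cases nonempty_fintype ι
  choose s hs using fun a => exists_sum_projZ ℛ (v a)
  refine ⟨Finset.univ.biUnion fun a => (s a).image fun j => j + deg a, ?_⟩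
  ext a
  rw [Finset.sum_apply]
  simp only [vecProj_apply]
  set T := Finset.univ.biUnion fun a => (s a).image fun j => j + deg a
  have := hs a (T.image fun t => t - deg a) (fun j hj => by
    rw [Finset.mem_image]
    exact ⟨j + deg a, Finset.mem_biUnion.2 ⟨a, Finset.mem_univ _, Finset.mem_image_of_mem _ hj⟩,
      by ring⟩)
  rwa [Finset.sum_image (fun x _ y _ h => by simpa using h)] at this

omit [GradedAlgebra ℛ] in
theorem finrank_vecPiece [∀ n, Module.Finite k (ℛ n)] [Fintype ι] (deg : ι → ℤ) (t : ℤ) :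
    Module.finrank k (vecPiece ℛ deg t) = ∑ a, hilbertFn ℛ (t - deg a) := by
  let e : vecPiece ℛ deg t ≃ₗ[k] ∀ a, intPiece ℛ (t - deg a) :=
    { toFun := fun v a => ⟨v.1 a, (mem_vecPiece ℛ).1 v.2 a⟩
      invFun := fun w => ⟨fun a => w a, (mem_vecPiece ℛ).2 fun a => (w a).2⟩
      left_inv := fun v => rfl
      right_inv := fun w => rfl
      map_add' := fun v w => rfl
      map_smul' := fun r v => rfl }
  rw [e.finrank_eq, Module.finrank_pi_fintype]
  rfl

omit [GradedAlgebra ℛ] in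
instance vecPiece.finite [∀ n, Module.Finite k (ℛ n)] [Finite ι] (deg : ι → ℤ) (t : ℤ) :
    Module.Finite k (vecPiece ℛ deg t) := by
  let f : vecPiece ℛ deg t →ₗ[k] ∀ a, intPiece ℛ (t - deg a) :=
    { toFun := fun v a => ⟨v.1 a, (mem_vecPiece ℛ).1 v.2 a⟩
      map_add' := fun v w => rfl
      map_smul' := fun r v => rfl }
  refine Module.Finite.of_injective f fun v w h => Subtype.ext (funext fun a => ?_)
  exact congrArg Subtype.val (congrFun h a)

theorem vecProj_matrixAction [Fintype κ] {deg : ι → ℤ} {deg' : κ → ℤ} {A : Matrix ι κ R}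
    (hA : ∀ a b, A a b ∈ intPiece ℛ (deg' b - deg a)) (t : ℤ) (v : κ → R) :
    vecProj ℛ deg t (matrixAction R A v) = matrixAction R A (vecProj ℛ deg' t v) := by
  ext a
  simp only [vecProj_apply, matrixAction_apply, map_sum, smul_eq_mul]
  refine Finset.sum_congr rfl fun b _ => ?_
  rw [projZ_mul ℛ (hA a b)]
  congr 3
  ring

variable (k) in
/-- `matrixAction` for `M = R`, as a `k`-linear map. -/
def matrixActionₖ [Fintype κ] (A : Matrix ι κ R) : (κ → R) →ₗ[k] (ι → R) :=
  (matrixAction R A).restrictScalars k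

/-- The piece of degree `t` of the image of the map given by a homogeneous matrix. -/
def rangePiece [Fintype κ] (deg : ι → ℤ) (A : Matrix ι κ R) (t : ℤ) : Submodule k (ι → R) :=
  LinearMap.range (matrixActionₖ k A) ⊓ vecPiece ℛ deg t

theorem finrank_rangePiece_add [∀ n, Module.Finite k (ℛ n)] {ν : Type*} [Fintype ι] [Fintype κ]
    [Fintype ν] {deg : ι → ℤ} {deg' : κ → ℤ} {A : Matrix ι κ R} {B : Matrix κ ν R}
    (hA : ∀ a b, A a b ∈ intPiece ℛ (deg' b - deg a))
    (hex : Function.Exact (matrixAction R B) (matrixAction R A)) (t : ℤ) :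
    Module.finrank k (rangePiece ℛ deg A t) + Module.finrank k (rangePiece ℛ deg' B t) =
      ∑ b, hilbertFn ℛ (t - deg' b) := by
  let f := (matrixActionₖ k A).domRestrict (vecPiece ℛ deg' t)
  have hr : LinearMap.range f = rangePiece ℛ deg A t := by
    ext v
    constructor
    · rintro ⟨⟨w, hw⟩, rfl⟩
      refine ⟨⟨w, rfl⟩, ?_⟩
      change matrixAction R A w ∈ _
      rw [← vecProj_of_mem ℛ hw, ← vecProj_matrixAction ℛ hA]
      exact vecProj_mem ℛ _ _ _
    · rintro ⟨⟨w, rfl⟩, hv⟩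
      refine ⟨⟨vecProj ℛ deg' t w, vecProj_mem ℛ _ _ _⟩, ?_⟩
      change matrixAction R A (vecProj ℛ deg' t w) = matrixAction R A w
      rw [← vecProj_matrixAction ℛ hA]
      exact vecProj_of_mem ℛ hv
  have hk : (LinearMap.ker f).map (vecPiece ℛ deg' t).subtype = rangePiece ℛ deg' B t := by
    ext v
    constructor
    · rintro ⟨⟨w, hw⟩, hw0, rfl⟩
      exact ⟨(hex w).1 hw0, hw⟩
    · rintro ⟨⟨w, rfl⟩, hv⟩
      exact ⟨⟨_, hv⟩, (hex _).2 ⟨w, rfl⟩, rfl⟩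
  rw [← hr, ← hk, Submodule.finrank_map_subtype_eq, LinearMap.finrank_range_add_finrank_ker,
    finrank_vecPiece]

end GradedComplexes

/-- A complex of graded free modules `⋯ → ⊕_b R(-deg 1 b) → ⊕_b R(-deg 0 b)` over a graded ring,
with homogeneous differentials of degree zero. -/
structure GradedFreeComplex {k R : Type*} [Field k] [CommRing R] [Algebra k R]
    (ℛ : ℕ → Submodule k R) where
  rank : ℕ → ℕ
  deg : (i : ℕ) → Fin (rank i) → ℤ
  d : (i : ℕ) → Matrix (Fin (rank i)) (Fin (rank (i + 1))) R
  d_mem : ∀ i a b, d i a b ∈ intPiece ℛ (deg (i + 1) b - deg i a)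

namespace GradedFreeComplex

variable {k R : Type*} [Field k] [CommRing R] [Algebra k R] {ℛ : ℕ → Submodule k R}
  [GradedAlgebra ℛ]

/-- The alternating sum `∑_{i<L} (-1)^i ∑_b φ (deg (i+1) b)` over the degrees in the positions
`1, …, L`. -/
def altSum (C : GradedFreeComplex ℛ) (L : ℕ) {A : Type*} [Ring A] (φ : ℤ → A) : A :=
  ∑ i ∈ Finset.range L, (-1) ^ i * ∑ b, φ (C.deg (i + 1) b)

/-- The Hilbert function of the image of the last differential of an exact complex is the
alternating sum of the Hilbert functions of its members. -/
theorem finrank_rangePiece_eq [∀ n, Module.Finite k (ℛ n)] (C : GradedFreeComplex ℛ)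
    (hex : ∀ i, ExactAt C.d R i) {L : ℕ} (hL : ∀ i, L < i → C.rank i = 0) (t : ℤ) :
    (Module.finrank k (rangePiece ℛ (C.deg 0) (C.d 0) t) : ℤ) =
      C.altSum L fun j => (hilbertFn ℛ (t - j) : ℤ) := by
  have key : ∀ l, (Module.finrank k (rangePiece ℛ (C.deg 0) (C.d 0) t) : ℤ) =
      C.altSum l (fun j => (hilbertFn ℛ (t - j) : ℤ)) +
        (-1) ^ l * Module.finrank k (rangePiece ℛ (C.deg l) (C.d l) t) := by
    intro l
    induction l with
    | zero => simp [altSum]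
    | succ l ih =>
      rw [ih, altSum, altSum, Finset.sum_range_succ, pow_succ]
      have := finrank_rangePiece_add ℛ (C.d_mem l) (hex l) t
      have h2 : (Module.finrank k (rangePiece ℛ (C.deg l) (C.d l) t) : ℤ) =
        ∑ b, (hilbertFn ℛ (t - C.deg (l + 1) b) : ℤ) -
          Module.finrank k (rangePiece ℛ (C.deg (l + 1)) (C.d (l + 1)) t) := by
        rw [eq_sub_iff_add_eq]
        exact_mod_cast this
      rw [h2]
      ring
  have h0 : rangePiece ℛ (C.deg L) (C.d L) t = ⊥ := by
    rw [eq_bot_iff]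
    rintro _ ⟨⟨w, rfl⟩, -⟩
    have : IsEmpty (Fin (C.rank (L + 1))) := by rw [hL _ (by omega)]; infer_instance
    have : w = 0 := Subsingleton.elim _ _
    rw [this, map_zero]
    exact zero_mem _
  rw [key L, h0, finrank_bot]
  simp

/-- The pullback of a complex under the `n`-th power of the Frobenius map. -/
def frobenius (C : GradedFreeComplex ℛ) (p : ℕ) [ExpChar R p] (n : ℕ) : GradedFreeComplex ℛ where
  rank := C.rank
  deg i b := (p ^ n : ℕ) * C.deg i b
  d i := (C.d i).map (iterateFrobenius R p n)
  d_mem i a b := by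
    rw [Matrix.map_apply, iterateFrobenius_def, ← mul_sub]
    exact pow_mem_intPiece ℛ (C.d_mem i a b) _

end GradedFreeComplex

/-- A function on the integers with finite support whose convolution with the Hilbert function
vanishes is zero: consider the least element of the support. -/
theorem finsupp_eq_zero_of_convolution {k R : Type*} [Field k] [CommRing R] [Algebra k R]
    {ℛ : ℕ → Submodule k R} (h₀ : hilbertFn ℛ 0 ≠ 0) (δ : ℤ →₀ ℤ)
    (hδ : ∀ t, (δ.sum fun j n => n * (hilbertFn ℛ (t - j) : ℤ)) = 0) : δ = 0 := by
  by_contra hne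
  have hs : δ.support.Nonempty := Finsupp.support_nonempty_iff.2 hne
  set m := δ.support.min' hs
  have := hδ m
  rw [Finsupp.sum, Finset.sum_eq_single_of_mem m (δ.support.min'_mem hs)] at this
  · rw [sub_self, mul_eq_zero] at this
    rcases this with h | h
    · exact Finsupp.mem_support_iff.1 (δ.support.min'_mem hs) h
    · exact h₀ (by exact_mod_cast h)
  · intro j hj hjm
    have : m ≤ j := δ.support.min'_le j hj
    rw [hilbertFn_of_neg ℛ (by omega)]
    simp

namespace GradedFreeResolution

variable {k R : Type*} [Field k] [CommRing R] [Algebra k R] {ℛ : ℕ → Submodule k R}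
  {J : Ideal R}

/-- The augmented complex `⋯ → F_1 → F_0 → R` of a resolution of the ideal `J`. -/
def augmented [GradedAlgebra ℛ] (F : GradedFreeResolution ℛ J) : GradedFreeComplex ℛ where
  rank
    | 0 => 1
    | i + 1 => F.rank i
  deg
    | 0 => fun _ => 0
    | i + 1 => F.deg i
  d
    | 0 => Matrix.of fun _ b => F.gen b
    | i + 1 => F.d i
  d_mem
    | 0 => fun _ b => by
      have := F.gen_mem b
      rwa [← sub_zero (F.deg 0 b)] at this
    | i + 1 => F.d_mem i

variable [GradedAlgebra ℛ] (F : GradedFreeResolution ℛ J)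

theorem augmented_rank_eq_zero (i : ℕ) (hi : F.len < i) : F.augmented.rank i = 0 := by
  obtain ⟨j, rfl⟩ : ∃ j, i = j + 1 := ⟨i - 1, by omega⟩
  exact F.rank_eq_zero j (by omega)

omit [GradedAlgebra ℛ] in
theorem matrixAction_gen (v : Fin (F.rank 0) → R) (a : Fin 1) :
    matrixAction R (Matrix.of fun (_ : Fin 1) b => F.gen b) v a =
      Fintype.linearCombination R F.gen v := by
  rw [matrixAction_apply, Fintype.linearCombination_apply]
  exact Finset.sum_congr rfl fun b _ => mul_comm _ _

theorem augmented_exactAt (i : ℕ) : ExactAt F.augmented.d R i := by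
  cases i with
  | zero =>
    change Function.Exact (matrixAction R (F.d 0))
      (matrixAction R (Matrix.of fun (_ : Fin 1) b => F.gen b))
    intro v
    have h := F.exact_zero v
    rw [← matrixAction_self] at h
    refine Iff.trans ?_ h
    constructor
    · intro hv
      rw [← matrixAction_gen F v 0]
      exact congrFun hv 0
    · intro hv
      funext a
      rw [matrixAction_gen, hv]
      rfl
  | succ i =>
    have := F.exact_succ i
    rwa [← matrixAction_self, ← matrixAction_self] at this

/-- The alternating sum `∑_i (-1)^i ∑_b φ (deg i b)` over the degrees of the resolution. -/
def altSum (F : GradedFreeResolution ℛ J) {A : Type*} [Ring A] (φ : ℤ → A) : A :=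
  ∑ i ∈ Finset.range F.len, (-1) ^ i * ∑ b, φ (F.deg i b)

omit [GradedAlgebra ℛ] in
theorem bettiSum_eq (d m : ℕ) (x : ℝ) :
    F.bettiSum d m x =
      x ^ (d - 1) - F.altSum fun j => (max (x - (j : ℝ) / (m : ℝ)) 0) ^ (d - 1) := by
  rw [bettiSum, altSum]
  congr 1
  refine Finset.sum_congr rfl fun i _ => ?_
  congr 1
  set φ : ℤ → ℝ := fun j => (max (x - (j : ℝ) / (m : ℝ)) 0) ^ (d - 1)
  change ∑ᶠ j, (F.betti i j : ℝ) * φ j = _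
  rw [finsum_eq_sum_of_support_subset (s := Finset.univ.image (F.deg i))]
  · rw [← Finset.sum_fiberwise_of_maps_to (s := Finset.univ) (g := F.deg i)
      (t := Finset.univ.image (F.deg i)) (fun b _ => Finset.mem_image_of_mem _ (Finset.mem_univ b))]
    refine Finset.sum_congr rfl fun j _ => ?_
    rw [Finset.sum_congr rfl (g := fun _ => φ j) (fun b hb => by rw [(Finset.mem_filter.1 hb).2]),
      Finset.sum_const, nsmul_eq_mul, betti, Fintype.card_subtype]
  · intro j hj
    rw [Finset.coe_image, Finset.coe_univ, Set.image_univ, Set.mem_range]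
    by_contra hcon
    push Not at hcon
    apply hj
    have : IsEmpty {b : Fin (F.rank i) // F.deg i b = j} := ⟨fun b => hcon b.1 b.2⟩
    change (F.betti i j : ℝ) * φ j = 0
    rw [betti, Fintype.card_eq_zero]
    simp

/-- The signed count of the degrees of the resolution, a Laurent polynomial. -/
def eulerPoly (F : GradedFreeResolution ℛ J) : ℤ →₀ ℤ :=
  ∑ i ∈ Finset.range F.len, ∑ b, Finsupp.single (F.deg i b) ((-1) ^ i)

omit [GradedAlgebra ℛ] in
theorem altSum_eq {A : Type*} [CommRing A] (φ : ℤ → A) :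
    F.altSum φ = F.eulerPoly.sum fun j n => (n : A) * φ j := by
  rw [eulerPoly, altSum, ← Finsupp.sum_finsetSum_index (by simp) (by intros; push_cast; ring)]
  refine Finset.sum_congr rfl fun i _ => ?_
  rw [← Finsupp.sum_finsetSum_index (by simp) (by intros; push_cast; ring), Finset.mul_sum]
  refine Finset.sum_congr rfl fun b _ => ?_
  rw [Finsupp.sum_single_index (by simp)]
  simp

omit [GradedAlgebra ℛ] in
/-- A piece of an ideal is the piece of the image of the matrix of any of its systems of
generators. -/
theorem finrank_rangePiece_row [∀ n, Module.Finite k (ℛ n)] {m : ℕ} (g : Fin m → R)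
    (deg : Fin 1 → ℤ) (hdeg : deg 0 = 0) (t : ℤ) :
    Module.finrank k (rangePiece ℛ deg (Matrix.of fun (_ : Fin 1) b => g b) t) =
      Module.finrank k ↥((Ideal.span (Set.range g)).restrictScalars k ⊓ intPiece ℛ t) := by
  have : ((Ideal.span (Set.range g)).restrictScalars k ⊓ intPiece ℛ t) =
      (rangePiece ℛ deg (Matrix.of fun (_ : Fin 1) b => g b) t).map
        (LinearEquiv.funUnique (Fin 1) k R).toLinearMap := by
    ext x
    constructor
    · rintro ⟨hx, hxt⟩
      obtain ⟨v, hv⟩ := (Submodule.mem_span_range_iff_exists_fun R).1 hx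
      refine ⟨fun _ => x, ⟨⟨v, ?_⟩, ?_⟩, rfl⟩
      · funext a
        change matrixAction R _ v a = x
        rw [matrixAction_apply, ← hv]
        exact Finset.sum_congr rfl fun b _ => mul_comm _ _
      · rw [SetLike.mem_coe, mem_vecPiece]
        intro a
        rwa [Subsingleton.elim a 0, hdeg, sub_zero]
    · rintro ⟨_, ⟨⟨v, rfl⟩, hv⟩, rfl⟩
      constructor
      · change matrixAction R _ v default ∈ Ideal.span (Set.range g)
        rw [matrixAction_apply]
        refine sum_mem fun b _ => ?_
        rw [smul_eq_mul, mul_comm]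
        exact Ideal.mul_mem_left _ _ (Ideal.subset_span ⟨b, rfl⟩)
      · have := (mem_vecPiece ℛ).1 hv 0
        rwa [hdeg, sub_zero] at this
  rw [this, LinearEquiv.finrank_map_eq]

/-- The Hilbert function of an ideal with a finite graded free resolution. -/
theorem finrank_inf_intPiece [∀ n, Module.Finite k (ℛ n)] (t : ℤ) :
    (Module.finrank k ↥(J.restrictScalars k ⊓ intPiece ℛ t) : ℤ) =
      F.altSum fun j => (hilbertFn ℛ (t - j) : ℤ) := by
  have h := F.augmented.finrank_rangePiece_eq F.augmented_exactAt F.augmented_rank_eq_zero t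
  have h1 := finrank_rangePiece_row (ℛ := ℛ) F.gen (F.augmented.deg 0) rfl t
  rw [F.span_gen] at h1
  rw [← h1]
  exact h

/-- The alternating sums over the degrees of two resolutions of `J` agree. -/
theorem altSum_eq_altSum [∀ n, Module.Finite k (ℛ n)] [Nontrivial R]
    (F F' : GradedFreeResolution ℛ J) {A : Type*} [CommRing A] (φ : ℤ → A) :
    F.altSum φ = F'.altSum φ := by
  have h : F.eulerPoly = F'.eulerPoly := by
    rw [← sub_eq_zero]
    refine finsupp_eq_zero_of_convolution (ℛ := ℛ) ?_ _ fun t => ?_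
    · have := hilbertFn_natCast ℛ 0
      rw [Nat.cast_zero] at this
      rw [this]
      intro h0
      have h1 := Submodule.finrank_eq_zero.1 h0
      have h2 : (1 : R) ∈ ℛ 0 := SetLike.one_mem_graded ℛ
      rw [h1, Submodule.mem_bot] at h2
      exact one_ne_zero h2
    · rw [Finsupp.sum_sub_index (by intros; ring)]
      have h1 := F.finrank_inf_intPiece t
      have h2 := F'.finrank_inf_intPiece t
      rw [altSum_eq] at h1 h2
      simp only [Int.cast_id] at h1 h2
      rw [← h1, ← h2, sub_self]
  rw [altSum_eq, altSum_eq, h]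

end GradedFreeResolution

/-! ### Minimal graded free resolutions -/

section HomogeneousMaximalIdeal

variable {k R : Type*} [Field k] [CommRing R] [Algebra k R] (ℛ : ℕ → Submodule k R)
  [GradedAlgebra ℛ] [IsLocalRing (ℛ 0)]

/-- The homogeneous maximal ideal of a graded ring with local degree zero part: the elements whose
component of degree zero is not a unit of `R_0`. -/
def homogeneousMaximalIdeal : Ideal R :=
  (IsLocalRing.maximalIdeal (ℛ 0)).comap (GradedRing.projZeroRingHom' ℛ)

omit [IsLocalRing (ℛ 0)] in
theorem projZ_zero_eq (x : R) : projZ ℛ 0 x = (GradedRing.projZeroRingHom' ℛ x : R) := by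
  rw [projZ_of_nonneg ℛ le_rfl]; rfl

theorem not_isUnit_of_mem_homogeneousMaximalIdeal {x : R} (hx : x ∈ homogeneousMaximalIdeal ℛ) :
    ¬ IsUnit x := fun h =>
  (IsLocalRing.mem_maximalIdeal _).1 (Ideal.mem_comap.1 hx) (h.map (GradedRing.projZeroRingHom' ℛ))

theorem isUnit_projZ_zero {x : R} (hx : x ∉ homogeneousMaximalIdeal ℛ) : IsUnit (projZ ℛ 0 x) := by
  have : IsUnit (GradedRing.projZeroRingHom' ℛ x) := by
    by_contra h
    exact hx ((IsLocalRing.mem_maximalIdeal _).2 h)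
  rw [projZ_zero_eq]
  exact this.map (SetLike.GradeZero.subring ℛ).subtype

omit [IsLocalRing (ℛ 0)] in
theorem projZ_mul_of_forall_lt (a : R) {x : R} {n : ℤ} (hx : ∀ j < n, projZ ℛ j x = 0) :
    projZ ℛ n (a * x) = projZ ℛ 0 a * projZ ℛ n x := by
  classical
  obtain ⟨s, hs⟩ := exists_sum_projZ ℛ a
  have := hs (insert 0 s) (Finset.subset_insert _ _)
  conv_lhs => rw [← this]
  rw [Finset.sum_mul, map_sum, Finset.sum_eq_single_of_mem 0 (Finset.mem_insert_self _ _)]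
  · rw [projZ_mul ℛ (projZ_mem ℛ 0 a), sub_zero]
  · intro j _ hj
    rw [projZ_mul ℛ (projZ_mem ℛ j a)]
    rcases lt_or_gt_of_ne hj with h | h
    · rw [projZ_of_neg ℛ h, zero_mul]
    · rw [hx _ (by omega), mul_zero]

/-- Elements outside the homogeneous maximal ideal are not zero divisors: compare the components of
lowest degree. -/
theorem eq_zero_of_mul_eq_zero_of_notMem {a x : R} (ha : a ∉ homogeneousMaximalIdeal ℛ)
    (h : a * x = 0) : x = 0 := by
  apply eq_zero_of_projZ ℛ
  have key : ∀ n : ℕ, projZ ℛ n x = 0 := by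
    intro n
    induction n using Nat.strong_induction_on with
    | _ n ih =>
      have h1 := projZ_mul_of_forall_lt ℛ a (x := x) (n := n) (fun j hj => by
        rcases lt_or_ge j 0 with h0 | h0
        · exact projZ_of_neg ℛ h0 x
        · lift j to ℕ using h0
          exact ih j (by exact_mod_cast hj))
      rw [h, map_zero] at h1
      exact ((isUnit_projZ_zero ℛ ha).mul_right_eq_zero).1 h1.symm
  intro j
  rcases lt_or_ge j 0 with h0 | h0
  · exact projZ_of_neg ℛ h0 x
  · lift j to ℕ using h0
    exact key j

theorem eq_bot_of_le_smul {ι : Type*} (K : Submodule R (ι → R)) (hfg : K.FG)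
    (hK : K ≤ homogeneousMaximalIdeal ℛ • K) : K = ⊥ := by
  obtain ⟨r, hr, hrK⟩ := Submodule.exists_sub_one_mem_and_smul_eq_zero_of_fg_of_le_smul _ _ hfg hK
  rw [eq_bot_iff]
  intro v hv
  rw [Submodule.mem_bot]
  funext a
  refine eq_zero_of_mul_eq_zero_of_notMem ℛ (a := r) (fun h => ?_) (congrFun (hrK v hv) a)
  have h1 := sub_mem h hr
  rw [sub_sub_cancel] at h1
  exact not_isUnit_of_mem_homogeneousMaximalIdeal ℛ h1 isUnit_one

end HomogeneousMaximalIdeal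

section MinimalResolution

variable {k R : Type*} [Field k] [CommRing R] [Algebra k R]

/-- A graded submodule of a graded free module `⊕_a R(-deg a)` of finite rank. -/
structure GradedSubmoduleOfFree (ℛ : ℕ → Submodule k R) [GradedAlgebra ℛ] where
  rank : ℕ
  deg : Fin rank → ℤ
  carrier : Submodule R (Fin rank → R)
  homogeneous : ∀ t, ∀ v ∈ carrier, vecProj ℛ deg t v ∈ carrier

variable {ℛ : ℕ → Submodule k R} [GradedAlgebra ℛ]

/-- The homogeneous matrix `A` with source degrees `deg'` generates the graded submodule `s`. -/
def GradedSubmoduleOfFree.Generates (s : GradedSubmoduleOfFree ℛ) {m : ℕ} (deg' : Fin m → ℤ)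
    (A : Matrix (Fin s.rank) (Fin m) R) : Prop :=
  (∀ a b, A a b ∈ intPiece ℛ (deg' b - s.deg a)) ∧
    LinearMap.range (matrixAction R A) = s.carrier

theorem GradedSubmoduleOfFree.exists_generates [IsNoetherianRing R]
    (s : GradedSubmoduleOfFree ℛ) :
    ∃ (m : ℕ) (deg' : Fin m → ℤ) (A : Matrix (Fin s.rank) (Fin m) R), s.Generates deg' A := by
  classical
  obtain ⟨G, hG⟩ := IsNoetherian.noetherian s.carrier
  choose T hT using fun v : Fin s.rank → R => exists_sum_vecProj ℛ s.deg v
  let ι := Σ g : G, T g.1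
  let e : ι ≃ Fin (Fintype.card ι) := Fintype.equivFin ι
  let w : ι → (Fin s.rank → R) := fun x => vecProj ℛ s.deg x.2.1 x.1.1
  refine ⟨Fintype.card ι, fun b => (e.symm b).2.1, Matrix.of fun a b => w (e.symm b) a,
    fun a b => projZ_mem ℛ _ _, ?_⟩
  have hsum : ∀ u : Fin (Fintype.card ι) → R,
      matrixAction R (Matrix.of fun a b => w (e.symm b) a) u = ∑ b, u b • w (e.symm b) := by
    intro u
    ext a
    rw [matrixAction_apply, Finset.sum_apply]
    exact Finset.sum_congr rfl fun b _ => mul_comm _ _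
  apply le_antisymm
  · rintro _ ⟨u, rfl⟩
    rw [hsum]
    refine sum_mem fun b _ => Submodule.smul_mem _ _ (s.homogeneous _ _ ?_)
    rw [← hG]
    exact Submodule.subset_span (e.symm b).1.2
  · rw [← hG, Submodule.span_le]
    intro g hg
    rw [← hT g]
    refine sum_mem fun t ht => ⟨Pi.single (e ⟨⟨g, hg⟩, ⟨t, ht⟩⟩) 1, ?_⟩
    rw [hsum, Finset.sum_eq_single_of_mem (e ⟨⟨g, hg⟩, ⟨t, ht⟩⟩) (Finset.mem_univ _)]
    · simp [w]
    · intro b _ hb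
      rw [Pi.single_eq_of_ne hb, zero_smul]

/-- A system of homogeneous generators of minimal cardinality has all its relations in
`𝔪 R^m`. -/
theorem GradedSubmoduleOfFree.exists_minimal_generates [IsNoetherianRing R] [IsLocalRing (ℛ 0)]
    (s : GradedSubmoduleOfFree ℛ) :
    ∃ (m : ℕ) (deg' : Fin m → ℤ) (A : Matrix (Fin s.rank) (Fin m) R), s.Generates deg' A ∧
      ∀ v, matrixAction R A v = 0 → ∀ b, v b ∈ homogeneousMaximalIdeal ℛ := by
  classical
  have hex := s.exists_generates
  obtain ⟨deg', A, hA, hrange⟩ := Nat.find_spec hex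
  have hmin : ∀ m < Nat.find hex, ¬ ∃ (deg' : Fin m → ℤ) (A : Matrix (Fin s.rank) (Fin m) R),
    s.Generates deg' A := fun m hm => Nat.find_min hex hm
  generalize Nat.find hex = m at deg' A hA hrange hmin
  refine ⟨m, deg', A, ⟨hA, hrange⟩, ?_⟩
  intro v hv b
  by_contra hb
  obtain ⟨m', rfl⟩ : ∃ m', m = m' + 1 := ⟨m - 1, by have := b.2; omega⟩
  set u := vecProj ℛ deg' (deg' b) v with hu
  have hu0 : matrixAction R A u = 0 := by
    rw [hu, ← vecProj_matrixAction ℛ hA, hv, map_zero]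
  have hub : IsUnit (u b) := by
    rw [hu, vecProj_apply, sub_self]
    exact isUnit_projZ_zero ℛ hb
  obtain ⟨c, hc⟩ := hub.exists_left_inv
  -- the generator with index `b` is a combination of the others
  refine hmin m' (Nat.lt_succ_self _) ⟨deg' ∘ b.succAbove, A.submatrix id b.succAbove,
    fun a b' => hA a _, ?_⟩
  rw [← hrange]
  apply le_antisymm
  · rintro _ ⟨w, rfl⟩
    refine ⟨b.insertNth 0 w, ?_⟩
    ext a
    simp [matrixAction_apply, Fin.sum_univ_succAbove _ b]
  · rintro _ ⟨w, rfl⟩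
    refine ⟨fun b' => w (b.succAbove b') - w b * c * u (b.succAbove b'), ?_⟩
    ext a
    have h1 := congrFun hu0 a
    rw [matrixAction_apply, Fin.sum_univ_succAbove _ b, Pi.zero_apply] at h1
    rw [matrixAction_apply, matrixAction_apply, Fin.sum_univ_succAbove _ b]
    simp only [Matrix.submatrix_apply, id_eq, smul_eq_mul] at h1 ⊢
    simp only [mul_sub, Finset.sum_sub_distrib]
    have h2 : ∑ x, A a (b.succAbove x) * (w b * c * u (b.succAbove x)) =
        w b * c * ∑ x, A a (b.succAbove x) * u (b.succAbove x) := by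
      rw [Finset.mul_sum]
      exact Finset.sum_congr rfl fun x _ => by ring
    rw [h2]
    have h3 : w b * c * (A a b * u b) = A a b * w b := by
      rw [show w b * c * (A a b * u b) = A a b * w b * (c * u b) by ring, hc, mul_one]
    linear_combination (-w b * c) * h1 + h3

section Syzygies

variable [IsNoetherianRing R] [IsLocalRing (ℛ 0)] (s : GradedSubmoduleOfFree ℛ)

/-- The minimal number of homogeneous generators of a graded submodule. -/
def GradedSubmoduleOfFree.genRank : ℕ := s.exists_minimal_generates.choose

/-- The degrees of a minimal system of homogeneous generators. -/
def GradedSubmoduleOfFree.genDeg : Fin s.genRank → ℤ :=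
  s.exists_minimal_generates.choose_spec.choose

/-- The matrix of a minimal system of homogeneous generators. -/
def GradedSubmoduleOfFree.genMatrix : Matrix (Fin s.rank) (Fin s.genRank) R :=
  s.exists_minimal_generates.choose_spec.choose_spec.choose

theorem GradedSubmoduleOfFree.genMatrix_generates : s.Generates s.genDeg s.genMatrix :=
  s.exists_minimal_generates.choose_spec.choose_spec.choose_spec.1

theorem GradedSubmoduleOfFree.mem_homogeneousMaximalIdeal_of_ker {v : Fin s.genRank → R}
    (hv : matrixAction R s.genMatrix v = 0) (b) : v b ∈ homogeneousMaximalIdeal ℛ :=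
  s.exists_minimal_generates.choose_spec.choose_spec.choose_spec.2 v hv b

/-- The first syzygy module for a minimal system of homogeneous generators. -/
def GradedSubmoduleOfFree.syzygy : GradedSubmoduleOfFree ℛ where
  rank := s.genRank
  deg := s.genDeg
  carrier := LinearMap.ker (matrixAction R s.genMatrix)
  homogeneous t v hv := by
    rw [LinearMap.mem_ker] at hv ⊢
    rw [← vecProj_matrixAction ℛ s.genMatrix_generates.1, hv, map_zero]

/-- The iterated syzygy modules. -/
def GradedSubmoduleOfFree.iterSyzygy : ℕ → GradedSubmoduleOfFree ℛ
  | 0 => s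
  | i + 1 => (GradedSubmoduleOfFree.iterSyzygy i).syzygy

/-- The minimal graded free resolution of a graded submodule `K` of a graded free module, with the
free module itself in position `0`. -/
def GradedSubmoduleOfFree.minimalComplex : GradedFreeComplex ℛ where
  rank i := (s.iterSyzygy i).rank
  deg i := (s.iterSyzygy i).deg
  d i := (s.iterSyzygy i).genMatrix
  d_mem i := (s.iterSyzygy i).genMatrix_generates.1

theorem GradedSubmoduleOfFree.range_d (i : ℕ) :
    LinearMap.range (matrixAction R (s.minimalComplex.d i)) = (s.iterSyzygy i).carrier :=
  (s.iterSyzygy i).genMatrix_generates.2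

theorem GradedSubmoduleOfFree.exactAt_minimalComplex (i : ℕ) :
    ExactAt s.minimalComplex.d R i :=
  LinearMap.exact_iff.2 (s.range_d (i + 1)).symm

theorem GradedSubmoduleOfFree.minimalComplex_d_mem (i : ℕ) (a b) :
    s.minimalComplex.d (i + 1) a b ∈ homogeneousMaximalIdeal ℛ := by
  classical
  have h := (s.exactAt_minimalComplex i _).2 ⟨Pi.single b 1, rfl⟩
  have h1 := (s.iterSyzygy i).mem_homogeneousMaximalIdeal_of_ker h a
  rw [matrixAction_apply, Finset.sum_eq_single_of_mem b (Finset.mem_univ _)] at h1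
  · simpa using h1
  · intro b' _ hb'
    rw [Pi.single_eq_of_ne hb', smul_zero]

theorem GradedSubmoduleOfFree.genRank_eq_zero (h : s.carrier = ⊥) : s.genRank = 0 := by
  classical
  by_contra hne
  have h1 := s.mem_homogeneousMaximalIdeal_of_ker (v := fun _ => 1) (by
    have : matrixAction R s.genMatrix (fun _ => 1) ∈ s.carrier := by
      rw [← s.genMatrix_generates.2]; exact ⟨_, rfl⟩
    rwa [h, Submodule.mem_bot] at this) ⟨0, Nat.pos_of_ne_zero hne⟩
  exact not_isUnit_of_mem_homogeneousMaximalIdeal ℛ h1 isUnit_one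

theorem GradedSubmoduleOfFree.rank_eq_zero_of_le {N : ℕ} (h : (s.iterSyzygy N).carrier = ⊥) (i : ℕ)
    (hi : N < i) : s.minimalComplex.rank i = 0 := by
  induction i, hi using Nat.le_induction with
  | base => exact (s.iterSyzygy N).genRank_eq_zero h
  | succ i hi ih =>
    refine (s.iterSyzygy i).genRank_eq_zero ?_
    have : IsEmpty (Fin (s.iterSyzygy i).rank) := by
      change IsEmpty (Fin (s.minimalComplex.rank i))
      rw [ih]; infer_instance
    exact Subsingleton.elim _ _

end Syzygies

/-- A homogeneous ideal as a graded submodule of the free module `R`. -/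
def Ideal.toGradedSubmodule (J : Ideal R) (hJ : J.IsHomogeneous ℛ) : GradedSubmoduleOfFree ℛ where
  rank := 1
  deg _ := 0
  carrier := Submodule.comap (LinearMap.proj 0 : (Fin 1 → R) →ₗ[R] R) J
  homogeneous t v hv := by
    change projZ ℛ (t - 0) (v 0) ∈ J
    have hv : v 0 ∈ J := hv
    rcases lt_or_ge (t - 0) 0 with h | h
    · rw [projZ_of_neg ℛ h]; exact zero_mem _
    · rw [projZ_of_nonneg ℛ h]; exact hJ _ hv

/-- A minimal system of homogeneous generators of a homogeneous ideal, as a row. -/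
def Ideal.genRow [IsNoetherianRing R] [IsLocalRing (ℛ 0)] (J : Ideal R) (hJ : J.IsHomogeneous ℛ) :
    Matrix (Fin 1) (Fin (J.toGradedSubmodule hJ).genRank) R :=
  (J.toGradedSubmodule hJ).genMatrix

theorem Ideal.mem_range_genRow [IsNoetherianRing R] [IsLocalRing (ℛ 0)] (J : Ideal R)
    (hJ : J.IsHomogeneous ℛ) (w : Fin 1 → R) :
    w ∈ LinearMap.range (matrixAction R (J.genRow hJ)) ↔ w 0 ∈ J :=
  SetLike.ext_iff.1 (J.toGradedSubmodule hJ).genMatrix_generates.2 w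

theorem Ideal.matrixAction_genRow [IsNoetherianRing R] [IsLocalRing (ℛ 0)] (J : Ideal R)
    (hJ : J.IsHomogeneous ℛ) (v : Fin (J.toGradedSubmodule hJ).genRank → R) (a : Fin 1) :
    matrixAction R (J.genRow hJ) v a = Fintype.linearCombination R (J.genRow hJ 0) v := by
  rw [Subsingleton.elim a 0, matrixAction_apply, Fintype.linearCombination_apply]
  exact Finset.sum_congr rfl fun b _ => mul_comm _ _

theorem Ideal.linearCombination_genRow_eq_zero_iff [IsNoetherianRing R] [IsLocalRing (ℛ 0)]
    (J : Ideal R) (hJ : J.IsHomogeneous ℛ) (v : Fin (J.toGradedSubmodule hJ).genRank → R) :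
    Fintype.linearCombination R (J.genRow hJ 0) v = 0 ↔ matrixAction R (J.genRow hJ) v = 0 := by
  rw [← J.matrixAction_genRow hJ v 0]
  exact ⟨fun h => funext fun a => by rw [Subsingleton.elim a 0, h, Pi.zero_apply],
    fun h => congrFun h 0⟩

theorem Ideal.span_genRow [IsNoetherianRing R] [IsLocalRing (ℛ 0)] (J : Ideal R)
    (hJ : J.IsHomogeneous ℛ) : Ideal.span (Set.range (J.genRow hJ 0)) = J := by
  ext x
  rw [Ideal.span, Submodule.mem_span_range_iff_exists_fun]
  have h := J.mem_range_genRow hJ (fun _ => x)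
  rw [← h]
  refine exists_congr fun v => ?_
  rw [← Fintype.linearCombination_apply, ← J.matrixAction_genRow hJ v 0]
  exact ⟨fun h => funext fun a => by rw [Subsingleton.elim a 0, h], fun h => congrFun h 0⟩

/-- The minimal graded free resolution of a homogeneous ideal, if it is finite. -/
def Ideal.minimalResolution [IsNoetherianRing R] [IsLocalRing (ℛ 0)] (J : Ideal R)
    (hJ : J.IsHomogeneous ℛ) (N : ℕ)
    (hN : ∀ i, N < i → (J.toGradedSubmodule hJ).minimalComplex.rank i = 0) :
    GradedFreeResolution ℛ J where
  len := N
  rank i := (J.toGradedSubmodule hJ).minimalComplex.rank (i + 1)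
  deg i := (J.toGradedSubmodule hJ).minimalComplex.deg (i + 1)
  gen := J.genRow hJ 0
  d i := (J.toGradedSubmodule hJ).minimalComplex.d (i + 1)
  rank_eq_zero i hi := hN _ (by omega)
  gen_mem b := by
    have := (J.toGradedSubmodule hJ).genMatrix_generates.1 (0 : Fin 1) b
    rwa [show (J.toGradedSubmodule hJ).deg (0 : Fin 1) = 0 from rfl, sub_zero] at this
  d_mem i := (J.toGradedSubmodule hJ).minimalComplex.d_mem (i + 1)
  span_gen := J.span_genRow hJ
  exact_zero := by
    have h : Function.Exact (matrixAction R ((J.toGradedSubmodule hJ).minimalComplex.d (0 + 1)))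
      (matrixAction R (J.genRow hJ)) := (J.toGradedSubmodule hJ).exactAt_minimalComplex 0
    intro v
    rw [← matrixAction_self]
    exact (J.linearCombination_genRow_eq_zero_iff hJ v).trans (h v)
  exact_succ i := by
    rw [← matrixAction_self, ← matrixAction_self]
    exact (J.toGradedSubmodule hJ).exactAt_minimalComplex (i + 1)

theorem Ideal.minimalResolution_d_mem [IsNoetherianRing R] [IsLocalRing (ℛ 0)] (J : Ideal R)
    (hJ : J.IsHomogeneous ℛ) (N : ℕ)
    (hN : ∀ i, N < i → (J.toGradedSubmodule hJ).minimalComplex.rank i = 0) (i : ℕ) (a b) :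
    (J.minimalResolution hJ N hN).d i a b ∈ homogeneousMaximalIdeal ℛ :=
  (J.toGradedSubmodule hJ).minimalComplex_d_mem i a b

end MinimalResolution

/-! ### Finiteness of minimal resolutions -/

section ProjectiveDimension

open CategoryTheory

theorem hasProjectiveDimensionLT_of_exact {A : Type u} [CommRing A] {K P M : Type u}
    [AddCommGroup K] [AddCommGroup P] [AddCommGroup M] [Module A K] [Module A P] [Module A M]
    [Module.Projective A P] (f : K →ₗ[A] P) (g : P →ₗ[A] M) (hf : Function.Injective f)
    (hg : Function.Surjective g) (hfg : Function.Exact f g) {n : ℕ}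
    (h : HasProjectiveDimensionLT (ModuleCat.of A M) (n + 2)) :
    HasProjectiveDimensionLT (ModuleCat.of A K) (n + 1) := by
  let S : ShortComplex (ModuleCat.{u} A) := ShortComplex.moduleCatMk f g hfg.linearMap_comp_eq_zero
  have hmono : Mono S.f := (ModuleCat.mono_iff_injective _).2 hf
  have hepi : Epi S.g := (ModuleCat.epi_iff_surjective _).2 hg
  have hS : S.ShortExact :=
    ShortComplex.ShortExact.mk ((ShortComplex.ShortExact.moduleCat_exact_iff_function_exact S).2 hfg)
  have hP : Projective S.X₂ := (IsProjective.iff_projective P).1 inferInstance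
  exact (hS.hasProjectiveDimensionLT_X₃_iff n hP).1 h

variable {R R₁ : Type u} [CommRing R] [CommRing R₁] [Algebra R₁ R]

/-- A graded submodule of a free module that is projective (over a ring that surjects onto `R`)
has no syzygies for a minimal system of generators: the syzygy module `K` is a direct summand, and
lies in `𝔪 R^m`, so `K = 𝔪 K`. -/
theorem GradedSubmoduleOfFree.syzygy_eq_bot {k : Type*} [Field k] [Algebra k R]
    {ℛ : ℕ → Submodule k R} [GradedAlgebra ℛ] [IsNoetherianRing R] [IsLocalRing (ℛ 0)]
    (hsurj : Function.Surjective (algebraMap R₁ R)) (s : GradedSubmoduleOfFree ℛ)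
    [Module.Projective R₁ s.carrier] : s.syzygy.carrier = ⊥ := by
  classical
  let π : (Fin s.genRank → R) →ₗ[R] s.carrier :=
    (matrixAction R s.genMatrix).codRestrict s.carrier fun v => by
      rw [← s.genMatrix_generates.2]; exact ⟨v, rfl⟩
  have hπ : Function.Surjective π := by
    rintro ⟨x, hx⟩
    rw [← s.genMatrix_generates.2] at hx
    obtain ⟨v, rfl⟩ := hx
    exact ⟨v, rfl⟩
  obtain ⟨σ, hσ⟩ := Module.projective_lifting_property (π.restrictScalars R₁) LinearMap.id hπ
  have hσ' : ∀ x, π (σ x) = x := fun x => LinearMap.congr_fun hσ x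
  have hσs : ∀ (r : R) (x : s.carrier), σ (r • x) = r • σ x := by
    intro r x
    obtain ⟨r, rfl⟩ := hsurj r
    rw [algebraMap_smul, algebraMap_smul, map_smul]
  refine eq_bot_of_le_smul ℛ _ (IsNoetherian.noetherian _) ?_
  intro (v : Fin s.genRank → R) hv
  have hv0 : matrixAction R s.genMatrix v = 0 := hv
  have hvm := fun b => s.mem_homogeneousMaximalIdeal_of_ker hv0 b
  have hπv : π v = 0 := Subtype.ext hv0
  have hv1 : v = ∑ b, v b • (Pi.single b (1 : R) : Fin s.genRank → R) := by
    ext a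
    rw [Finset.sum_apply]
    simp [Pi.single_apply]
  have hsum : v = ∑ b, v b • ((Pi.single b (1 : R) : Fin s.genRank → R) -
      σ (π (Pi.single b (1 : R)))) := by
    simp only [smul_sub, Finset.sum_sub_distrib]
    rw [← hv1]
    have : ∑ b, v b • σ (π (Pi.single b (1 : R))) = σ (π v) := by
      conv_rhs => rw [hv1]
      rw [map_sum, map_sum]
      refine Finset.sum_congr rfl fun b _ => ?_
      rw [map_smul, hσs]
    rw [this, hπv, map_zero, sub_zero]
  rw [hsum]
  refine sum_mem fun b _ => Submodule.smul_mem_smul (hvm b) ?_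
  change matrixAction R s.genMatrix _ = 0
  have : π ((Pi.single b (1 : R) : Fin s.genRank → R) - σ (π (Pi.single b (1 : R)))) = 0 := by
    rw [map_sub, hσ', sub_self]
  exact congrArg Subtype.val this

theorem GradedSubmoduleOfFree.hasProjectiveDimensionLT_syzygy {k : Type*} [Field k] [Algebra k R]
    {ℛ : ℕ → Submodule k R} [GradedAlgebra ℛ] [IsNoetherianRing R] [IsLocalRing (ℛ 0)]
    [Module.Projective R₁ R] (s : GradedSubmoduleOfFree ℛ) {n : ℕ}
    (h : HasProjectiveDimensionLT (ModuleCat.of R₁ s.carrier) (n + 2)) :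
    HasProjectiveDimensionLT (ModuleCat.of R₁ s.syzygy.carrier) (n + 1) := by
  have hproj : Module.Projective R₁ (Fin s.genRank → R) :=
    Module.Projective.of_equiv
      (DFinsupp.linearEquivFunOnFintype (R := R₁) (M := fun _ : Fin s.genRank => R))
  have hsub : ∀ v, matrixAction R s.genMatrix v ∈ s.carrier := fun v => by
    rw [← s.genMatrix_generates.2]; exact ⟨v, rfl⟩
  let f : s.syzygy.carrier →ₗ[R] (Fin s.genRank → R) := s.syzygy.carrier.subtype
  let g : (Fin s.genRank → R) →ₗ[R] s.carrier :=
    (matrixAction R s.genMatrix).codRestrict s.carrier hsub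
  refine hasProjectiveDimensionLT_of_exact (f.restrictScalars R₁) (g.restrictScalars R₁)
    Subtype.val_injective ?_ ?_ h
  · rintro ⟨x, hx⟩
    rw [← s.genMatrix_generates.2] at hx
    obtain ⟨v, rfl⟩ := hx
    exact ⟨v, rfl⟩
  · intro v
    constructor
    · intro hv
      exact ⟨⟨v, congrArg Subtype.val hv⟩, rfl⟩
    · rintro ⟨⟨v, hv⟩, rfl⟩
      exact Subtype.ext hv

/-- If `R/J` has finite projective dimension, then the minimal graded free resolution of `J` is
finite. The projective dimension may be taken over a ring `R₁` that surjects onto `R` if `R` is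
projective over `R₁`. -/
theorem Ideal.exists_minimalComplex_rank_eq_zero {k : Type*} [Field k] [Algebra k R]
    {ℛ : ℕ → Submodule k R} [GradedAlgebra ℛ] [IsNoetherianRing R] [IsLocalRing (ℛ 0)]
    (hsurj : Function.Surjective (algebraMap R₁ R)) [Module.Projective R₁ R] (J : Ideal R)
    (hJ : J.IsHomogeneous ℛ) (hpd : projectiveDimension (ModuleCat.of R₁ (R ⧸ J)) < ⊤) :
    ∃ N, ∀ i, N < i → (J.toGradedSubmodule hJ).minimalComplex.rank i = 0 := by
  obtain ⟨n, hn⟩ := (projectiveDimension_ne_top_iff _).1 hpd.ne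
  set s := J.toGradedSubmodule hJ
  have h0 : HasProjectiveDimensionLT (ModuleCat.of R₁ s.carrier) (n + 1) := by
    have h1 : HasProjectiveDimensionLT (ModuleCat.of R₁ (R ⧸ J)) (n + 2) :=
      hasProjectiveDimensionLT_of_ge _ (n + 1) _ (by omega)
    let e : s.carrier →ₗ[R] (Fin 1 → R) := s.carrier.subtype
    let f : s.carrier →ₗ[R] R := (LinearMap.proj (0 : Fin 1)).comp e
    refine hasProjectiveDimensionLT_of_exact (f.restrictScalars R₁)
      ((Submodule.mkQ J).restrictScalars R₁) ?_ (Submodule.mkQ_surjective J) ?_ h1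
    · intro x y hxy
      refine Subtype.ext (funext fun a => ?_)
      have ha : a = (0 : Fin 1) := Subsingleton.elim (α := Fin 1) _ _
      rw [ha]
      exact hxy
    · intro x
      change Submodule.mkQ J x = 0 ↔ _
      rw [Submodule.mkQ_apply, Submodule.Quotient.mk_eq_zero]
      constructor
      · intro hx
        exact ⟨⟨fun _ => x, hx⟩, rfl⟩
      · rintro ⟨⟨v, hv⟩, rfl⟩
        exact hv
  have hi : ∀ i ≤ n, HasProjectiveDimensionLT (ModuleCat.of R₁ (s.iterSyzygy i).carrier)
      (n - i + 1) := by
    intro i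
    induction i with
    | zero => intro _; exact h0
    | succ i ih =>
      intro hin
      have h1 := ih (by omega)
      rw [show n - i + 1 = (n - (i + 1)) + 2 by omega] at h1
      exact (s.iterSyzygy i).hasProjectiveDimensionLT_syzygy h1
  have hN := hi n le_rfl
  rw [Nat.sub_self, zero_add] at hN
  have hproj : Module.Projective R₁ (s.iterSyzygy n).carrier :=
    (IsProjective.iff_projective _).2 (projective_iff_hasProjectiveDimensionLT_one.2 hN)
  refine ⟨n + 1, fun i hi => s.rank_eq_zero_of_le (N := n + 1) ?_ i hi⟩
  exact (s.iterSyzygy n).syzygy_eq_bot hsurj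

end ProjectiveDimension

section Koszul

open scoped Pointwise

/-- If a regular sequence generates an ideal containing the entries of the differentials of a
complex `F` that is exact on `M`, then `F` is zero in positions above the length of the
sequence. -/
theorem rank_eq_zero_of_isRegular {R : Type*} [CommRing R] {c : ℕ → ℕ}
    {D : ∀ i, Matrix (Fin (c i)) (Fin (c (i + 1))) R} (hD : ∀ i, D i * D (i + 1) = 0)
    {𝔪 : Ideal R} (hmin : ∀ i a b, D (i + 1) a b ∈ 𝔪) (rs : List R) :
    ∀ (M : Type*) [AddCommGroup M] [Module R M] (_ : RingTheory.Sequence.IsRegular M rs)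
      (_ : ∀ a ∈ 𝔪, ∀ m : M, a • m ∈ Ideal.ofList rs • (⊤ : Submodule R M)) (t : ℕ)
      (_ : ∀ i, t ≤ i → ExactAt D M i) (i : ℕ), t + rs.length ≤ i → 0 < i → c (i + 1) = 0 := by
  induction rs with
  | nil =>
    intro M _ _ hreg hm t hex i hi h0
    obtain ⟨j, rfl⟩ : ∃ j, i = j + 1 := ⟨i - 1, by omega⟩
    have hkill : ∀ a ∈ 𝔪, ∀ m : M, a • m = 0 := fun a ha m => by
      simpa using hm a ha m
    have : Nontrivial M := hreg.nontrivial
    obtain ⟨m, hm0⟩ := exists_ne (0 : M)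
    by_contra hne
    obtain ⟨u, hu⟩ := (hex (j + 1) (by simpa using hi) (fun _ => m)).1 (by
      ext a
      rw [matrixAction_apply]
      exact Finset.sum_eq_zero fun b _ => hkill _ (hmin _ _ _) _)
    apply hm0
    rw [← congrFun hu ⟨0, Nat.pos_of_ne_zero hne⟩, matrixAction_apply]
    exact Finset.sum_eq_zero fun b _ => hkill _ (hmin _ _ _) _
  | cons x rs ih =>
    intro M _ _ hreg hm t hex i hi h0
    rw [RingTheory.Sequence.isRegular_cons_iff] at hreg
    refine ih (QuotSMulTop x M) hreg.2 ?_ (t + 1) ?_ i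
      (by rw [List.length_cons] at hi; omega) h0
    · intro a ha m
      obtain ⟨m, rfl⟩ := Submodule.mkQ_surjective _ m
      have h1 := hm a ha m
      rw [Ideal.ofList_cons_smul] at h1
      obtain ⟨y, hy, z, hz, hyz⟩ := Submodule.mem_sup.1 h1
      rw [← map_smul, ← hyz, map_add]
      have hy0 : Submodule.mkQ _ y = 0 := (Submodule.Quotient.mk_eq_zero _).2 hy
      rw [hy0, zero_add]
      have := Submodule.mem_map_of_mem (f := Submodule.mkQ (x • (⊤ : Submodule R M))) hz
      rw [Submodule.map_smul''] at this
      exact Submodule.smul_mono le_rfl le_top this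
    · intro j hj
      obtain ⟨j, rfl⟩ : ∃ j', j = j' + 1 := ⟨j - 1, by omega⟩
      exact (hex j (by omega)).quotSMulTop hD hreg.1 (hex (j + 1) (by omega))

theorem MvPolynomial.isRegular_ofFn_X (k : Type*) [Field k] (d : ℕ) :
    RingTheory.Sequence.IsRegular (MvPolynomial (Fin d) k)
      (List.ofFn fun i : Fin d => (MvPolynomial.X i : MvPolynomial (Fin d) k)) := by
  have hspan : ∀ n, Ideal.ofList ((List.ofFn fun i : Fin d =>
      (MvPolynomial.X i : MvPolynomial (Fin d) k)).take n) =
      Ideal.span (MvPolynomial.X '' {i : Fin d | i.1 < n}) := by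
    intro n
    rw [Ideal.ofList]
    congr 1
    ext x
    simp only [Set.mem_ofPred_eq, Set.mem_image, List.mem_take_iff_getElem, List.length_ofFn,
      List.getElem_ofFn]
    constructor
    · rintro ⟨i, hi, rfl⟩
      exact ⟨⟨i, by omega⟩, by simp; omega, rfl⟩
    · rintro ⟨i, hi, rfl⟩
      exact ⟨i.1, by have := i.2; omega, rfl⟩
  constructor
  · rw [RingTheory.Sequence.isWeaklyRegular_iff_Fin]
    rintro ⟨i, hi⟩
    rw [isSMulRegular_iff_right_eq_zero_of_smul]
    intro f hf
    obtain ⟨f, rfl⟩ := Submodule.mkQ_surjective _ f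
    rw [← map_smul, Submodule.mkQ_apply, Submodule.Quotient.mk_eq_zero] at hf
    rw [Submodule.mkQ_apply, Submodule.Quotient.mk_eq_zero]
    simp only [hspan, smul_eq_mul, Ideal.mul_top, Fin.getElem_fin, List.getElem_ofFn,
      MvPolynomial.mem_ideal_span_X_image] at hf ⊢
    intro m hm
    obtain ⟨j, hj, hne⟩ := hf (m + Finsupp.single ⟨i, by simpa using hi⟩ 1) (by
      rw [MvPolynomial.mem_support_iff, mul_comm, MvPolynomial.coeff_mul_X]
      exact MvPolynomial.mem_support_iff.1 hm)
    refine ⟨j, hj, ?_⟩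
    have hj' : j.1 < i := hj
    rw [Finsupp.add_apply, Finsupp.single_apply, if_neg (by
      intro h; rw [← h] at hj'; simp at hj'), add_zero] at hne
    exact hne
  · intro h
    have h1 := hspan d
    rw [List.take_of_length_le (by simp)] at h1
    rw [h1, smul_eq_mul, Ideal.mul_top, eq_comm, Ideal.eq_top_iff_one,
      MvPolynomial.mem_ideal_span_X_image] at h
    obtain ⟨j, -, hj⟩ := h 0 (by simp)
    exact hj rfl

end Koszul

/-! ### Graded Noether normalization -/

section NoetherNormalization

variable {k S : Type*} [Field k] [CommRing S] [Algebra k S] (𝒮 : ℕ → Submodule k S)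
  [GradedAlgebra 𝒮]

open HomogeneousIdeal in
/-- Homogeneous prime avoidance for a finite antichain of homogeneous primes that do not contain
the irrelevant ideal. -/
theorem exists_homogeneous_notMem (T : Finset (Ideal S)) (hprime : ∀ P ∈ T, P.IsPrime)
    (hhom : ∀ P ∈ T, P.IsHomogeneous 𝒮) (hanti : ∀ P ∈ T, ∀ Q ∈ T, P ≤ Q → P = Q)
    (hirr : ∀ P ∈ T, ¬ (irrelevant 𝒮).toIdeal ≤ P) :
    ∃ n, 0 < n ∧ ∃ θ ∈ 𝒮 n, ∀ P ∈ T, θ ∉ P := by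
  classical
  induction T using Finset.induction_on with
  | empty => exact ⟨1, one_pos, 0, zero_mem _, by simp⟩
  | insert Q T hQT ih =>
    obtain ⟨n, hn, θ, hθ, hθT⟩ := ih (fun P hP => hprime P (Finset.mem_insert_of_mem hP))
      (fun P hP => hhom P (Finset.mem_insert_of_mem hP))
      (fun P hP P' hP' => hanti P (Finset.mem_insert_of_mem hP) P' (Finset.mem_insert_of_mem hP'))
      (fun P hP => hirr P (Finset.mem_insert_of_mem hP))
    have hQ := Finset.mem_insert_self Q T
    have hQp := hprime Q hQ
    by_cases hθQ : θ ∈ Q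
    swap
    · refine ⟨n, hn, θ, hθ, fun P hP => ?_⟩
      rcases Finset.mem_insert.1 hP with rfl | hP
      · exact hθQ
      · exact hθT P hP
    -- a homogeneous element of `P` that is not in `Q`
    have h1 : ∀ P ∈ T, ∃ m, ∃ b ∈ 𝒮 m, b ∈ P ∧ b ∉ Q := by
      intro P hP
      have hne : ¬ P ≤ Q := fun h => hQT (by
        rw [← hanti P (Finset.mem_insert_of_mem hP) Q hQ h]; exact hP)
      obtain ⟨x, hxP, hxQ⟩ := Set.not_subset.1 hne
      have hx : ¬ ∀ i, (DirectSum.decompose 𝒮 x i : S) ∈ Q := fun h =>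
        hxQ (((hhom Q hQ).mem_iff 𝒮).2 h)
      push Not at hx
      obtain ⟨i, hi⟩ := hx
      exact ⟨i, _, SetLike.coe_mem _, hhom P (Finset.mem_insert_of_mem hP) i hxP, hi⟩
    choose! m b hb hbP hbQ using h1
    obtain ⟨m₀, hm₀, b₀, hb₀, hb₀Q⟩ : ∃ m, 0 < m ∧ ∃ b ∈ 𝒮 m, b ∉ Q := by
      by_contra! hcon
      apply hirr Q hQ
      rw [toIdeal_irrelevant_le]
      intro i hi x hx
      exact hcon i hi x hx
    set c := b₀ * ∏ P ∈ T, b P with hc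
    set M := m₀ + ∑ P ∈ T, m P with hM
    have hcM : c ∈ 𝒮 M := SetLike.mul_mem_graded hb₀ (SetLike.prod_mem_graded 𝒮 m b hb)
    have hcQ : c ∉ Q := by
      intro h
      rcases hQp.mem_or_mem h with h | h
      · exact hb₀Q h
      · obtain ⟨P, hP, h⟩ := (Ideal.IsPrime.prod_mem_iff).1 h
        exact hbQ P hP h
    have hcT : ∀ P ∈ T, c ∈ P := fun P hP => by
      refine Ideal.mul_mem_left _ _ ?_
      rw [← Finset.mul_prod_erase T b hP]
      exact Ideal.mul_mem_right _ _ (hbP P hP)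
    have hMpos : 0 < M := by omega
    refine ⟨M * n, Nat.mul_pos hMpos hn, θ ^ M + c ^ n, add_mem ?_ ?_, ?_⟩
    · have := SetLike.pow_mem_graded M hθ
      simpa [smul_eq_mul] using this
    · have := SetLike.pow_mem_graded n hcM
      rw [smul_eq_mul] at this
      rwa [mul_comm M n]
    · intro P hP h
      rcases Finset.mem_insert.1 hP with rfl | hP'
      · have h2 : θ ^ M ∈ P := Ideal.pow_mem_of_mem _ hθQ _ hMpos
        have h3 := (Submodule.add_mem_iff_right _ h2).1 h
        exact hcQ (hQp.mem_of_pow_mem _ h3)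
      · have h2 : c ^ n ∈ P := Ideal.pow_mem_of_mem _ (hcT P hP') _ hn
        have h3 := (Submodule.add_mem_iff_left _ h2).1 h
        exact hθT P hP' ((hprime P hP).mem_of_pow_mem _ h3)

variable (h𝒮 : 𝒮 0 = 1)

include h𝒮 in
theorem exists_algebraMap_eq_projZ (x : S) : ∃ a : k, algebraMap k S a = projZ 𝒮 0 x := by
  have h := projZ_mem 𝒮 0 x
  have h2 : intPiece 𝒮 0 = 𝒮 0 := intPiece_natCast 𝒮 0
  rw [h2, h𝒮, Submodule.mem_one] at h
  exact h

open HomogeneousIdeal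

theorem mem_irrelevant_iff_projZ {x : S} : x ∈ (irrelevant 𝒮).toIdeal ↔ projZ 𝒮 0 x = 0 := by
  rw [projZ_of_nonneg 𝒮 le_rfl]
  exact mem_irrelevant_iff 𝒮 x

include h𝒮 in
theorem le_irrelevant_of_isHomogeneous {P : Ideal S} (hP : P.IsHomogeneous 𝒮) (hne : P ≠ ⊤) :
    P ≤ (irrelevant 𝒮).toIdeal := by
  intro x hx
  rw [mem_irrelevant_iff_projZ]
  obtain ⟨a, ha⟩ := exists_algebraMap_eq_projZ 𝒮 h𝒮 x
  have h1 : projZ 𝒮 0 x ∈ P := by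
    rw [projZ_of_nonneg 𝒮 le_rfl]; exact hP _ hx
  rw [← ha] at h1 ⊢
  by_cases h0 : a = 0
  · rw [h0, map_zero]
  · exact absurd (P.eq_top_of_isUnit_mem h1 ((isUnit_iff_ne_zero.2 h0).map _)) hne

theorem sub_projZ_mem_irrelevant (x : S) : x - projZ 𝒮 0 x ∈ (irrelevant 𝒮).toIdeal := by
  have h := projZ_mem 𝒮 0 x
  rw [mem_irrelevant_iff_projZ, map_sub, projZ_of_mem 𝒮 h, sub_self]

include h𝒮 in
theorem eq_irrelevant_of_le {P : Ideal S} (hne : P ≠ ⊤) (h : (irrelevant 𝒮).toIdeal ≤ P) :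
    P = (irrelevant 𝒮).toIdeal := by
  refine le_antisymm (fun x hx => ?_) h
  rw [mem_irrelevant_iff_projZ]
  obtain ⟨a, ha⟩ := exists_algebraMap_eq_projZ 𝒮 h𝒮 x
  have h1 : projZ 𝒮 0 x ∈ P := by
    have := sub_mem hx (h (sub_projZ_mem_irrelevant 𝒮 x))
    rwa [sub_sub_cancel] at this
  rw [← ha] at h1 ⊢
  by_cases h0 : a = 0
  · rw [h0, map_zero]
  · exact absurd (P.eq_top_of_isUnit_mem h1 ((isUnit_iff_ne_zero.2 h0).map _)) hne

theorem irrelevant_isPrime [IsDomain S] : (irrelevant 𝒮).toIdeal.IsPrime := by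
  have : (irrelevant 𝒮).toIdeal = RingHom.ker (GradedRing.projZeroRingHom 𝒮) := by
    ext x
    exact mem_irrelevant_iff 𝒮 x
  rw [this]
  exact RingHom.ker_isPrime _

omit 𝒮 [Algebra k S] [GradedAlgebra 𝒮] [Field k] in
/-- Chains of primes of `S` that contain the ideal `𝔞` have length at most `e`; this says that
`dim S/𝔞 ≤ e`. -/
def PrimeChainsLE (𝔞 : Ideal S) (e : ℕ) : Prop :=
  ∀ l : LTSeries (PrimeSpectrum S), 𝔞 ≤ l.head.asIdeal → l.length ≤ e

theorem isHomogeneous_of_mem_minimalPrimes {𝔞 P : Ideal S} (h𝔞 : 𝔞.IsHomogeneous 𝒮)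
    (hP : P ∈ 𝔞.minimalPrimes) : P.IsHomogeneous 𝒮 := by
  have h1 := hP.1.1.homogeneousCore (𝒜 := 𝒮)
  have h2 : 𝔞 ≤ (P.homogeneousCore 𝒮).toIdeal := by
    rw [← h𝔞.toIdeal_homogeneousCore_eq_self]
    exact Ideal.homogeneousCore_mono 𝒮 hP.1.2
  have h3 := hP.2 ⟨h1, h2⟩ (Ideal.toIdeal_homogeneousCore_le 𝒮 P)
  rw [← le_antisymm (Ideal.toIdeal_homogeneousCore_le 𝒮 P) h3]
  exact HomogeneousIdeal.isHomogeneous _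

include h𝒮 in
/-- Homogeneous systems of parameters exist: if `dim S/𝔞 ≤ e` then the irrelevant ideal is, up to
radical, generated by `𝔞` and `e` homogeneous elements. -/
theorem exists_homogeneous_parameters [IsDomain S] [IsNoetherianRing S] (e : ℕ) :
    ∀ 𝔞 : Ideal S, 𝔞.IsHomogeneous 𝒮 → PrimeChainsLE 𝔞 e →
      ∃ θ : Fin e → S, (∀ i, ∃ n, 0 < n ∧ θ i ∈ 𝒮 n) ∧
        (irrelevant 𝒮).toIdeal ≤ (𝔞 ⊔ Ideal.span (Set.range θ)).radical := by
  classical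
  have hirr := irrelevant_isPrime 𝒮
  induction e with
  | zero =>
    intro 𝔞 h𝔞 hdim
    refine ⟨Fin.elim0, fun i => i.elim0, ?_⟩
    rw [Ideal.radical_eq_sInf]
    refine le_sInf ?_
    rintro P ⟨hP, hPp⟩
    obtain ⟨P₀, hP₀, hle⟩ := Ideal.exists_minimalPrimes_le (le_sup_left.trans hP)
    have h1 := le_irrelevant_of_isHomogeneous 𝒮 h𝒮 (isHomogeneous_of_mem_minimalPrimes 𝒮 h𝔞 hP₀)
      hP₀.1.1.ne_top
    rcases h1.eq_or_lt with h2 | h2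
    · rw [← h2]; exact hle
    · exfalso
      let l : LTSeries (PrimeSpectrum S) :=
        RelSeries.cons (RelSeries.singleton _ ⟨_, hirr⟩) ⟨P₀, hP₀.1.1⟩ h2
      have := hdim l (show 𝔞 ≤ P₀ from hP₀.1.2)
      have h3 : l.length = 1 := rfl
      omega
  | succ e ih =>
    intro 𝔞 h𝔞 hdim
    have hfin := Ideal.finite_minimalPrimes_of_isNoetherianRing S 𝔞
    obtain ⟨n, hn, θ₀, hθ₀, hθ₀T⟩ := exists_homogeneous_notMem 𝒮
      (hfin.toFinset.filter fun P => ¬ (irrelevant 𝒮).toIdeal ≤ P)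
      (fun P hP => ((hfin.mem_toFinset).1 (Finset.mem_filter.1 hP).1).1.1)
      (fun P hP => isHomogeneous_of_mem_minimalPrimes 𝒮 h𝔞
        ((hfin.mem_toFinset).1 (Finset.mem_filter.1 hP).1))
      (fun P hP Q hQ hPQ => le_antisymm hPQ
        (((hfin.mem_toFinset).1 (Finset.mem_filter.1 hQ).1).2
          ((hfin.mem_toFinset).1 (Finset.mem_filter.1 hP).1).1 hPQ))
      (fun P hP => (Finset.mem_filter.1 hP).2)
    have h𝔞' : (𝔞 ⊔ Ideal.span {θ₀}).IsHomogeneous 𝒮 :=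
      h𝔞.sup (Ideal.homogeneous_span 𝒮 _ (by
        rintro x hx
        rw [Set.mem_singleton_iff] at hx
        subst hx
        exact ⟨n, hθ₀⟩))
    obtain ⟨θ, hθ, hrad⟩ := ih _ h𝔞' (by
      intro l hl
      have hl1 : 𝔞 ≤ l.head.asIdeal := le_sup_left.trans hl
      have hl2 : θ₀ ∈ l.head.asIdeal := hl (Ideal.mem_sup_right (Ideal.mem_span_singleton_self _))
      have hprime := l.head.isPrime
      obtain ⟨P, hP, hle⟩ := Ideal.exists_minimalPrimes_le hl1
      by_cases hθP : θ₀ ∈ P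
      · have h1 : (irrelevant 𝒮).toIdeal ≤ P := by
          by_contra h
          exact hθ₀T P (Finset.mem_filter.2 ⟨(hfin.mem_toFinset).2 hP, h⟩) hθP
        have h2 : l.last = l.head := by
          apply PrimeSpectrum.ext
          rw [eq_irrelevant_of_le 𝒮 h𝒮 l.head.isPrime.ne_top (h1.trans hle),
            eq_irrelevant_of_le 𝒮 h𝒮 l.last.isPrime.ne_top
              ((h1.trans hle).trans l.head_le_last)]
        by_contra hcon
        have h3 := l.strictMono (a := 0) (b := Fin.last _) (by
          rw [Fin.lt_def]; simp; omega)
        exact h3.ne h2.symm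
      · have hlt : (⟨P, hP.1.1⟩ : PrimeSpectrum S) < l.head :=
          lt_of_le_of_ne hle (fun h => hθP (by rw [← h] at hl2; exact hl2))
        have := hdim (RelSeries.cons l ⟨P, hP.1.1⟩ hlt) (by
          rw [RelSeries.head_cons]; exact hP.1.2)
        rw [RelSeries.cons_length] at this
        omega)
    refine ⟨Fin.cons θ₀ θ, ?_, ?_⟩
    · intro i
      refine Fin.cases ⟨n, hn, hθ₀⟩ (fun j => ?_) i
      exact hθ j
    · refine hrad.trans (Ideal.radical_mono ?_)
      rw [Fin.range_cons, Set.insert_eq, Ideal.span_union, sup_assoc]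

include h𝒮 in
/-- Graded Noether normalization: a graded domain of dimension `d` is finite over a polynomial ring
in `d` variables which are sent to homogeneous elements of one and the same degree `D`. -/
theorem exists_noether_normalization [IsDomain S] [Algebra.FiniteType k S] {d : ℕ}
    (hd : ringKrullDim S = d) :
    ∃ (D : ℕ) (θ : Fin d → S), 0 < D ∧ (∀ i, θ i ∈ 𝒮 D) ∧
      (MvPolynomial.aeval (R := k) θ).toRingHom.Finite ∧
      Function.Injective (MvPolynomial.aeval (R := k) θ) := by
  classical
  have hnoeth : IsNoetherianRing S := Algebra.FiniteType.isNoetherianRing k S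
  obtain ⟨θ, hθ, hrad⟩ := exists_homogeneous_parameters 𝒮 h𝒮 d ⊥ (Ideal.IsHomogeneous.bot 𝒮)
    (fun l _ => by
      have : (l.length : WithBot ℕ∞) ≤ ringKrullDim S := Order.le_krullDim_iff.2 ⟨l, rfl⟩
      rw [hd] at this
      exact_mod_cast this)
  choose n hn hθn using hθ
  set D := ∏ i, n i with hD
  have hDpos : 0 < D := Finset.prod_pos fun i _ => hn i
  let e : Fin d → ℕ := fun i => ∏ j ∈ Finset.univ.erase i, n j
  have hDe : ∀ i, e i * n i = D := fun i => by
    rw [mul_comm]; exact Finset.mul_prod_erase _ _ (Finset.mem_univ i)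
  have hepos : ∀ i, 0 < e i := fun i => Finset.prod_pos fun j _ => hn j
  let η : Fin d → S := fun i => θ i ^ e i
  have hη : ∀ i, η i ∈ 𝒮 D := fun i => by
    have := SetLike.pow_mem_graded (e i) (hθn i)
    rwa [smul_eq_mul, hDe] at this
  have hrad' : (irrelevant 𝒮).toIdeal ≤ (Ideal.span (Set.range η)).radical := by
    refine hrad.trans ?_
    rw [bot_sup_eq, Ideal.radical_le_radical_iff, Ideal.span_le]
    rintro _ ⟨i, rfl⟩
    exact ⟨e i, Ideal.subset_span ⟨i, rfl⟩⟩
  refine ⟨D, η, hDpos, hη, ?_⟩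
  set 𝔟 := Ideal.span (Set.range η) with h𝔟
  -- `S/𝔟` is integral, hence finite, over `k`
  have hint : Algebra.IsIntegral k (S ⧸ 𝔟) := ⟨fun x => by
    obtain ⟨x, rfl⟩ := Ideal.Quotient.mk_surjective x
    obtain ⟨a, ha⟩ := exists_algebraMap_eq_projZ 𝒮 h𝒮 x
    obtain ⟨m, hm⟩ := hrad' (sub_projZ_mem_irrelevant 𝒮 x)
    have h1 : IsIntegral k (Ideal.Quotient.mk 𝔟 (x - projZ 𝒮 0 x)) :=
      ⟨Polynomial.X ^ m, Polynomial.monic_X_pow m, by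
        rw [Polynomial.eval₂_X_pow, ← map_pow]
        exact Ideal.Quotient.eq_zero_iff_mem.2 hm⟩
    have h2 : IsIntegral k (algebraMap k (S ⧸ 𝔟) a) := isIntegral_algebraMap
    have h3 : Ideal.Quotient.mk 𝔟 x =
        Ideal.Quotient.mk 𝔟 (x - projZ 𝒮 0 x) + algebraMap k (S ⧸ 𝔟) a := by
      rw [IsScalarTower.algebraMap_apply k S (S ⧸ 𝔟), ha, Ideal.Quotient.algebraMap_eq, ← map_add,
        sub_add_cancel]
    rw [h3]
    exact h1.add h2⟩
  have hfin : Module.Finite k (S ⧸ 𝔟) := Algebra.IsIntegral.finite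
  obtain ⟨G, hG⟩ := hfin.fg_top
  choose lift hlift using fun x : S ⧸ 𝔟 => Ideal.Quotient.mk_surjective x
  choose T hT using fun x : S => exists_sum_projZ 𝒮 x
  let algA : Algebra (MvPolynomial (Fin d) k) S := (MvPolynomial.aeval (R := k) η).toAlgebra
  have hsmul : ∀ (a : MvPolynomial (Fin d) k) (x : S), a • x = MvPolynomial.aeval η a * x :=
    fun a x => rfl
  -- finitely many homogeneous elements that span `S` modulo `𝔟`
  let G' : Finset S := G.biUnion fun g => (T (lift g)).image fun j => projZ 𝒮 j (lift g)
  have hG'hom : ∀ x ∈ G', ∃ j, x ∈ intPiece 𝒮 j := by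
    intro x hx
    obtain ⟨g, -, hx⟩ := Finset.mem_biUnion.1 hx
    obtain ⟨j, -, rfl⟩ := Finset.mem_image.1 hx
    exact ⟨j, projZ_mem 𝒮 _ _⟩
  have hspan : ∀ x : S, ∃ y ∈ Submodule.span k (G' : Set S), x - y ∈ 𝔟 := by
    intro x
    have hx : Ideal.Quotient.mk 𝔟 x ∈ Submodule.span k (G : Set (S ⧸ 𝔟)) := by rw [hG]; trivial
    have key : ∀ z ∈ Submodule.span k (G : Set (S ⧸ 𝔟)),
        ∃ y ∈ Submodule.span k (G' : Set S), Ideal.Quotient.mk 𝔟 y = z := by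
      intro z hz
      induction hz using Submodule.span_induction with
      | mem g hg =>
        refine ⟨lift g, ?_, hlift g⟩
        rw [← hT (lift g) _ subset_rfl]
        refine sum_mem fun j hj => Submodule.subset_span ?_
        exact Finset.mem_biUnion.2 ⟨g, hg, Finset.mem_image_of_mem _ hj⟩
      | zero => exact ⟨0, zero_mem _, map_zero _⟩
      | add a b _ _ ha hb =>
        obtain ⟨y, hy, rfl⟩ := ha
        obtain ⟨z, hz, rfl⟩ := hb
        exact ⟨y + z, add_mem hy hz, map_add _ _ _⟩
      | smul c a _ ha =>
        obtain ⟨y, hy, rfl⟩ := ha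
        exact ⟨c • y, Submodule.smul_mem _ _ hy, rfl⟩
    obtain ⟨y, hy, hyx⟩ := key _ hx
    exact ⟨y, hy, (Ideal.Quotient.eq).1 hyx.symm⟩
  have hall : ∀ m : ℕ, ∀ x ∈ 𝒮 m, x ∈ Submodule.span (MvPolynomial (Fin d) k) (G' : Set S) := by
    intro m
    induction m using Nat.strong_induction_on with
    | _ m ih =>
      intro x hx
      have hxm : x ∈ intPiece 𝒮 (m : ℤ) := by rw [intPiece_natCast]; exact hx
      obtain ⟨y, hy, hxy⟩ := hspan x
      obtain ⟨c, hc⟩ := (Submodule.mem_span_range_iff_exists_fun S).1 hxy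
      have hx2 : x = projZ 𝒮 m y + ∑ i, η i * projZ 𝒮 (m - D) (c i) := by
        have h1 : x = y + ∑ i, η i * c i := by
          have : ∑ i, η i * c i = x - y := by
            rw [← hc]; exact Finset.sum_congr rfl fun i _ => mul_comm _ _
          rw [this]; ring
        conv_lhs => rw [← projZ_of_mem 𝒮 hxm, h1, map_add, map_sum]
        congr 1
        refine Finset.sum_congr rfl fun i _ => ?_
        exact projZ_mul 𝒮 (i := D) (by rw [intPiece_natCast]; exact hη i) _ _
      rw [hx2]
      refine add_mem ?_ (sum_mem fun i _ => ?_)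
      · have h2 : ∀ z ∈ Submodule.span k (G' : Set S),
            projZ 𝒮 m z ∈ Submodule.span (MvPolynomial (Fin d) k) (G' : Set S) := by
          intro z hz
          induction hz using Submodule.span_induction with
          | mem g hg =>
            obtain ⟨j, hj⟩ := hG'hom g hg
            by_cases hjm : j = m
            · rw [← hjm, projZ_of_mem 𝒮 hj]
              exact Submodule.subset_span hg
            · rw [projZ_of_mem_ne 𝒮 hj hjm]; exact zero_mem _
          | zero => rw [map_zero]; exact zero_mem _
          | add a b _ _ ha hb => rw [map_add]; exact add_mem ha hb
          | smul c a _ ha =>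
            rw [map_smul]
            have : c • projZ 𝒮 m a = (MvPolynomial.C c : MvPolynomial (Fin d) k) •
                projZ 𝒮 m a := by
              rw [hsmul, MvPolynomial.aeval_C, Algebra.smul_def]
            rw [this]
            exact Submodule.smul_mem _ _ ha
        exact h2 y hy
      · have : η i * projZ 𝒮 (m - D) (c i) =
            (MvPolynomial.X i : MvPolynomial (Fin d) k) • projZ 𝒮 (m - D) (c i) := by
          rw [hsmul, MvPolynomial.aeval_X]
        rw [this]
        refine Submodule.smul_mem _ _ ?_
        rcases lt_or_ge ((m : ℤ) - D) 0 with h | h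
        · rw [projZ_of_neg 𝒮 h]; exact zero_mem _
        · have h3 := projZ_mem 𝒮 ((m : ℤ) - D) (c i)
          rw [intPiece_of_nonneg 𝒮 h] at h3
          exact ih _ (by omega) _ h3
  have hfinite : Module.Finite (MvPolynomial (Fin d) k) S := ⟨G', by
    rw [_root_.eq_top_iff]
    intro x _
    rw [← DirectSum.sum_support_decompose 𝒮 x]
    exact sum_mem fun i _ => hall i _ (SetLike.coe_mem _)⟩
  refine ⟨hfinite, ?_⟩
  -- a nonzero kernel would give a chain of primes of length `d + 1` in the polynomial ring
  rw [injective_iff_map_eq_zero]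
  by_contra! hcon
  obtain ⟨g, hg0, hgne⟩ := hcon
  have hintS : Algebra.IsIntegral (MvPolynomial (Fin d) k) S := Algebra.IsIntegral.of_finite _ _
  obtain ⟨l, hl⟩ := Order.le_krullDim_iff.1 (show (d : WithBot ℕ∞) ≤ ringKrullDim S from hd.ge)
  have hmono : StrictMono (PrimeSpectrum.comap (algebraMap (MvPolynomial (Fin d) k) S)) :=
    fun P Q hPQ => Ideal.IsIntegral.comap_lt_comap (I := P.asIdeal) (J := Q.asIdeal) hPQ
  let l' := l.map _ hmono
  have hlt : (⟨⊥, Ideal.isPrime_bot⟩ : PrimeSpectrum (MvPolynomial (Fin d) k)) < l'.head := by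
    refine lt_of_le_of_ne (bot_le (a := l'.head.asIdeal)) fun h => ?_
    have h1 : g ∈ l'.head.asIdeal := by
      change g ∈ Ideal.comap (algebraMap (MvPolynomial (Fin d) k) S) l.head.asIdeal
      rw [Ideal.mem_comap]
      have : algebraMap (MvPolynomial (Fin d) k) S g = 0 := hg0
      rw [this]; exact zero_mem _
    rw [← h] at h1
    exact hgne h1
  have h1 : (((RelSeries.cons l' _ hlt).length : ℕ) : WithBot ℕ∞) ≤
    ringKrullDim (MvPolynomial (Fin d) k) :=
    Order.le_krullDim_iff.2 ⟨_, rfl⟩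
  rw [MvPolynomial.ringKrullDim_of_isNoetherianRing, ringKrullDim_eq_zero_of_field,
    RelSeries.cons_length] at h1
  have h2 : l'.length = d := hl
  rw [h2] at h1
  simp only [Nat.card_eq_fintype_card, Fintype.card_fin, zero_add] at h1
  have h3 : d + 1 ≤ d := by exact_mod_cast h1
  omega

end NoetherNormalization

/-! ### Comparison of Hilbert functions along a finite extension -/

section Dimension

variable {k V : Type*} [Field k] [AddCommGroup V] [Module k V]

theorem finrank_sup_map_add_le {W : Type*} [AddCommGroup W] [Module k W] (U : Submodule k V)
    [Module.Finite k U] {X Y : Submodule k W} [Module.Finite k X] (hYX : Y ≤ X)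
    (φ : W →ₗ[k] V) (hφ : Y.map φ ≤ U) :
    Module.finrank k ↥(U ⊔ X.map φ) + Module.finrank k Y ≤
      Module.finrank k U + Module.finrank k X := by
  have hYfin : Module.Finite k Y := Submodule.finiteDimensional_of_le hYX
  have h1 := Submodule.finrank_sup_add_finrank_inf_eq U (X.map φ)
  have h2 := (φ.domRestrict X).finrank_range_add_finrank_ker
  have h3 := (φ.domRestrict Y).finrank_range_add_finrank_ker
  rw [LinearMap.range_domRestrict] at h2 h3
  have h4 : Module.finrank k ↥(Y.map φ) ≤ Module.finrank k ↥(U ⊓ X.map φ) :=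
    Submodule.finrank_mono (le_inf hφ (Submodule.map_mono hYX))
  have h5 : Module.finrank k (LinearMap.ker (φ.domRestrict Y)) ≤
      Module.finrank k (LinearMap.ker (φ.domRestrict X)) := by
    rw [← Submodule.finrank_map_subtype_eq Y, ← Submodule.finrank_map_subtype_eq X]
    refine Submodule.finrank_mono ?_
    rintro _ ⟨⟨y, hy⟩, hy0, rfl⟩
    exact ⟨⟨y, hYX hy⟩, hy0, rfl⟩
  omega

/-- If `V` is covered by `U` and the images of finitely many spaces `X_λ`, each of which has a
subspace `Y_λ` that is mapped into `U`, then `dim V - dim U ≤ ∑ (dim X_λ - dim Y_λ)`. -/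
theorem finrank_add_sum_le {ι : Type*} {W : Type*} [AddCommGroup W] [Module k W]
    (s : Finset ι) (U : Submodule k V) [Module.Finite k U] (X Y : ι → Submodule k W)
    [∀ i, Module.Finite k (X i)] (hYX : ∀ i, Y i ≤ X i) (φ : ι → W →ₗ[k] V)
    (hφ : ∀ i, (Y i).map (φ i) ≤ U) (V' : Submodule k V)
    (hV : V' ≤ U ⊔ s.sup fun i => (X i).map (φ i)) :
    Module.finrank k V' + ∑ i ∈ s, Module.finrank k (Y i) ≤
      Module.finrank k U + ∑ i ∈ s, Module.finrank k (X i) := by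
  classical
  suffices h : Module.Finite k ↥(U ⊔ s.sup fun i => (X i).map (φ i)) ∧
      Module.finrank k ↥(U ⊔ s.sup fun i => (X i).map (φ i)) + ∑ i ∈ s, Module.finrank k (Y i) ≤
      Module.finrank k U + ∑ i ∈ s, Module.finrank k (X i) by
    have := h.1
    have := Submodule.finrank_mono hV
    omega
  clear hV
  induction s using Finset.induction_on with
  | empty =>
    rw [Finset.sup_empty, sup_bot_eq]
    exact ⟨inferInstance, by simp⟩
  | insert i s hi ih =>
    obtain ⟨h1, h2⟩ := ih
    rw [Finset.sup_insert, sup_left_comm, sup_comm, Finset.sum_insert hi, Finset.sum_insert hi]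
    refine ⟨inferInstance, ?_⟩
    have := finrank_sup_map_add_le (U ⊔ s.sup fun i => (X i).map (φ i)) (hYX i) (φ i)
      ((hφ i).trans le_sup_left)
    omega

end Dimension

section Frame

variable {k A B : Type*} [Field k] [CommRing A] [CommRing B] [Algebra k A] [Algebra k B]
  [Algebra A B] [IsScalarTower k A B] (𝒜 : ℕ → Submodule k A) (ℬ : ℕ → Submodule k B)

omit [IsScalarTower k A B] in
theorem algebraMap_mem_intPiece (h : ∀ n, ∀ a ∈ 𝒜 n, algebraMap A B a ∈ ℬ n) {j : ℤ} {a : A}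
    (ha : a ∈ intPiece 𝒜 j) : algebraMap A B a ∈ intPiece ℬ j := by
  rcases lt_or_ge j 0 with hj | hj
  · rw [intPiece_of_neg _ hj, Submodule.mem_bot] at ha
    rw [ha, map_zero]; exact zero_mem _
  · rw [intPiece_of_nonneg _ hj] at ha ⊢
    exact h _ a ha

omit [IsScalarTower k A B] in
theorem projZ_algebraMap [GradedAlgebra 𝒜] [GradedAlgebra ℬ]
    (h : ∀ n, ∀ a ∈ 𝒜 n, algebraMap A B a ∈ ℬ n) (j : ℤ) (a : A) :
    projZ ℬ j (algebraMap A B a) = algebraMap A B (projZ 𝒜 j a) := by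
  obtain ⟨s, hs⟩ := exists_sum_projZ 𝒜 a
  conv_lhs => rw [← hs (insert j s) (Finset.subset_insert _ _), map_sum, map_sum]
  rw [Finset.sum_eq_single_of_mem j (Finset.mem_insert_self _ _)]
  · exact projZ_of_mem ℬ (algebraMap_mem_intPiece 𝒜 ℬ h (projZ_mem 𝒜 j a))
  · intro i _ hij
    exact projZ_of_mem_ne ℬ (algebraMap_mem_intPiece 𝒜 ℬ h (projZ_mem 𝒜 i a)) hij

omit [Algebra k A] [Algebra k B] [IsScalarTower k A B] [Field k] in
theorem exists_smul_mem_of_finite [IsDomain A] {m : ℕ} (v : Fin m → B) :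
    ∃ I : Finset (Fin m), LinearIndepOn A v (I : Set (Fin m)) ∧ ∃ s : A, s ≠ 0 ∧
      ∀ j, s • v j ∈ Submodule.span A (v '' I) := by
  classical
  obtain ⟨I, hI, hmax⟩ := exists_maximal_linearIndepOn A v
  have h : ∀ i, ∃ a : A, a ≠ 0 ∧ a • v i ∈ Submodule.span A (v '' I) := by
    intro i
    by_cases hi : i ∈ I
    · exact ⟨1, one_ne_zero, by
        rw [one_smul]; exact Submodule.subset_span (Set.mem_image_of_mem v hi)⟩
    · exact hmax i hi
  choose a ha hav using h
  refine ⟨I.toFinset, by rwa [Set.coe_toFinset], ∏ i, a i, Finset.prod_ne_zero_iff.2 fun i _ => ha i,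
    fun j => ?_⟩
  rw [Set.coe_toFinset, ← Finset.mul_prod_erase _ _ (Finset.mem_univ j), mul_comm, mul_smul]
  exact Submodule.smul_mem _ _ (hav j)

/-- Data that compare a graded ring `B` with a free module over the graded ring `A`: homogeneous
elements `w i` of `B` that are linearly independent over `A`, homogeneous generators `v j` of the
`A`-module `B`, and a nonzero homogeneous `s` in `A` such that `s B` lies in the span of the
`w i`. -/
structure HomogeneousFrame where
  r : ℕ
  w : Fin r → B
  a : Fin r → ℤ
  w_mem : ∀ i, w i ∈ intPiece ℬ (a i)
  linearIndependent : LinearIndependent A w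
  m : ℕ
  v : Fin m → B
  b : Fin m → ℤ
  v_mem : ∀ j, v j ∈ intPiece ℬ (b j)
  span_v : Submodule.span A (Set.range v) = ⊤
  s : A
  σ : ℤ
  s_mem : s ∈ intPiece 𝒜 σ
  s_ne_zero : s ≠ 0
  smul_mem : ∀ j, s • v j ∈ Submodule.span A (Set.range w)

omit [Algebra k A] [IsScalarTower k A B] in
theorem exists_homogeneous_generators [GradedAlgebra ℬ] [Module.Finite A B] :
    ∃ (m : ℕ) (v : Fin m → B) (b : Fin m → ℤ), (∀ j, v j ∈ intPiece ℬ (b j)) ∧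
      Submodule.span A (Set.range v) = ⊤ := by
  classical
  obtain ⟨n, g, hg⟩ := Module.Finite.exists_fin (R := A) (M := B)
  choose T hT using fun i => exists_sum_projZ ℬ (g i)
  let ι := Σ i : Fin n, T i
  let e := Fintype.equivFin ι
  refine ⟨Fintype.card ι, fun j => projZ ℬ (e.symm j).2 (g (e.symm j).1), fun j => (e.symm j).2,
    fun j => projZ_mem ℬ _ _, ?_⟩
  rw [eq_top_iff, ← hg, Submodule.span_le]
  rintro _ ⟨i, rfl⟩
  rw [SetLike.mem_coe, ← hT i (T i) subset_rfl]
  refine Submodule.sum_mem _ fun t ht => Submodule.subset_span ⟨e ⟨i, ⟨t, ht⟩⟩, ?_⟩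
  change projZ ℬ (e.symm (e _)).2 (g (e.symm (e _)).1) = _
  rw [e.symm_apply_apply]

variable {𝒜 ℬ}

omit [IsScalarTower k A B] in
theorem projZ_smul [GradedAlgebra 𝒜] [GradedAlgebra ℬ]
    (h : ∀ n, ∀ a ∈ 𝒜 n, algebraMap A B a ∈ ℬ n) {i : ℤ} {x : B} (hx : x ∈ intPiece ℬ i) (t : ℤ)
    (a : A) : projZ ℬ t (a • x) = projZ 𝒜 (t - i) a • x := by
  rw [Algebra.smul_def, mul_comm, projZ_mul ℬ hx, projZ_algebraMap 𝒜 ℬ h, mul_comm,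
    ← Algebra.smul_def]

omit [IsScalarTower k A B] in
theorem smul_mem_intPiece [GradedAlgebra 𝒜] [GradedAlgebra ℬ]
    (h : ∀ n, ∀ a ∈ 𝒜 n, algebraMap A B a ∈ ℬ n) {i j : ℤ} {a : A} {x : B}
    (ha : a ∈ intPiece 𝒜 i) (hx : x ∈ intPiece ℬ j) : a • x ∈ intPiece ℬ (i + j) := by
  rw [Algebra.smul_def]
  exact mul_mem_intPiece ℬ (algebraMap_mem_intPiece 𝒜 ℬ h ha) hx

omit [IsScalarTower k A B] in
theorem projZ_mem_span [GradedAlgebra 𝒜] [GradedAlgebra ℬ]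
    (h : ∀ n, ∀ a ∈ 𝒜 n, algebraMap A B a ∈ ℬ n) {ι : Type*} {w : ι → B} {a : ι → ℤ}
    (hw : ∀ i, w i ∈ intPiece ℬ (a i)) (t : ℤ) {x : B} (hx : x ∈ Submodule.span A (Set.range w)) :
    projZ ℬ t x ∈ Submodule.span A (Set.range w) := by
  rw [← Finsupp.range_linearCombination] at hx
  obtain ⟨c, rfl⟩ := hx
  rw [Finsupp.linearCombination_apply, Finsupp.sum, map_sum]
  refine Submodule.sum_mem _ fun i _ => ?_
  rw [projZ_smul h (hw i)]
  exact Submodule.smul_mem _ _ (Submodule.subset_span ⟨i, rfl⟩)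

omit [IsScalarTower k A B] in
theorem HomogeneousFrame.nonempty [GradedAlgebra 𝒜] [GradedAlgebra ℬ] [IsDomain A]
    [Module.Finite A B] (h : ∀ n, ∀ a ∈ 𝒜 n, algebraMap A B a ∈ ℬ n) :
    Nonempty (HomogeneousFrame 𝒜 ℬ) := by
  classical
  obtain ⟨m, v, b, hv, hspan⟩ := exists_homogeneous_generators (A := A) ℬ
  obtain ⟨I, hI, s, hs, hsv⟩ := exists_smul_mem_of_finite (A := A) v
  have : ∃ σ, projZ 𝒜 σ s ≠ 0 := by
    by_contra! hcon
    exact hs (eq_zero_of_projZ 𝒜 hcon)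
  obtain ⟨σ, hσ⟩ := this
  let e := Fintype.equivFin I
  have hrange : Set.range (fun i => v (e.symm i)) = v '' I := by
    ext x
    constructor
    · rintro ⟨i, rfl⟩; exact ⟨_, (e.symm i).2, rfl⟩
    · rintro ⟨i, hi, rfl⟩; exact ⟨e ⟨i, hi⟩, by simp⟩
  refine ⟨⟨Fintype.card I, fun i => v (e.symm i), fun i => b (e.symm i), fun i => hv _,
    ?_, m, v, b, hv, hspan, projZ 𝒜 σ s, σ, projZ_mem _ _ _, hσ, fun j => ?_⟩⟩
  · exact LinearIndependent.comp hI.linearIndependent e.symm e.symm.injective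
  · have := projZ_smul h (hv j) (σ + b j) s
    rw [add_sub_cancel_right] at this
    rw [← this]
    refine projZ_mem_span h (fun i => hv (e.symm i)) _ ?_
    rw [hrange]
    exact hsv j

/-- Over a graded domain, multiplication by a nonzero homogeneous element gives a frame of the ring
over itself. -/
def HomogeneousFrame.ofElement [GradedAlgebra 𝒜] [IsDomain A] {s : A} {σ : ℤ}
    (hs : s ∈ intPiece 𝒜 σ) (hs0 : s ≠ 0) : HomogeneousFrame 𝒜 𝒜 where
  r := 1
  w _ := s
  a _ := σ
  w_mem _ := hs
  linearIndependent := LinearIndependent.of_subsingleton (0 : Fin 1) hs0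
  m := 1
  v _ := 1
  b _ := 0
  v_mem _ := by
    rw [intPiece_of_nonneg _ le_rfl]; exact SetLike.one_mem_graded 𝒜
  span_v := by simp [Set.range_const]
  s := s
  σ := σ
  s_mem := hs
  s_ne_zero := hs0
  smul_mem _ := by
    rw [smul_eq_mul, mul_one]
    exact Submodule.subset_span ⟨0, rfl⟩

omit [IsScalarTower k A B] in
theorem HomogeneousFrame.r_pos (F : HomogeneousFrame 𝒜 ℬ)
    (hinj : Function.Injective (algebraMap A B)) : 0 < F.r := by
  by_contra! hr
  have hempty : IsEmpty (Fin F.r) := by rw [Nat.le_zero.1 hr]; infer_instance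
  have h1 : ∀ x : B, F.s • x = 0 := by
    intro x
    have hx : x ∈ Submodule.span A (Set.range F.v) := by rw [F.span_v]; trivial
    induction hx using Submodule.span_induction with
    | mem x hx =>
      obtain ⟨j, rfl⟩ := hx
      have := F.smul_mem j
      rwa [Set.range_eq_empty, Submodule.span_empty, Submodule.mem_bot] at this
    | zero => simp
    | add x y _ _ hx hy => rw [smul_add, hx, hy, add_zero]
    | smul c x _ hx => rw [smul_comm, hx, smul_zero]
  have := h1 1
  rw [Algebra.smul_def, mul_one, ← map_zero (algebraMap A B)] at this
  exact F.s_ne_zero (hinj this)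

end Frame

section Comparison

variable {k A B : Type*} [Field k] [CommRing A] [CommRing B] [Algebra k A] [Algebra k B]
  [Algebra A B] [IsScalarTower k A B] {𝒜 : ℕ → Submodule k A} {ℬ : ℕ → Submodule k B}

/-- The Hilbert function of an ideal, at an integer. -/
def idealHilbertFn (𝒜 : ℕ → Submodule k A) (𝔞 : Ideal A) (t : ℤ) : ℕ :=
  Module.finrank k ↥(𝔞.restrictScalars k ⊓ intPiece 𝒜 t)

theorem idealHilbertFn_top (𝒜 : ℕ → Submodule k A) (t : ℤ) :
    idealHilbertFn 𝒜 ⊤ t = hilbertFn 𝒜 t := by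
  rw [idealHilbertFn, Submodule.restrictScalars_top, top_inf_eq, hilbertFn]

variable [GradedAlgebra 𝒜] [GradedAlgebra ℬ]

/-- A graded ring that is finite over a graded ring with finite-dimensional pieces has
finite-dimensional pieces. -/
theorem finite_piece_of_finite [Module.Finite A B] [∀ n, Module.Finite k (𝒜 n)]
    (h : ∀ n, ∀ a ∈ 𝒜 n, algebraMap A B a ∈ ℬ n) (n : ℕ) : Module.Finite k (ℬ n) := by
  obtain ⟨m, v, b, hv, hspan⟩ := exists_homogeneous_generators (A := A) ℬ
  let φ : Fin m → A →ₗ[k] B := fun j => (LinearMap.toSpanSingleton A B (v j)).restrictScalars k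
  have hle : ℬ n ≤ Finset.univ.sup fun j => (intPiece 𝒜 (n - b j)).map (φ j) := by
    intro x hx
    rw [← intPiece_natCast ℬ] at hx
    have hx' : x ∈ Submodule.span A (Set.range v) := by rw [hspan]; trivial
    rw [Submodule.mem_span_range_iff_exists_fun] at hx'
    obtain ⟨c, rfl⟩ := hx'
    rw [← projZ_of_mem ℬ hx, map_sum]
    refine Submodule.sum_mem _ fun j _ => ?_
    rw [projZ_smul h (hv j)]
    exact (Finset.le_sup (f := fun j => (intPiece 𝒜 (n - b j)).map (φ j)) (Finset.mem_univ j))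
      ⟨_, projZ_mem 𝒜 _ _, rfl⟩
  exact Submodule.finiteDimensional_of_le hle

variable (F : HomogeneousFrame 𝒜 ℬ)

namespace HomogeneousFrame

omit [GradedAlgebra 𝒜] [GradedAlgebra ℬ] in
/-- The graded free submodule `⊕ 𝔞 w_i` of `B` has the Hilbert function `∑ H_𝔞(t - a_i)`. -/
theorem finrank_map_basis [∀ n, Module.Finite k (𝒜 n)] (𝔞 : Ideal A) (t : ℤ) :
    Module.finrank k ↥(LinearMap.range
      ((Fintype.linearCombination A F.w).restrictScalars k ∘ₗ
        (Submodule.pi Set.univ fun i => 𝔞.restrictScalars k ⊓ intPiece 𝒜 (t - F.a i)).subtype)) =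
      ∑ i, idealHilbertFn 𝒜 𝔞 (t - F.a i) := by
  rw [LinearMap.finrank_range_of_inj]
  · let e : ↥(Submodule.pi Set.univ fun i => 𝔞.restrictScalars k ⊓ intPiece 𝒜 (t - F.a i)) ≃ₗ[k]
        ∀ i, ↥(𝔞.restrictScalars k ⊓ intPiece 𝒜 (t - F.a i)) :=
      { toFun := fun v i => ⟨v.1 i, v.2 i trivial⟩
        invFun := fun w => ⟨fun i => w i, fun i _ => (w i).2⟩
        left_inv := fun v => rfl
        right_inv := fun w => rfl
        map_add' := fun v w => rfl
        map_smul' := fun r v => rfl }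
    have : ∀ i, Module.Finite k ↥(𝔞.restrictScalars k ⊓ intPiece 𝒜 (t - F.a i)) := fun i =>
      Submodule.finiteDimensional_of_le inf_le_right
    rw [e.finrank_eq, Module.finrank_pi_fintype]
    rfl
  · intro x y hxy
    refine Subtype.ext ?_
    exact F.linearIndependent.fintypeLinearCombination_injective hxy

theorem range_basis_le (h : ∀ n, ∀ a ∈ 𝒜 n, algebraMap A B a ∈ ℬ n) (𝔞 : Ideal A) (t : ℤ) :
    LinearMap.range ((Fintype.linearCombination A F.w).restrictScalars k ∘ₗ
        (Submodule.pi Set.univ fun i => 𝔞.restrictScalars k ⊓ intPiece 𝒜 (t - F.a i)).subtype) ≤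
      (𝔞.map (algebraMap A B)).restrictScalars k ⊓ intPiece ℬ t := by
  rintro _ ⟨⟨x, hx⟩, rfl⟩
  have key : ∀ i, x i • F.w i ∈ (𝔞.map (algebraMap A B)).restrictScalars k ⊓ intPiece ℬ t := by
    intro i
    obtain ⟨h1, h2⟩ := hx i trivial
    refine ⟨?_, ?_⟩
    · rw [Algebra.smul_def]
      exact Ideal.mul_mem_right _ _ (Ideal.mem_map_of_mem _ h1)
    · have := smul_mem_intPiece h h2 (F.w_mem i)
      rwa [sub_add_cancel] at this
  change Fintype.linearCombination A F.w x ∈ _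
  rw [Fintype.linearCombination_apply]
  exact Submodule.sum_mem _ fun i _ => key i

theorem sum_le_idealHilbertFn [∀ n, Module.Finite k (𝒜 n)] [∀ n, Module.Finite k (ℬ n)]
    (h : ∀ n, ∀ a ∈ 𝒜 n, algebraMap A B a ∈ ℬ n) (𝔞 : Ideal A) (t : ℤ) :
    ∑ i, idealHilbertFn 𝒜 𝔞 (t - F.a i) ≤ idealHilbertFn ℬ (𝔞.map (algebraMap A B)) t := by
  rw [← F.finrank_map_basis]
  have : Module.Finite k ↥((𝔞.map (algebraMap A B)).restrictScalars k ⊓ intPiece ℬ t) :=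
    Submodule.finiteDimensional_of_le inf_le_right
  exact Submodule.finrank_mono (F.range_basis_le h 𝔞 t)

/-- The upper bound for the Hilbert function of an extended ideal `𝔞B`: its quotient by the free
submodule `⊕ 𝔞 w_i` is generated by the products `f_l v_j` and is killed by `s`. -/
theorem idealHilbertFn_le [IsDomain A] [∀ n, Module.Finite k (𝒜 n)]
    (h : ∀ n, ∀ a ∈ 𝒜 n, algebraMap A B a ∈ ℬ n) {n : ℕ} (f : Fin n → A) (e : Fin n → ℤ)
    (hf : ∀ l, f l ∈ intPiece 𝒜 (e l)) (t : ℤ) :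
    idealHilbertFn ℬ ((Ideal.span (Set.range f)).map (algebraMap A B)) t +
        ∑ l, ∑ j, hilbertFn 𝒜 (t - e l - F.b j - F.σ) ≤
      ∑ i, idealHilbertFn 𝒜 (Ideal.span (Set.range f)) (t - F.a i) +
        ∑ l, ∑ j, hilbertFn 𝒜 (t - e l - F.b j) := by
  classical
  set 𝔞 := Ideal.span (Set.range f) with h𝔞
  set U := LinearMap.range ((Fintype.linearCombination A F.w).restrictScalars k ∘ₗ
        (Submodule.pi Set.univ fun i => 𝔞.restrictScalars k ⊓ intPiece 𝒜 (t - F.a i)).subtype)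
    with hU
  have hpifin : Module.Finite k ↥(Submodule.pi Set.univ
      fun i => 𝔞.restrictScalars k ⊓ intPiece 𝒜 (t - F.a i)) := by
    have : Submodule.pi Set.univ (fun i => 𝔞.restrictScalars k ⊓ intPiece 𝒜 (t - F.a i)) ≤
        vecPiece 𝒜 F.a t := Submodule.pi_mono fun _ _ => inf_le_right
    exact Submodule.finiteDimensional_of_le this
  have hUfin : Module.Finite k U := by rw [hU]; infer_instance
  let φ : Fin n × Fin F.m → A →ₗ[k] B := fun lj =>
    (LinearMap.toSpanSingleton A B (f lj.1 • F.v lj.2)).restrictScalars k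
  have hφ : ∀ lj x, φ lj x = x • f lj.1 • F.v lj.2 := fun _ _ => rfl
  have hfv : ∀ lj : Fin n × Fin F.m, f lj.1 • F.v lj.2 ∈ intPiece ℬ (e lj.1 + F.b lj.2) :=
    fun lj => smul_mem_intPiece h (hf _) (F.v_mem _)
  let X : Fin n × Fin F.m → Submodule k A := fun lj => intPiece 𝒜 (t - e lj.1 - F.b lj.2)
  let μ : A →ₗ[k] A := LinearMap.mulLeft k F.s
  let Y : Fin n × Fin F.m → Submodule k A := fun lj =>
    (intPiece 𝒜 (t - e lj.1 - F.b lj.2 - F.σ)).map μ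
  have hμ : Function.Injective μ := mul_right_injective₀ F.s_ne_zero
  have hYX : ∀ lj, Y lj ≤ X lj := by
    rintro lj _ ⟨x, hx, rfl⟩
    have := mul_mem_intPiece 𝒜 F.s_mem hx
    rwa [add_sub_cancel] at this
  have hYU : ∀ lj, (Y lj).map (φ lj) ≤ U := by
    rintro lj _ ⟨_, ⟨x, hx, rfl⟩, rfl⟩
    rw [hφ]
    have h1 := F.smul_mem lj.2
    rw [Submodule.mem_span_range_iff_exists_fun] at h1
    obtain ⟨c, hc⟩ := h1
    -- `s v_j = ∑ c_i w_i`, where the `c_i` can be taken homogeneous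
    have h2 : F.s • F.v lj.2 = ∑ i, projZ 𝒜 (F.σ + F.b lj.2 - F.a i) (c i) • F.w i := by
      rw [← projZ_of_mem ℬ (smul_mem_intPiece h F.s_mem (F.v_mem lj.2)), ← hc, map_sum]
      exact Finset.sum_congr rfl fun i _ => projZ_smul h (F.w_mem i) _ _
    have h3 : (μ x) • f lj.1 • F.v lj.2 =
        ∑ i, (x * f lj.1 * projZ 𝒜 (F.σ + F.b lj.2 - F.a i) (c i)) • F.w i := by
      simp only [mul_smul _ _ (F.w _)]
      rw [← Finset.smul_sum, ← h2, ← mul_smul, ← mul_smul]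
      congr 1
      change F.s * x * f lj.1 = _
      ring
    rw [h3]
    refine ⟨⟨fun i => x * f lj.1 * projZ 𝒜 (F.σ + F.b lj.2 - F.a i) (c i), fun i _ => ⟨?_, ?_⟩⟩,
      rfl⟩
    · exact Ideal.mul_mem_right _ _ (Ideal.mul_mem_left _ _ (Ideal.subset_span ⟨_, rfl⟩))
    · have := mul_mem_intPiece 𝒜 (mul_mem_intPiece 𝒜 hx (hf lj.1))
        (projZ_mem 𝒜 (F.σ + F.b lj.2 - F.a i) (c i))
      rwa [show t - e lj.1 - F.b lj.2 - F.σ + e lj.1 + (F.σ + F.b lj.2 - F.a i) = t - F.a i by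
        ring] at this
  have hV : (𝔞.map (algebraMap A B)).restrictScalars k ⊓ intPiece ℬ t ≤
      U ⊔ Finset.univ.sup fun lj => (X lj).map (φ lj) := by
    refine le_trans ?_ le_sup_right
    rintro y ⟨hy1, hy2⟩
    have hgen : ∀ y ∈ 𝔞.map (algebraMap A B),
        y ∈ Submodule.span A (Set.range fun lj : Fin n × Fin F.m => f lj.1 • F.v lj.2) := by
      intro y hy
      rw [h𝔞, Ideal.map_span] at hy
      induction hy using Submodule.span_induction with
      | mem x hx =>
        obtain ⟨_, ⟨l, rfl⟩, rfl⟩ := hx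
        have : (1 : B) ∈ Submodule.span A (Set.range F.v) := by rw [F.span_v]; trivial
        rw [Submodule.mem_span_range_iff_exists_fun] at this
        obtain ⟨c, hc⟩ := this
        rw [← mul_one (algebraMap A B (f l)), ← Algebra.smul_def, ← hc, Finset.smul_sum]
        refine Submodule.sum_mem _ fun j _ => ?_
        rw [smul_comm]
        exact Submodule.smul_mem _ _ (Submodule.subset_span ⟨(l, j), rfl⟩)
      | zero => exact zero_mem _
      | add x y _ _ hx hy => exact add_mem hx hy
      | smul b x _ hx =>
        rw [Submodule.mem_span_range_iff_exists_fun] at hx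
        obtain ⟨c, rfl⟩ := hx
        rw [smul_eq_mul, Finset.mul_sum]
        refine Submodule.sum_mem _ fun lj _ => ?_
        have : b * F.v lj.2 ∈ Submodule.span A (Set.range F.v) := by rw [F.span_v]; trivial
        rw [Submodule.mem_span_range_iff_exists_fun] at this
        obtain ⟨c', hc'⟩ := this
        rw [mul_smul_comm, mul_smul_comm, ← hc', Finset.smul_sum, Finset.smul_sum]
        refine Submodule.sum_mem _ fun j _ => ?_
        rw [smul_comm (f lj.1)]
        exact Submodule.smul_mem _ _ (Submodule.smul_mem _ _ (Submodule.subset_span ⟨(lj.1, j), rfl⟩))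
    have := hgen y hy1
    rw [Submodule.mem_span_range_iff_exists_fun] at this
    obtain ⟨c, rfl⟩ := this
    rw [← projZ_of_mem ℬ hy2, map_sum]
    refine Submodule.sum_mem _ fun lj _ => ?_
    rw [projZ_smul h (hfv lj)]
    refine (Finset.le_sup (f := fun lj => (X lj).map (φ lj)) (Finset.mem_univ lj)) ⟨_, ?_, rfl⟩
    rw [← sub_sub]
    exact projZ_mem 𝒜 _ _
  have := finrank_add_sum_le Finset.univ U X Y hYX φ hYU _ hV
  rw [F.finrank_map_basis] at this
  have hY : ∀ lj, Module.finrank k (Y lj) = hilbertFn 𝒜 (t - e lj.1 - F.b lj.2 - F.σ) := fun lj =>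
    (Submodule.equivMapOfInjective μ hμ _).finrank_eq.symm
  simp only [hY, Fintype.sum_prod_type] at this
  exact this

theorem hilbertFn_le [IsDomain A] [∀ n, Module.Finite k (𝒜 n)]
    (h : ∀ n, ∀ a ∈ 𝒜 n, algebraMap A B a ∈ ℬ n) (t : ℤ) :
    hilbertFn ℬ t + ∑ j, hilbertFn 𝒜 (t - F.b j - F.σ) ≤
      ∑ i, hilbertFn 𝒜 (t - F.a i) + ∑ j, hilbertFn 𝒜 (t - F.b j) := by
  have := F.idealHilbertFn_le h (fun _ : Fin 1 => (1 : A)) (fun _ => 0) (fun _ => by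
    rw [intPiece_of_nonneg _ le_rfl]; exact SetLike.one_mem_graded 𝒜) t
  have h1 : Ideal.span (Set.range fun _ : Fin 1 => (1 : A)) = ⊤ := by
    rw [Set.range_const, Ideal.span_singleton_one]
  rw [h1, Ideal.map_top] at this
  simpa [idealHilbertFn_top] using this

theorem sum_le_hilbertFn [∀ n, Module.Finite k (𝒜 n)] [∀ n, Module.Finite k (ℬ n)]
    (h : ∀ n, ∀ a ∈ 𝒜 n, algebraMap A B a ∈ ℬ n) (t : ℤ) :
    ∑ i, hilbertFn 𝒜 (t - F.a i) ≤ hilbertFn ℬ t := by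
  have := F.sum_le_idealHilbertFn h ⊤ t
  rw [Ideal.map_top] at this
  simpa [idealHilbertFn_top] using this

end HomogeneousFrame

end Comparison

/-! ### Growth of Hilbert functions -/

section Asymptotics

open Asymptotics

variable {X : Type*} {N u v : X → ℝ}

/-- If `u - v` is bounded, the truncated powers `u₊ ^ e` and `v₊ ^ e` differ by a term of the order
of the power `e - 1`. -/
theorem isBigO_max_pow_sub (e : ℕ) (hu : u =O[⊤] N) (hv : v =O[⊤] N)
    (huv : (fun x => u x - v x) =O[⊤] fun _ => (1 : ℝ)) :
    (fun x => max (u x) 0 ^ e - max (v x) 0 ^ e) =O[⊤] fun x => N x ^ (e - 1) := by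
  have h1 : (fun x => max (u x) 0 ^ e - max (v x) 0 ^ e) =O[⊤]
      fun x => |u x - v x| * e * (|u x| + |v x|) ^ (e - 1) := by
    refine IsBigO.of_norm_le fun x => ?_
    rw [Real.norm_eq_abs]
    refine (abs_pow_sub_pow_le (max (u x) 0) (max (v x) 0) e).trans ?_
    have hle : ∀ z : ℝ, |max z 0| ≤ |z| := fun z => by
      rw [abs_of_nonneg (le_max_right _ _)]
      exact max_le (le_abs_self z) (abs_nonneg z)
    refine mul_le_mul (mul_le_mul_of_nonneg_right (abs_max_sub_max_le_abs _ _ _) (by positivity))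
      (pow_le_pow_left₀ (by positivity) ?_ _) (by positivity) (by positivity)
    exact max_le ((hle _).trans (le_add_of_nonneg_right (abs_nonneg _)))
      ((hle _).trans (le_add_of_nonneg_left (abs_nonneg _)))
  refine h1.trans ?_
  have h2 : (fun x => |u x - v x| * e) =O[⊤] fun _ => (1 : ℝ) := by
    simpa [mul_comm] using (huv.abs_left.const_mul_left (e : ℝ))
  have h3 : (fun x => (|u x| + |v x|) ^ (e - 1)) =O[⊤] fun x => N x ^ (e - 1) :=
    (hu.abs_left.add hv.abs_left).pow _
  simpa using h2.mul h3

theorem isBigO_self_abs_add_one : (fun j : ℤ => (j : ℝ)) =O[⊤] fun j : ℤ => |(j : ℝ)| + 1 :=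
  isBigO_of_le _ fun j => by
    rw [Real.norm_eq_abs, Real.norm_eq_abs, abs_of_nonneg (by positivity : (0 : ℝ) ≤ |(j : ℝ)| + 1)]
    linarith

theorem isBigO_one_abs_add_one : (fun _ : ℤ => (1 : ℝ)) =O[⊤] fun j : ℤ => |(j : ℝ)| + 1 :=
  isBigO_of_le _ fun j => by
    rw [Real.norm_eq_abs, Real.norm_eq_abs, abs_of_nonneg (by positivity : (0 : ℝ) ≤ |(j : ℝ)| + 1),
      abs_one]
    linarith [abs_nonneg (j : ℝ)]

theorem isBigO_comp_int {f : ℤ → ℝ} {e : ℕ} (hf : f =O[⊤] fun j : ℤ => (|(j : ℝ)| + 1) ^ e)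
    {τ : X → ℤ} (hτ : (fun x => (τ x : ℝ)) =O[⊤] N) (h1 : (fun _ => (1 : ℝ)) =O[⊤] N) :
    (fun x => f (τ x)) =O[⊤] fun x => N x ^ e :=
  (hf.comp_tendsto (tendsto_top (f := τ))).trans ((hτ.abs_left.add h1).pow e)

theorem isBigO_shift (c : ℤ) : (fun j : ℤ => ((j - c : ℤ) : ℝ)) =O[⊤] fun j : ℤ => |(j : ℝ)| + 1 := by
  simp only [Int.cast_sub]
  refine isBigO_self_abs_add_one.sub ?_
  simpa using isBigO_one_abs_add_one.const_mul_left (c : ℝ)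

theorem isBigO_comp_shift {f : ℤ → ℝ} {e : ℕ} (hf : f =O[⊤] fun j : ℤ => (|(j : ℝ)| + 1) ^ e)
    (c : ℤ) : (fun j => f (j - c)) =O[⊤] fun j : ℤ => (|(j : ℝ)| + 1) ^ e :=
  isBigO_comp_int hf (isBigO_shift c) isBigO_one_abs_add_one

theorem isBigO_max_pow_shift (e : ℕ) (c : ℤ) :
    (fun j : ℤ => max ((j - c : ℤ) : ℝ) 0 ^ e - max (j : ℝ) 0 ^ e) =O[⊤]
      fun j : ℤ => (|(j : ℝ)| + 1) ^ (e - 1) := by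
  refine isBigO_max_pow_sub e (isBigO_shift c) isBigO_self_abs_add_one ?_
  refine (isBigO_const_const (-(c : ℝ)) one_ne_zero _).congr_left fun j => ?_
  push_cast; ring

/-- A function on the integers that is `κ j₊ ^ e` up to terms of lower order has the expected limits
along arithmetic progressions. -/
theorem tendsto_div_pow_of_isBigO {f : ℤ → ℝ} {e : ℕ} (he : 0 < e) {κ : ℝ} (D : ℕ) (t : ℤ)
    (hf : (fun j => f (t + D * j) - κ * max ((t + D * j : ℤ) : ℝ) 0 ^ e) =O[⊤]
      fun j : ℤ => (|(j : ℝ)| + 1) ^ (e - 1)) :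
    Tendsto (fun n : ℕ => f (t + D * n) / (n : ℝ) ^ e) atTop (𝓝 (κ * (D : ℝ) ^ e)) := by
  have h1 : (fun j : ℤ => max ((t + D * j : ℤ) : ℝ) 0 ^ e - max ((D * j : ℤ) : ℝ) 0 ^ e) =O[⊤]
      fun j : ℤ => (|(j : ℝ)| + 1) ^ (e - 1) := by
    have hD : (fun j : ℤ => ((D * j : ℤ) : ℝ)) =O[⊤] fun j : ℤ => |(j : ℝ)| + 1 := by
      simp only [Int.cast_mul]
      exact isBigO_self_abs_add_one.const_mul_left _
    refine isBigO_max_pow_sub e ?_ hD ?_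
    · simp only [Int.cast_add]
      refine IsBigO.add ?_ hD
      simpa using isBigO_one_abs_add_one.const_mul_left (t : ℝ)
    · refine (isBigO_const_const (t : ℝ) one_ne_zero _).congr_left fun j => ?_
      push_cast; ring
  have h2 : (fun j : ℤ => f (t + D * j) - κ * max ((D * j : ℤ) : ℝ) 0 ^ e) =O[⊤]
      fun j : ℤ => (|(j : ℝ)| + 1) ^ (e - 1) := by
    refine (hf.add (h1.const_mul_left κ)).congr_left fun j => ?_
    ring
  obtain ⟨C, hC⟩ := isBigO_top.1 h2
  rw [tendsto_iff_norm_sub_tendsto_zero]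
  have hb : ∀ᶠ n : ℕ in atTop, ‖f (t + D * n) / (n : ℝ) ^ e - κ * (D : ℝ) ^ e‖ ≤
      C * 2 ^ (e - 1) / n := by
    filter_upwards [eventually_ge_atTop 1] with n hn
    have hn' : (1 : ℝ) ≤ n := by exact_mod_cast hn
    have hne : (n : ℝ) ≠ 0 := by positivity
    have h3 := hC n
    rw [show (((D : ℤ) * (n : ℤ) : ℤ) : ℝ) = D * n by push_cast; ring,
      max_eq_left (by positivity), Int.cast_natCast, abs_of_nonneg (by positivity),
      Real.norm_of_nonneg (by positivity : (0 : ℝ) ≤ ((n : ℝ) + 1) ^ (e - 1))] at h3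
    have hC0 : 0 ≤ C := by
      by_contra! hneg
      have : C * ((n : ℝ) + 1) ^ (e - 1) < 0 := mul_neg_of_neg_of_pos hneg (by positivity)
      linarith [norm_nonneg (f (t + D * n) - κ * ((D : ℝ) * n) ^ e)]
    have h4 : f (t + D * n) / (n : ℝ) ^ e - κ * (D : ℝ) ^ e =
        (f (t + D * n) - κ * ((D : ℝ) * n) ^ e) / (n : ℝ) ^ e := by
      rw [mul_pow]
      field_simp
    rw [h4, norm_div, Real.norm_of_nonneg (by positivity : (0 : ℝ) ≤ (n : ℝ) ^ e),
      div_le_div_iff₀ (by positivity) (by positivity)]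
    have h5 : ((n : ℝ) + 1) ^ (e - 1) ≤ 2 ^ (e - 1) * (n : ℝ) ^ (e - 1) := by
      rw [← mul_pow]
      gcongr
      linarith
    have h6 : (n : ℝ) ^ e = n ^ (e - 1) * n := by
      rw [← pow_succ, Nat.sub_add_cancel he]
    calc _ ≤ (C * ((n : ℝ) + 1) ^ (e - 1)) * n := by gcongr
      _ ≤ C * (2 ^ (e - 1) * (n : ℝ) ^ (e - 1)) * n := by gcongr
      _ = _ := by rw [h6]; ring
  refine squeeze_zero' (Eventually.of_forall fun _ => norm_nonneg _) hb ?_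
  exact tendsto_const_nhds.div_atTop tendsto_natCast_atTop_atTop

end Asymptotics

section Growth

open Asymptotics

/-- The function `H` on the integers equals `γ j₊ ^ e` at the multiples `j` of `m` and vanishes at
the other integers, up to an error of order `|j| ^ (e - 1)`. -/
def HasGrowth (H : ℤ → ℕ) (m e : ℕ) (γ : ℝ) : Prop :=
  (fun j : ℤ => (H j : ℝ) - if (m : ℤ) ∣ j then γ * max (j : ℝ) 0 ^ e else 0) =O[⊤]
    fun j : ℤ => (|(j : ℝ)| + 1) ^ (e - 1)

variable {H : ℤ → ℕ} {m e : ℕ} {γ : ℝ}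

theorem HasGrowth.sub_shift (h : HasGrowth H m e γ) {σ : ℤ} (hσ : (m : ℤ) ∣ σ) :
    (fun j : ℤ => (H j : ℝ) - H (j - σ)) =O[⊤] fun j : ℤ => (|(j : ℝ)| + 1) ^ (e - 1) := by
  have h1 := isBigO_comp_shift h σ
  have h2 : (fun j : ℤ => (if (m : ℤ) ∣ j then γ * max (j : ℝ) 0 ^ e else 0) -
      if (m : ℤ) ∣ j - σ then γ * max ((j - σ : ℤ) : ℝ) 0 ^ e else 0) =O[⊤]
      fun j : ℤ => (|(j : ℝ)| + 1) ^ (e - 1) := by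
    refine IsBigO.trans (isBigO_of_le _ fun j => ?_)
      ((isBigO_max_pow_shift e σ).const_mul_left (-γ))
    simp only [dvd_sub_left hσ]
    split_ifs
    · refine le_of_eq (congrArg _ ?_); ring
    · rw [sub_self, norm_zero]; exact norm_nonneg _
  refine ((h.sub h1).add h2).congr_left fun j => ?_
  ring

variable {k A B : Type*} [Field k] [CommRing A] [CommRing B] [Algebra k A] [Algebra k B]
  [Algebra A B] [IsScalarTower k A B] {𝒜 : ℕ → Submodule k A} {ℬ : ℕ → Submodule k B}
  [GradedAlgebra 𝒜] [GradedAlgebra ℬ]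

/-- Up to terms of lower order, the Hilbert function of a finite extension is a sum of shifts of the
Hilbert function of the base. -/
theorem HomogeneousFrame.isBigO_hilbertFn [IsDomain A] [∀ n, Module.Finite k (𝒜 n)]
    [∀ n, Module.Finite k (ℬ n)] (F : HomogeneousFrame 𝒜 ℬ)
    (h : ∀ n, ∀ a ∈ 𝒜 n, algebraMap A B a ∈ ℬ n) (hA : HasGrowth (hilbertFn 𝒜) m e γ)
    (hσ : (m : ℤ) ∣ F.σ) :
    (fun t : ℤ => (hilbertFn ℬ t : ℝ) - ∑ i, (hilbertFn 𝒜 (t - F.a i) : ℝ)) =O[⊤]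
      fun t : ℤ => (|(t : ℝ)| + 1) ^ (e - 1) := by
  have h1 : (fun t : ℤ => ∑ j, ((hilbertFn 𝒜 (t - F.b j) : ℝ) -
      hilbertFn 𝒜 (t - F.b j - F.σ))) =O[⊤] fun t : ℤ => (|(t : ℝ)| + 1) ^ (e - 1) :=
    IsBigO.fun_sum fun j _ => isBigO_comp_shift (hA.sub_shift hσ) (F.b j)
  refine IsBigO.trans (isBigO_of_le _ fun t => ?_) h1
  have hu := F.hilbertFn_le h t
  have hl := F.sum_le_hilbertFn h t
  have hu' : (hilbertFn ℬ t : ℝ) + ∑ j, (hilbertFn 𝒜 (t - F.b j - F.σ) : ℝ) ≤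
      ∑ i, (hilbertFn 𝒜 (t - F.a i) : ℝ) + ∑ j, (hilbertFn 𝒜 (t - F.b j) : ℝ) := by
    exact_mod_cast hu
  have hl' : ∑ i, (hilbertFn 𝒜 (t - F.a i) : ℝ) ≤ hilbertFn ℬ t := by exact_mod_cast hl
  rw [Finset.sum_sub_distrib, Real.norm_of_nonneg (by linarith), Real.norm_of_nonneg (by linarith)]
  linarith

end Growth

section PolynomialRing

open Asymptotics MvPolynomial

variable (k : Type*) [Field k]

theorem natCard_weight_eq (e : ℕ) {D : ℕ} (hD : 0 < D) (m : ℕ) :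
    Nat.card {s : Fin (e + 1) →₀ ℕ | Finsupp.weight (fun _ => D) s = D * m} =
      (m + e).choose e := by
  classical
  have h : {s : Fin (e + 1) →₀ ℕ | Finsupp.weight (fun _ => D) s = D * m} =
      ((Finset.univ : Finset (Fin (e + 1))).finsuppAntidiag m : Set (Fin (e + 1) →₀ ℕ)) := by
    ext s
    rw [Finset.mem_coe, Finset.mem_finsuppAntidiag, Set.mem_ofPred_eq, Finsupp.weight_apply,
      Finsupp.sum_fintype _ _ (by simp)]
    simp only [smul_eq_mul, ← Finset.sum_mul, Finset.subset_univ, and_true]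
    rw [mul_comm, Nat.mul_right_inj hD.ne']
  rw [h, Nat.card_coe_set_eq, Set.ncard_coe_finset, Finset.card_finsuppAntidiag_nat_eq_choose,
    Finset.card_univ, Fintype.card_fin, show e + 1 + m - 1 = m + e by omega, Nat.choose_symm_add]

theorem finite_weightedHomogeneousSubmodule {e D : ℕ} (hD : 0 < D) (n : ℕ) :
    Module.Finite k (weightedHomogeneousSubmodule k (fun _ : Fin e => D) n) :=
  Module.Finite.iff_fg.2 (weightedHomogeneousSubmodule_fg k _ (fun _ => hD.ne') n)

theorem finrank_weightedHomogeneousSubmodule (e D n : ℕ) :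
    Module.finrank k (weightedHomogeneousSubmodule k (fun _ : Fin (e + 1) => D) n) =
      Nat.card {s : Fin (e + 1) →₀ ℕ | Finsupp.weight (fun _ => D) s = n} := by
  rw [weightedHomogeneousSubmodule_eq_finsupp_supported]
  exact Module.finrank_eq_nat_card_basis (basisRestrictSupport k _)

theorem natCard_weight_of_not_dvd {e D n : ℕ} (h : ¬ D ∣ n) :
    Nat.card {s : Fin (e + 1) →₀ ℕ | Finsupp.weight (fun _ => D) s = n} = 0 := by
  have : {s : Fin (e + 1) →₀ ℕ | Finsupp.weight (fun _ => D) s = n} = ∅ := by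
    refine Set.eq_empty_of_forall_notMem fun s hs => h ?_
    rw [Set.mem_ofPred_eq, Finsupp.weight_apply] at hs
    rw [← hs]
    exact Finset.dvd_sum fun i _ => Dvd.intro_left _ rfl
  rw [this]
  simp

theorem abs_choose_sub_le (e m : ℕ) :
    |((m + e).choose e : ℝ) - (1 / e.factorial) * (m : ℝ) ^ e| ≤
      ((e : ℝ) * e * (e + 1) ^ (e - 1)) * ((m : ℝ) + 1) ^ (e - 1) := by
  have hf : (1 : ℝ) ≤ e.factorial := by exact_mod_cast e.factorial_pos
  have h1 : (e.factorial : ℝ) * (m + e).choose e = ((m + 1).ascFactorial e : ℕ) := by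
    rw [Nat.ascFactorial_eq_factorial_mul_choose]; push_cast; ring
  have h2 : (m : ℝ) ^ e ≤ ((m + 1).ascFactorial e : ℕ) := by
    have : m ^ e ≤ (m + 1).ascFactorial e :=
      (Nat.pow_le_pow_left (Nat.le_succ m) e).trans (Nat.pow_succ_le_ascFactorial (m + 1) e)
    exact_mod_cast this
  have h3 : (((m + 1).ascFactorial e : ℕ) : ℝ) ≤ ((m : ℝ) + e) ^ e := by
    exact_mod_cast Nat.ascFactorial_le_pow_add m e
  have h4 : ((m : ℝ) + e) ^ e - (m : ℝ) ^ e ≤ e * e * ((m : ℝ) + e) ^ (e - 1) := by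
    have := abs_pow_sub_pow_le ((m : ℝ) + e) (m : ℝ) e
    rw [add_sub_cancel_left, abs_of_nonneg (by positivity : (0 : ℝ) ≤ m + e),
      abs_of_nonneg (by positivity : (0 : ℝ) ≤ m), abs_of_nonneg (by positivity : (0 : ℝ) ≤ e),
      max_eq_left (by linarith [(Nat.cast_nonneg e : (0 : ℝ) ≤ e)])] at this
    exact (le_abs_self _).trans this
  have h5 : ((m : ℝ) + e) ^ (e - 1) ≤ (e + 1) ^ (e - 1) * ((m : ℝ) + 1) ^ (e - 1) := by
    rw [← mul_pow]
    gcongr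
    nlinarith [(Nat.cast_nonneg e : (0 : ℝ) ≤ e), (Nat.cast_nonneg m : (0 : ℝ) ≤ m)]
  have h6 : ((m + e).choose e : ℝ) - (1 / e.factorial) * (m : ℝ) ^ e =
      (((m + 1).ascFactorial e : ℕ) - (m : ℝ) ^ e) / e.factorial := by
    rw [← h1]; field_simp
  rw [h6, abs_of_nonneg (by apply div_nonneg <;> linarith), div_le_iff₀ (by linarith)]
  calc (((m + 1).ascFactorial e : ℕ) : ℝ) - (m : ℝ) ^ e
      ≤ e * e * ((e + 1) ^ (e - 1) * ((m : ℝ) + 1) ^ (e - 1)) := by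
        refine (sub_le_sub_right h3 _).trans (h4.trans ?_)
        gcongr
    _ = ((e : ℝ) * e * (e + 1) ^ (e - 1)) * ((m : ℝ) + 1) ^ (e - 1) * 1 := by ring
    _ ≤ _ := by gcongr

/-- The Hilbert function of a polynomial ring in `e + 1` variables of degree `D`. -/
theorem hasGrowth_weightedHomogeneousSubmodule (e : ℕ) {D : ℕ} (hD : 0 < D) :
    HasGrowth (hilbertFn (weightedHomogeneousSubmodule k (fun _ : Fin (e + 1) => D))) D e
      (1 / ((D : ℝ) ^ e * e.factorial)) := by
  refine isBigO_top.2 ⟨(e : ℝ) * e * (e + 1) ^ (e - 1) + 1, fun j => ?_⟩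
  rw [Real.norm_of_nonneg (by positivity : (0 : ℝ) ≤ (|(j : ℝ)| + 1) ^ (e - 1))]
  rcases lt_or_ge j 0 with hj | hj
  · have hj' : max (j : ℝ) 0 = 0 := max_eq_right (by exact_mod_cast hj.le)
    rw [hilbertFn_of_neg _ hj, hj']
    rcases Nat.eq_zero_or_pos e with rfl | he
    · split_ifs <;> simp
    · rw [zero_pow he.ne', mul_zero, ite_self, Nat.cast_zero, sub_zero, norm_zero]
      positivity
  obtain ⟨n, rfl⟩ := Int.eq_ofNat_of_zero_le hj
  rw [hilbertFn_natCast, finrank_weightedHomogeneousSubmodule]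
  by_cases hDn : D ∣ n
  · obtain ⟨m, rfl⟩ := hDn
    rw [natCard_weight_eq e hD, if_pos ⟨m, by push_cast; ring⟩, Int.cast_natCast,
      max_eq_left (by positivity), abs_of_nonneg (by positivity), Real.norm_eq_abs]
    have h := abs_choose_sub_le e m
    have hD' : (1 : ℝ) ≤ D := by exact_mod_cast hD
    have h2 : (1 / ((D : ℝ) ^ e * e.factorial)) * (((D * m : ℕ) : ℝ)) ^ e =
        (1 / e.factorial) * (m : ℝ) ^ e := by
      push_cast
      rw [mul_pow]
      field_simp
    rw [h2]
    refine h.trans ?_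
    have h3 : (m : ℝ) ≤ (D * m : ℕ) := by
      push_cast
      nlinarith [(Nat.cast_nonneg m : (0 : ℝ) ≤ m)]
    gcongr
    linarith
  · rw [natCard_weight_of_not_dvd hDn, if_neg (by exact_mod_cast hDn)]
    simp only [Nat.cast_zero, sub_zero, norm_zero]
    positivity

end PolynomialRing

section ResidueCount

open Asymptotics

variable {r D e : ℕ} {a : Fin r → ℤ} {γ : ℝ} {HA HB : ℤ → ℕ}

/-- The number of the `a i` that are congruent to `t` modulo `D`. -/
def residueCount (D : ℕ) (a : Fin r → ℤ) (t : ℤ) : ℕ :=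
  (Finset.univ.filter fun i => (D : ℤ) ∣ t - a i).card

theorem residueCount_add_mul (D : ℕ) (a : Fin r → ℤ) (t n : ℤ) :
    residueCount D a (t + D * n) = residueCount D a t := by
  rw [residueCount, residueCount]
  congr 1
  ext i
  simp only [Finset.mem_filter, Finset.mem_univ, true_and]
  rw [show t + D * n - a i = t - a i + D * n by ring]
  exact dvd_add_left (dvd_mul_right _ _)

theorem isBigO_sub_residueCount (hA : HasGrowth HA D e γ)
    (hB : (fun t : ℤ => (HB t : ℝ) - ∑ i, (HA (t - a i) : ℝ)) =O[⊤]
      fun t : ℤ => (|(t : ℝ)| + 1) ^ (e - 1)) :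
    (fun t : ℤ => (HB t : ℝ) - residueCount D a t * γ * max (t : ℝ) 0 ^ e) =O[⊤]
      fun t : ℤ => (|(t : ℝ)| + 1) ^ (e - 1) := by
  have h1 : (fun t : ℤ => ∑ i, ((HA (t - a i) : ℝ) -
      if (D : ℤ) ∣ t - a i then γ * max ((t - a i : ℤ) : ℝ) 0 ^ e else 0)) =O[⊤]
      fun t : ℤ => (|(t : ℝ)| + 1) ^ (e - 1) :=
    IsBigO.fun_sum fun i _ => isBigO_comp_shift hA (a i)
  have h2 : (fun t : ℤ => ∑ i, ((if (D : ℤ) ∣ t - a i then γ * max ((t - a i : ℤ) : ℝ) 0 ^ e else 0) -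
      if (D : ℤ) ∣ t - a i then γ * max (t : ℝ) 0 ^ e else 0)) =O[⊤]
      fun t : ℤ => (|(t : ℝ)| + 1) ^ (e - 1) := by
    refine IsBigO.fun_sum fun i _ => IsBigO.trans (isBigO_of_le _ fun t => ?_)
      ((isBigO_max_pow_shift e (a i)).const_mul_left γ)
    split_ifs
    · exact le_of_eq (congrArg _ (by ring))
    · rw [sub_self, norm_zero]; exact norm_nonneg _
  refine ((hB.add h1).add h2).congr_left fun t => ?_
  have h3 : ∑ i, (if (D : ℤ) ∣ t - a i then γ * max (t : ℝ) 0 ^ e else 0) =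
      residueCount D a t * γ * max (t : ℝ) 0 ^ e := by
    rw [← Finset.sum_filter, Finset.sum_const, residueCount, nsmul_eq_mul, mul_assoc]
  rw [Finset.sum_sub_distrib, Finset.sum_sub_distrib, h3]
  ring

theorem tendsto_div_pow_residueCount (he : 0 < e)
    (h : (fun t : ℤ => (HB t : ℝ) - residueCount D a t * γ * max (t : ℝ) 0 ^ e) =O[⊤]
      fun t : ℤ => (|(t : ℝ)| + 1) ^ (e - 1)) (t : ℤ) :
    Tendsto (fun n : ℕ => (HB (t + D * n) : ℝ) / (n : ℝ) ^ e) atTop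
      (𝓝 (residueCount D a t * γ * (D : ℝ) ^ e)) := by
  refine tendsto_div_pow_of_isBigO (f := fun j => (HB j : ℝ)) he D t ?_
  have hτ : (fun j : ℤ => ((t + D * j : ℤ) : ℝ)) =O[⊤] fun j : ℤ => |(j : ℝ)| + 1 := by
    simp only [Int.cast_add, Int.cast_mul]
    refine IsBigO.add ?_ (isBigO_self_abs_add_one.const_mul_left _)
    simpa using isBigO_one_abs_add_one.const_mul_left (t : ℝ)
  refine (isBigO_comp_int h hτ isBigO_one_abs_add_one).congr_left fun j => ?_
  rw [residueCount_add_mul]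

theorem residueCount_le (he : 0 < e) (hD : 0 < D) (hγ : 0 < γ)
    (h : (fun t : ℤ => (HB t : ℝ) - residueCount D a t * γ * max (t : ℝ) 0 ^ e) =O[⊤]
      fun t : ℤ => (|(t : ℝ)| + 1) ^ (e - 1)) {z : ℤ} (hz : ∀ t, HB t ≤ HB (t + z)) (t : ℤ) :
    residueCount D a t ≤ residueCount D a (t + z) := by
  have h1 := tendsto_div_pow_residueCount he h t
  have h2 := tendsto_div_pow_residueCount he h (t + z)
  have h3 := le_of_tendsto_of_tendsto' h1 h2 fun n => by
    have : (HB (t + D * n) : ℝ) ≤ HB (t + z + D * n) := by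
      rw [add_right_comm]; exact_mod_cast hz _
    gcongr
  have hpos : 0 < γ * (D : ℝ) ^ e := by positivity
  rw [mul_assoc, mul_assoc] at h3
  exact_mod_cast le_of_mul_le_mul_right h3 hpos

theorem residueCount_add_eq (he : 0 < e) (hD : 0 < D) (hγ : 0 < γ)
    (h : (fun t : ℤ => (HB t : ℝ) - residueCount D a t * γ * max (t : ℝ) 0 ^ e) =O[⊤]
      fun t : ℤ => (|(t : ℝ)| + 1) ^ (e - 1)) {z : ℤ} (hz : ∀ t, HB t ≤ HB (t + z)) (t : ℤ) :
    residueCount D a (t + z) = residueCount D a t := by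
  have hle := residueCount_le he hD hγ h hz
  have hiter : ∀ n : ℕ, residueCount D a (t + z) ≤ residueCount D a (t + z + n * z) := by
    intro n
    induction n with
    | zero => simp
    | succ n ih =>
      refine ih.trans ((hle _).trans (le_of_eq ?_))
      congr 1; push_cast; ring
  refine le_antisymm ?_ (hle t)
  refine (hiter (D - 1)).trans (le_of_eq ?_)
  rw [← residueCount_add_mul D a t z]
  congr 1
  rw [Nat.cast_sub hD]
  push_cast; ring

end ResidueCount

section DegreeGcd

variable {k S : Type*} [Field k] [CommRing S] [Algebra k S] (𝒮 : ℕ → Submodule k S)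

theorem degreeGcd_dvd {j : ℤ} (h : intPiece 𝒮 j ≠ ⊥) : (degreeGcd 𝒮 : ℤ) ∣ j := by
  rcases lt_or_ge j 0 with hj | hj
  · exact absurd (intPiece_of_neg _ hj) h
  · rw [intPiece_of_nonneg _ hj] at h
    have := Nat.setGcd_dvd_of_mem (s := {n | 𝒮 n ≠ ⊥}) h
    rw [← Int.toNat_of_nonneg hj]
    exact_mod_cast this

theorem degreeGcd_dvd_of_mem {j : ℤ} {s : S} (hs : s ∈ intPiece 𝒮 j) (h : s ≠ 0) :
    (degreeGcd 𝒮 : ℤ) ∣ j :=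
  degreeGcd_dvd 𝒮 fun h0 => h (by rwa [h0, Submodule.mem_bot] at hs)

theorem intPiece_eq_bot_of_not_dvd {j : ℤ} (h : ¬ (degreeGcd 𝒮 : ℤ) ∣ j) : intPiece 𝒮 j = ⊥ := by
  by_contra hne
  exact h (degreeGcd_dvd 𝒮 hne)

/-- A set of integers that is closed under addition and subtraction and contains the degrees of the
nonzero pieces contains the multiples of their greatest common divisor. -/
theorem mem_of_degreeGcd_dvd (P : AddSubgroup ℤ) (hP : ∀ n : ℕ, 𝒮 n ≠ ⊥ → (n : ℤ) ∈ P) {z : ℤ}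
    (hz : (degreeGcd 𝒮 : ℤ) ∣ z) : z ∈ P := by
  obtain ⟨g, rfl⟩ := Int.subgroup_cyclic P
  have hg : g.natAbs ∣ degreeGcd 𝒮 := by
    refine Nat.dvd_setGcd_iff.2 fun n hn => ?_
    have := hP n hn
    rw [AddSubgroup.mem_closure_singleton] at this
    obtain ⟨c, hc⟩ := this
    rw [← Int.natAbs_natCast n, Int.natAbs_dvd_natAbs]
    exact ⟨c, by rw [← hc, smul_eq_mul, mul_comm]⟩
  have : g ∣ z := (Int.dvd_natCast.2 hg).trans hz
  obtain ⟨c, rfl⟩ := this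
  rw [AddSubgroup.mem_closure_singleton]
  exact ⟨c, by rw [smul_eq_mul, mul_comm]⟩

variable [GradedAlgebra 𝒮]

theorem hilbertFn_le_add [IsDomain S] [∀ n, Module.Finite k (𝒮 n)] {z : ℤ}
    (hz : intPiece 𝒮 z ≠ ⊥) (t : ℤ) : hilbertFn 𝒮 t ≤ hilbertFn 𝒮 (t + z) := by
  obtain ⟨s, hs, hs0⟩ := Submodule.exists_mem_ne_zero_of_ne_bot hz
  have : ∑ _i : Fin 1, hilbertFn 𝒮 (t + z - z) ≤ hilbertFn 𝒮 (t + z) :=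
    (HomogeneousFrame.ofElement hs hs0).sum_le_hilbertFn (fun _ _ h => h) (t + z)
  rwa [Fin.sum_univ_one, add_sub_cancel_right] at this

end DegreeGcd

section GrowthOfDomain

open Asymptotics MvPolynomial

variable {k S : Type*} [Field k] [CommRing S] [Algebra k S] (𝒮 : ℕ → Submodule k S)
  [GradedAlgebra 𝒮]

theorem aeval_mem_of_isWeightedHomogeneous {e D : ℕ} {θ : Fin e → S} (hθ : ∀ i, θ i ∈ 𝒮 D) {n : ℕ}
    {f : MvPolynomial (Fin e) k} (hf : f ∈ weightedHomogeneousSubmodule k (fun _ => D) n) :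
    aeval θ f ∈ 𝒮 n := by
  rw [f.as_sum, map_sum]
  refine Submodule.sum_mem _ fun s hs => ?_
  rw [aeval_monomial, ← Algebra.smul_def]
  refine Submodule.smul_mem _ _ ?_
  have h1 := SetLike.prod_pow_mem_graded 𝒮 (F := s.support) (fun _ => D) θ s fun i _ => hθ i
  have h2 : Finsupp.weight (fun _ => D) s = n := hf (mem_support_iff.1 hs)
  rw [Finsupp.weight_apply] at h2
  rw [← h2]
  exact h1

/-- The Hilbert function of a graded domain of dimension `e + 1` grows like a constant multiple of
`j ^ e` along the multiples `j` of the greatest common divisor of the degrees. By Noether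
normalization it is a sum of shifted Hilbert functions of a polynomial ring; the leading coefficient
does not depend on the residue class of `j`, as multiplication by a homogeneous element is
injective. -/
theorem exists_hasGrowth (h𝒮 : 𝒮 0 = 1) [IsDomain S] [Algebra.FiniteType k S] {e : ℕ} (he : 0 < e)
    (hd : ringKrullDim S = (e + 1 : ℕ)) :
    (∀ n, Module.Finite k (𝒮 n)) ∧ 0 < degreeGcd 𝒮 ∧
      ∃ γ : ℝ, 0 < γ ∧ HasGrowth (hilbertFn 𝒮) (degreeGcd 𝒮) e γ := by
  obtain ⟨D, θ, hD, hθ, hfin, hinj⟩ := exists_noether_normalization 𝒮 h𝒮 hd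
  let _ : Algebra (MvPolynomial (Fin (e + 1)) k) S := (aeval (R := k) θ).toRingHom.toAlgebra
  have : IsScalarTower k (MvPolynomial (Fin (e + 1)) k) S :=
    IsScalarTower.of_algebraMap_eq fun x => ((aeval (R := k) θ).commutes x).symm
  have : Module.Finite (MvPolynomial (Fin (e + 1)) k) S := hfin
  let 𝒜 := weightedHomogeneousSubmodule k (fun _ : Fin (e + 1) => D)
  let _ : GradedAlgebra 𝒜 := weightedGradedAlgebra k fun _ : Fin (e + 1) => D
  have h𝒜fin : ∀ n, Module.Finite k (𝒜 n) := fun n => finite_weightedHomogeneousSubmodule k hD n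
  have hdeg : ∀ n, ∀ f ∈ 𝒜 n, algebraMap (MvPolynomial (Fin (e + 1)) k) S f ∈ 𝒮 n := fun n f hf =>
    aeval_mem_of_isWeightedHomogeneous 𝒮 hθ hf
  have h𝒮fin : ∀ n, Module.Finite k (𝒮 n) := finite_piece_of_finite hdeg
  obtain ⟨F⟩ := HomogeneousFrame.nonempty hdeg
  set γ : ℝ := 1 / ((D : ℝ) ^ e * e.factorial) with hγ
  have hγpos : 0 < γ := by positivity
  have hA : HasGrowth (hilbertFn 𝒜) D e γ := hasGrowth_weightedHomogeneousSubmodule k e hD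
  have hσ : (D : ℤ) ∣ F.σ := by
    by_contra hcon
    refine F.s_ne_zero ?_
    have hs := F.s_mem
    rcases lt_or_ge F.σ 0 with h | h
    · rwa [intPiece_of_neg _ h, Submodule.mem_bot] at hs
    · rw [intPiece_of_nonneg _ h] at hs
      have h0 : Module.finrank k (𝒜 F.σ.toNat) = 0 := by
        rw [finrank_weightedHomogeneousSubmodule]
        refine natCard_weight_of_not_dvd fun hdvd => hcon ?_
        rw [← Int.toNat_of_nonneg h]
        exact_mod_cast hdvd
      have := Submodule.finrank_eq_zero.1 h0
      rwa [this, Submodule.mem_bot] at hs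
  have hB := F.isBigO_hilbertFn hdeg hA hσ
  have hρ := isBigO_sub_residueCount hA hB
  have hper : ∀ z : ℤ, (degreeGcd 𝒮 : ℤ) ∣ z → ∀ t,
      residueCount D F.a (t + z) = residueCount D F.a t := by
    let P : AddSubgroup ℤ :=
      { carrier := {z | ∀ t, residueCount D F.a (t + z) = residueCount D F.a t}
        zero_mem' := fun t => by rw [add_zero]
        add_mem' := fun {x y} hx hy t => by rw [← add_assoc, hy, hx]
        neg_mem' := fun {x} hx t => by rw [← hx (t + -x), neg_add_cancel_right] }
    intro z hz
    refine mem_of_degreeGcd_dvd 𝒮 P (fun n hn => ?_) hz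
    refine residueCount_add_eq he hD hγpos hρ fun t => hilbertFn_le_add 𝒮 ?_ t
    rwa [intPiece_natCast]
  have hmpos : 0 < degreeGcd 𝒮 := by
    refine Nat.pos_of_ne_zero fun h0 => ?_
    have hmem := Nat.setGcd_eq_zero_iff.1 h0
    have hne : 𝒮 D ≠ ⊥ := fun hbot => by
      have h1 := hθ 0
      rw [hbot, Submodule.mem_bot] at h1
      have h2 : aeval (R := k) θ (X 0) = aeval (R := k) θ 0 := by rw [aeval_X, h1, map_zero]
      exact X_ne_zero _ (hinj h2)
    exact hD.ne' (hmem hne)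
  have hrpos := F.r_pos hinj
  -- every multiple of the greatest common divisor is congruent to the degree of a basis element
  have hcount : 0 < residueCount D F.a 0 := by
    have h0 : F.w ⟨0, hrpos⟩ ≠ 0 := F.linearIndependent.ne_zero _
    have h1 := degreeGcd_dvd_of_mem 𝒮 (F.w_mem _) h0
    rw [← hper _ h1, zero_add, residueCount, Finset.card_pos]
    exact ⟨⟨0, hrpos⟩, by simp⟩
  refine ⟨h𝒮fin, hmpos, residueCount D F.a 0 * γ, by positivity, ?_⟩
  refine IsBigO.trans (isBigO_of_le _ fun t => ?_) hρ
  by_cases ht : (degreeGcd 𝒮 : ℤ) ∣ t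
  · rw [if_pos ht]
    have := hper t ht 0
    rw [zero_add] at this
    rw [this]
  · rw [if_neg ht, hilbertFn, intPiece_eq_bot_of_not_dvd 𝒮 ht, finrank_bot, Nat.cast_zero, sub_zero, norm_zero]
    exact norm_nonneg _

end GrowthOfDomain

/-! ### Hilbert functions of Frobenius powers -/

section FrobeniusPower

variable {S : Type*} [CommRing S] (p n : ℕ)

theorem frobeniusPower_eq_map [ExpChar S p] (I : Ideal S) :
    frobeniusPower p n I = I.map (iterateFrobenius S p n) := rfl

theorem frobeniusPower_span [ExpChar S p] (s : Set S) :
    frobeniusPower p n (Ideal.span s) = Ideal.span ((fun x => x ^ p ^ n) '' s) := by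
  rw [frobeniusPower_eq_map, Ideal.map_span]; rfl

theorem frobeniusPower_span_range [ExpChar S p] {ι : Type*} (f : ι → S) :
    frobeniusPower p n (Ideal.span (Set.range f)) = Ideal.span (Set.range fun i => f i ^ p ^ n) := by
  rw [frobeniusPower_span, ← Set.range_comp]; rfl

theorem frobeniusPower_map {R : Type*} [CommRing R] [ExpChar S p] [ExpChar R p] (g : S →+* R)
    (I : Ideal S) : (frobeniusPower p n I).map g = frobeniusPower p n (I.map g) := by
  rw [frobeniusPower_eq_map, frobeniusPower_eq_map, Ideal.map_map, Ideal.map_map]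
  congr 1
  ext x
  simp [iterateFrobenius_def]

end FrobeniusPower

section Resolution

variable {k R : Type*} [Field k] [CommRing R] [Algebra k R] {ℛ : ℕ → Submodule k R}
  [GradedAlgebra ℛ] {J : Ideal R}

/-- The Hilbert functions of the Frobenius powers of an ideal with a finite minimal graded free
resolution: the Frobenius pullback of the resolution is a resolution of the Frobenius power. -/
theorem GradedFreeResolution.idealHilbertFn_frobeniusPower [IsNoetherianRing R]
    [∀ n, Module.Finite k (ℛ n)] (p : ℕ) [ExpChar R p] (F : GradedFreeResolution ℛ J) (𝔪 : Ideal R)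
    (hJ : ∀ P : Ideal R, P.IsPrime → J ≤ P → 𝔪 ≤ P) (hJ𝔪 : J ≤ 𝔪)
    (hmin : ∀ i a b, F.d i a b ∈ 𝔪) (n : ℕ) (t : ℤ) :
    (idealHilbertFn ℛ (frobeniusPower p n J) t : ℤ) =
      F.altSum fun j => (hilbertFn ℛ (t - (p ^ n : ℕ) * j) : ℤ) := by
  have hgen : ∀ b, F.gen b ∈ J := fun b => F.span_gen.le (Ideal.subset_span ⟨b, rfl⟩)
  have hex : ∀ i, ExactAt (F.augmented.frobenius p n).d R i := by
    refine exactAt_frobenius (D := F.augmented.d) p F.augmented_exactAt F.augmented_rank_eq_zero J 𝔪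
      hJ ?_ ?_ n
    · intro i a b
      cases i with
      | zero => exact hJ𝔪 (hgen b)
      | succ i => exact hmin i a b
    · intro y hy
      rw [← F.span_gen] at hy
      obtain ⟨c, hc⟩ := (Submodule.mem_span_range_iff_exists_fun R).1 hy
      refine ⟨Matrix.of fun b (_ : Fin 1) => c b, ?_⟩
      change (Matrix.of fun (_ : Fin 1) b => F.gen b) * (Matrix.of fun b (_ : Fin 1) => c b) =
        y • (1 : Matrix (Fin 1) (Fin 1) R)
      ext i j
      rw [Subsingleton.elim i j, Matrix.mul_apply, Matrix.smul_apply, Matrix.one_apply_eq,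
        smul_eq_mul, mul_one, ← hc]
      exact Finset.sum_congr rfl fun b _ => mul_comm _ _
  have h := (F.augmented.frobenius p n).finrank_rangePiece_eq hex (L := F.len)
    F.augmented_rank_eq_zero t
  have hrow := finrank_rangePiece_row (ℛ := ℛ) (fun b => F.gen b ^ p ^ n)
    ((F.augmented.frobenius p n).deg 0) (by
      change ((p ^ n : ℕ) : ℤ) * 0 = 0
      rw [mul_zero]) t
  rw [← frobeniusPower_span_range, F.span_gen] at hrow
  rw [idealHilbertFn, ← hrow]
  exact h

omit [GradedAlgebra ℛ] in
theorem GradedFreeResolution.altSum_sub (F : GradedFreeResolution ℛ J) {A : Type*} [Ring A]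
    (φ ψ : ℤ → A) : F.altSum (fun j => φ j - ψ j) = F.altSum φ - F.altSum ψ := by
  simp only [altSum, Finset.sum_sub_distrib, mul_sub]

omit [GradedAlgebra ℛ] in
theorem GradedFreeResolution.altSum_const_mul (F : GradedFreeResolution ℛ J) {A : Type*}
    [CommRing A] (c : A) (φ : ℤ → A) : F.altSum (fun j => c * φ j) = c * F.altSum φ := by
  simp only [altSum, Finset.mul_sum]
  refine Finset.sum_congr rfl fun i _ => Finset.sum_congr rfl fun b _ => ?_
  ring

omit [GradedAlgebra ℛ] in
theorem GradedFreeResolution.altSum_sum (F : GradedFreeResolution ℛ J) {A ι : Type*} [Ring A]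
    (s : Finset ι) (φ : ι → ℤ → A) :
    F.altSum (fun j => ∑ i ∈ s, φ i j) = ∑ i ∈ s, F.altSum (φ i) := by
  simp only [altSum]
  rw [Finset.sum_comm]
  refine Finset.sum_congr rfl fun i _ => ?_
  rw [← Finset.mul_sum, Finset.sum_comm]

omit [GradedAlgebra ℛ] in
theorem GradedFreeResolution.isBigO_altSum (F : GradedFreeResolution ℛ J) {X : Type*}
    {φ : X → ℤ → ℝ} {N : X → ℝ} (h : ∀ j, (fun x => φ x j) =O[⊤] N) :
    (fun x => F.altSum (φ x)) =O[⊤] N := by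
  simp only [altSum]
  refine Asymptotics.IsBigO.fun_sum fun i _ => Asymptotics.IsBigO.const_mul_left ?_ _
  exact Asymptotics.IsBigO.fun_sum fun b _ => h _

end Resolution

section Window

theorem sum_range_add_eq_of_vanish {h : ℤ → ℝ} {m : ℕ} (hm : 0 < m)
    (hh : ∀ j, ¬ (m : ℤ) ∣ j → h j = 0) (s : ℤ) :
    ∑ j ∈ Finset.range m, h (s + j) = h (s + (-s) % m) := by
  have hm' : (0 : ℤ) < m := by exact_mod_cast hm
  have h1 := Int.emod_nonneg (-s) hm'.ne'
  have h2 := Int.emod_lt_of_pos (-s) hm'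
  have h3 : (((-s) % m).toNat : ℤ) = (-s) % m := Int.toNat_of_nonneg h1
  rw [Finset.sum_eq_single_of_mem ((-s) % m).toNat (Finset.mem_range.2 (by omega)), h3]
  intro j hj hne
  refine hh _ fun hdvd => hne ?_
  have h4 := Finset.mem_range.1 hj
  have h5 : (j : ℤ) % m = (-s) % m := by
    refine Int.ModEq.eq ((Int.modEq_iff_dvd).2 ?_)
    rw [show -s - (j : ℤ) = -(s + j) by ring]
    exact (dvd_neg).2 hdvd
  rw [Int.emod_eq_of_lt (by omega) (by omega)] at h5
  omega

theorem dvd_add_neg_emod (m : ℕ) (s : ℤ) : (m : ℤ) ∣ s + (-s) % m := by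
  have := Int.dvd_sub_self_of_emod_eq (a := -s) (b := m) rfl
  rw [show s + -s % m = -s % m - -s by ring]
  exact this

end Window

section Estimate

open Asymptotics

/-- The error terms at the `q`-th Frobenius power, `q = p ^ n`, and in degree `t` are of the order
of `(|t| + q) ^ e`. -/
def errorBound (p : ℕ) (x : ℕ × ℤ) : ℝ := |(x.2 : ℝ)| + (p : ℝ) ^ x.1

variable {p : ℕ}

theorem errorBound_pos (hp : 0 < p) (x : ℕ × ℤ) : 0 < errorBound p x := by
  have : (0 : ℝ) < p := by exact_mod_cast hp
  rw [errorBound]; positivity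

theorem isBigO_one_errorBound (hp : 0 < p) : (fun _ => (1 : ℝ)) =O[⊤] errorBound p :=
  isBigO_of_le _ fun x => by
    have h1 : (1 : ℝ) ≤ (p : ℝ) ^ x.1 := one_le_pow₀ (by exact_mod_cast hp)
    rw [norm_one, Real.norm_of_nonneg (errorBound_pos hp x).le, errorBound]
    linarith [abs_nonneg (x.2 : ℝ)]

theorem isBigO_errorBound_affine (hp : 0 < p) (a b c : ℤ) :
    (fun x : ℕ × ℤ => ((a * x.2 - (p ^ x.1 : ℕ) * b - c : ℤ) : ℝ)) =O[⊤] errorBound p := by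
  have h1 : (fun x : ℕ × ℤ => (x.2 : ℝ)) =O[⊤] errorBound p := isBigO_of_le _ fun x => by
    rw [Real.norm_of_nonneg (errorBound_pos hp x).le, Real.norm_eq_abs, errorBound]
    exact le_add_of_nonneg_right (by positivity)
  have h2 : (fun x : ℕ × ℤ => (p : ℝ) ^ x.1) =O[⊤] errorBound p := isBigO_of_le _ fun x => by
    rw [Real.norm_of_nonneg (errorBound_pos hp x).le, Real.norm_of_nonneg (by positivity),
      errorBound]
    exact le_add_of_nonneg_left (abs_nonneg _)
  have h3 := ((h1.const_mul_left (a : ℝ)).sub (h2.const_mul_left (b : ℝ))).sub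
    ((isBigO_one_errorBound hp).const_mul_left (c : ℝ))
  refine h3.congr_left fun x => ?_
  push_cast; ring

variable {k A B : Type*} [Field k] [CommRing A] [CommRing B] [Algebra k A] [Algebra k B]
  [Algebra A B] [IsScalarTower k A B] {𝒜 : ℕ → Submodule k A} {ℬ : ℕ → Submodule k B}
  [GradedAlgebra 𝒜] [GradedAlgebra ℬ] [IsDomain A] [∀ n, Module.Finite k (𝒜 n)]
  [∀ n, Module.Finite k (ℬ n)] [ExpChar A p] [ExpChar B p] {m e : ℕ} {γ : ℝ}

omit [ExpChar B p] in
/-- The Hilbert function of the extension of the Frobenius power `I^[q]` of an ideal `I` to a finite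
extension is, up to an error of order `(|t| + q) ^ (e - 1)`, a sum of shifts of that of `I^[q]`. -/
theorem HomogeneousFrame.isBigO_frobeniusPower (F : HomogeneousFrame 𝒜 ℬ) (hp : 0 < p)
    (h : ∀ n, ∀ a ∈ 𝒜 n, algebraMap A B a ∈ ℬ n) (hA : HasGrowth (hilbertFn 𝒜) m e γ)
    (hσ : (m : ℤ) ∣ F.σ) {l : ℕ} (f : Fin l → A) (c : Fin l → ℤ)
    (hf : ∀ i, f i ∈ intPiece 𝒜 (c i)) :
    (fun x : ℕ × ℤ =>
      (idealHilbertFn ℬ ((frobeniusPower p x.1 (Ideal.span (Set.range f))).map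
        (algebraMap A B)) x.2 : ℝ) -
      ∑ i, (idealHilbertFn 𝒜 (frobeniusPower p x.1 (Ideal.span (Set.range f)))
        (x.2 - F.a i) : ℝ)) =O[⊤] fun x => errorBound p x ^ (e - 1) := by
  have h1 : (fun x : ℕ × ℤ => ∑ i, ∑ j, ((hilbertFn 𝒜 (x.2 - (p ^ x.1 : ℕ) * c i - F.b j) : ℝ) -
      hilbertFn 𝒜 (x.2 - (p ^ x.1 : ℕ) * c i - F.b j - F.σ))) =O[⊤]
      fun x => errorBound p x ^ (e - 1) := by
    refine IsBigO.fun_sum fun i _ => IsBigO.fun_sum fun j _ => ?_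
    have hτ := isBigO_errorBound_affine hp 1 (c i) (F.b j)
    simp only [one_mul] at hτ
    exact isBigO_comp_int (hA.sub_shift hσ) hτ (isBigO_one_errorBound hp)
  refine IsBigO.trans (isBigO_of_le _ fun x => ?_) h1
  rw [frobeniusPower_span_range]
  have hu := F.idealHilbertFn_le h (fun i => f i ^ p ^ x.1) (fun i => (p ^ x.1 : ℕ) * c i)
    (fun i => pow_mem_intPiece 𝒜 (hf i) _) x.2
  have hl := F.sum_le_idealHilbertFn h (Ideal.span (Set.range fun i => f i ^ p ^ x.1)) x.2
  have hu' : (idealHilbertFn ℬ ((Ideal.span (Set.range fun i => f i ^ p ^ x.1)).map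
      (algebraMap A B)) x.2 : ℝ) + ∑ i, ∑ j,
        (hilbertFn 𝒜 (x.2 - (p ^ x.1 : ℕ) * c i - F.b j - F.σ) : ℝ) ≤
      ∑ i, (idealHilbertFn 𝒜 (Ideal.span (Set.range fun i => f i ^ p ^ x.1)) (x.2 - F.a i) : ℝ) +
        ∑ i, ∑ j, (hilbertFn 𝒜 (x.2 - (p ^ x.1 : ℕ) * c i - F.b j) : ℝ) := by
    exact_mod_cast hu
  have hl' : ∑ i, (idealHilbertFn 𝒜 (Ideal.span (Set.range fun i => f i ^ p ^ x.1))
      (x.2 - F.a i) : ℝ) ≤ (idealHilbertFn ℬ ((Ideal.span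
        (Set.range fun i => f i ^ p ^ x.1)).map (algebraMap A B)) x.2 : ℝ) := by exact_mod_cast hl
  simp only [Finset.sum_sub_distrib]
  rw [Real.norm_of_nonneg (by linarith), Real.norm_of_nonneg (by linarith)]
  linarith

omit [ExpChar A p] in
theorem isBigO_errorBound_shift {g : ℕ × ℤ → ℝ} {e : ℕ} (hp : 0 < p)
    (hg : g =O[⊤] fun x => errorBound p x ^ e) (a : ℤ) :
    (fun x : ℕ × ℤ => g (x.1, x.2 - a)) =O[⊤] fun x => errorBound p x ^ e := by
  have h1 := hg.comp_tendsto (tendsto_top (f := fun x : ℕ × ℤ => (x.1, x.2 - a)) (l := ⊤))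
  refine h1.trans ?_
  refine IsBigO.pow ?_ e
  have h2 := isBigO_errorBound_affine hp 1 0 a
  have h3 := isBigO_errorBound_affine hp 0 1 0
  have h4 := h2.abs_left.sub h3
  refine h4.congr_left fun x => ?_
  simp only [errorBound]
  push_cast
  ring_nf

/-- The Hilbert functions of the Frobenius powers of an ideal of a graded domain vary little under
shifts by multiples of the greatest common divisor of the degrees. -/
theorem isBigO_idealHilbertFn_sub_shift (hp : 0 < p)
    (hA : HasGrowth (hilbertFn 𝒜) (degreeGcd 𝒜) e γ) {l : ℕ} (f : Fin l → A) (c : Fin l → ℤ)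
    (hf : ∀ i, f i ∈ intPiece 𝒜 (c i)) {z : ℤ} (hz : (degreeGcd 𝒜 : ℤ) ∣ z) :
    (fun x : ℕ × ℤ =>
      (idealHilbertFn 𝒜 (frobeniusPower p x.1 (Ideal.span (Set.range f))) x.2 : ℝ) -
      idealHilbertFn 𝒜 (frobeniusPower p x.1 (Ideal.span (Set.range f))) (x.2 - z)) =O[⊤]
      fun x => errorBound p x ^ (e - 1) := by
  set H : ℕ × ℤ → ℝ := fun x =>
    (idealHilbertFn 𝒜 (frobeniusPower p x.1 (Ideal.span (Set.range f))) x.2 : ℝ) with hH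
  let P : AddSubgroup ℤ :=
    { carrier := {z | (fun x : ℕ × ℤ => H x - H (x.1, x.2 - z)) =O[⊤]
        fun x => errorBound p x ^ (e - 1)}
      zero_mem' := by
        change (fun x : ℕ × ℤ => H x - H (x.1, x.2 - 0)) =O[⊤] _
        simp only [sub_zero, Prod.mk.eta, sub_self]
        exact isBigO_zero _ _
      add_mem' := fun {y z} hy hz => by
        change (fun x : ℕ × ℤ => H x - H (x.1, x.2 - (y + z))) =O[⊤] _
        refine (IsBigO.add hy (isBigO_errorBound_shift hp hz y)).congr_left fun x => ?_
        simp only [sub_sub]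
        ring
      neg_mem' := fun {y} hy => by
        change (fun x : ℕ × ℤ => H x - H (x.1, x.2 - -y)) =O[⊤] _
        refine (isBigO_errorBound_shift hp hy (-y)).neg_left.congr_left fun x => ?_
        simp only [sub_sub, neg_add_cancel, sub_zero, Prod.mk.eta]
        ring }
  refine mem_of_degreeGcd_dvd 𝒜 P (fun n hn => ?_) hz
  obtain ⟨s, hs, hs0⟩ := Submodule.exists_mem_ne_zero_of_ne_bot hn
  rw [← intPiece_natCast 𝒜] at hs
  have h1 := (HomogeneousFrame.ofElement hs hs0).isBigO_frobeniusPower hp (fun _ _ h => h) hA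
    (degreeGcd_dvd_of_mem 𝒜 hs hs0) f c hf
  refine h1.congr_left fun x => ?_
  change (idealHilbertFn 𝒜 ((frobeniusPower p x.1 (Ideal.span (Set.range f))).map
    (algebraMap A A)) x.2 : ℝ) - ∑ _i : Fin 1, H (x.1, x.2 - n) = H x - H (x.1, x.2 - n)
  rw [Fin.sum_univ_one, Algebra.algebraMap_self, Ideal.map_id]

omit [IsDomain A] [∀ n, Module.Finite k (𝒜 n)] [ExpChar A p] [GradedAlgebra 𝒜] in
theorem idealHilbertFn_eq_zero_of_not_dvd (𝔞 : Ideal A) {j : ℤ} (h : ¬ (degreeGcd 𝒜 : ℤ) ∣ j) :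
    idealHilbertFn 𝒜 𝔞 j = 0 := by
  rw [idealHilbertFn, intPiece_eq_bot_of_not_dvd 𝒜 h, inf_bot_eq, finrank_bot]

omit [ExpChar A p] [ExpChar B p] in
/-- The Hilbert function of a finite extension, summed over a full period. -/
theorem HomogeneousFrame.isBigO_window (F : HomogeneousFrame 𝒜 ℬ)
    (h : ∀ n, ∀ a ∈ 𝒜 n, algebraMap A B a ∈ ℬ n)
    (hA : HasGrowth (hilbertFn 𝒜) (degreeGcd 𝒜) e γ) (hm : 0 < degreeGcd 𝒜) :
    (fun t : ℤ => ∑ j ∈ Finset.range (degreeGcd 𝒜), (hilbertFn ℬ (t + j) : ℝ) -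
      F.r * γ * max (t : ℝ) 0 ^ e) =O[⊤] fun t : ℤ => (|(t : ℝ)| + 1) ^ (e - 1) := by
  have hσ := degreeGcd_dvd_of_mem 𝒜 F.s_mem F.s_ne_zero
  have h1 : (fun t : ℤ => ∑ j ∈ Finset.range (degreeGcd 𝒜), ((hilbertFn ℬ (t + j) : ℝ) -
      ∑ i, (hilbertFn 𝒜 (t + j - F.a i) : ℝ))) =O[⊤] fun t : ℤ => (|(t : ℝ)| + 1) ^ (e - 1) := by
    refine IsBigO.fun_sum fun j _ => ?_
    have := isBigO_comp_shift (F.isBigO_hilbertFn h hA hσ) (-j)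
    simpa only [sub_neg_eq_add] using this
  have h2 : ∀ i, (fun t : ℤ => ∑ j ∈ Finset.range (degreeGcd 𝒜), (hilbertFn 𝒜 (t + j - F.a i) : ℝ) -
      γ * max (t : ℝ) 0 ^ e) =O[⊤] fun t : ℤ => (|(t : ℝ)| + 1) ^ (e - 1) := by
    intro i
    set τ : ℤ → ℤ := fun t => t - F.a i + (-(t - F.a i)) % (degreeGcd 𝒜 : ℤ) with hτ
    have hb : (fun t : ℤ => ((τ t : ℤ) : ℝ) - t) =O[⊤] fun _ => (1 : ℝ) := by
      refine isBigO_top.2 ⟨|(F.a i : ℝ)| + degreeGcd 𝒜, fun t => ?_⟩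
      have hm' : (0 : ℤ) < degreeGcd 𝒜 := by exact_mod_cast hm
      have e1 : (0 : ℝ) ≤ ((-(t - F.a i)) % (degreeGcd 𝒜 : ℤ) : ℤ) := by
        exact_mod_cast Int.emod_nonneg _ hm'.ne'
      have e2 : (((-(t - F.a i)) % (degreeGcd 𝒜 : ℤ) : ℤ) : ℝ) ≤ degreeGcd 𝒜 := by
        exact_mod_cast (Int.emod_lt_of_pos (-(t - F.a i)) hm').le
      have e3 : ((τ t : ℤ) : ℝ) - t =
          -(F.a i : ℝ) + ((-(t - F.a i)) % (degreeGcd 𝒜 : ℤ) : ℤ) := by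
        rw [hτ]; push_cast; ring
      rw [norm_one, mul_one, e3]
      refine (norm_add_le _ _).trans ?_
      rw [norm_neg, Real.norm_eq_abs, Real.norm_of_nonneg e1]
      linarith
    have hτO : (fun t : ℤ => ((τ t : ℤ) : ℝ)) =O[⊤] fun t : ℤ => |(t : ℝ)| + 1 := by
      refine ((hb.trans isBigO_one_abs_add_one).add isBigO_self_abs_add_one).congr_left fun t => ?_
      ring
    have h3 := isBigO_comp_int hA hτO isBigO_one_abs_add_one
    have h4 := (isBigO_max_pow_sub e hτO isBigO_self_abs_add_one hb).const_mul_left γ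
    refine (h3.add h4).congr_left fun t => ?_
    have h5 : ∑ j ∈ Finset.range (degreeGcd 𝒜), (hilbertFn 𝒜 (t + j - F.a i) : ℝ) =
        hilbertFn 𝒜 (τ t) := by
      rw [← sum_range_add_eq_of_vanish (h := fun t => (hilbertFn 𝒜 t : ℝ)) hm ?_]
      · exact Finset.sum_congr rfl fun j _ => by rw [add_sub_right_comm]
      · intro j hj
        rw [hilbertFn, intPiece_eq_bot_of_not_dvd 𝒜 hj, finrank_bot, Nat.cast_zero]
    rw [h5, if_pos (dvd_add_neg_emod _ _)]
    ring
  have h6 := IsBigO.fun_sum (s := Finset.univ) fun i (_ : i ∈ Finset.univ) => h2 i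
  refine (h1.add h6).congr_left fun t => ?_
  rw [Finset.sum_sub_distrib, Finset.sum_sub_distrib, Finset.sum_comm (s := Finset.univ),
    Finset.sum_const, Finset.card_univ, Fintype.card_fin, nsmul_eq_mul]
  ring

/-- The Hilbert functions of the Frobenius powers of `I`, in terms of a minimal graded free resolution
of `IB` over the finite extension `B`. -/
theorem HomogeneousFrame.isBigO_idealHilbertFn (F : HomogeneousFrame 𝒜 ℬ) (hp : 0 < p)
    (h : ∀ n, ∀ a ∈ 𝒜 n, algebraMap A B a ∈ ℬ n) (hinj : Function.Injective (algebraMap A B))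
    (hA : HasGrowth (hilbertFn 𝒜) (degreeGcd 𝒜) e γ) (hm : 0 < degreeGcd 𝒜) {l : ℕ} (f : Fin l → A)
    (c : Fin l → ℤ) (hf : ∀ i, f i ∈ intPiece 𝒜 (c i)) {I : Ideal A}
    (hI : Ideal.span (Set.range f) = I)
    (G : GradedFreeResolution ℬ (I.map (algebraMap A B)))
    (hG : ∀ n t, (idealHilbertFn ℬ (frobeniusPower p n (I.map (algebraMap A B))) t : ℤ) =
      G.altSum fun j => (hilbertFn ℬ (t - (p ^ n : ℕ) * j) : ℤ)) :
    (fun x : ℕ × ℤ => (idealHilbertFn 𝒜 (frobeniusPower p x.1 I) (degreeGcd 𝒜 * x.2) : ℝ) -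
      γ * G.altSum fun j => max ((degreeGcd 𝒜 * x.2 - (p ^ x.1 : ℕ) * j : ℤ) : ℝ) 0 ^ e) =O[⊤]
      fun x => errorBound p x ^ (e - 1) := by
  set m := degreeGcd 𝒜 with hmdef
  have hσ := degreeGcd_dvd_of_mem 𝒜 F.s_mem F.s_ne_zero
  have hr := F.r_pos hinj
  -- compare `B` and `A`
  have h1 : (fun x : ℕ × ℤ => ∑ j ∈ Finset.range m,
      ((idealHilbertFn ℬ (frobeniusPower p x.1 (I.map (algebraMap A B))) (x.2 + j) : ℝ) -
      ∑ i, (idealHilbertFn 𝒜 (frobeniusPower p x.1 I) (x.2 + j - F.a i) : ℝ))) =O[⊤]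
      fun x => errorBound p x ^ (e - 1) := by
    refine IsBigO.fun_sum fun j _ => ?_
    have := isBigO_errorBound_shift hp (F.isBigO_frobeniusPower hp h hA hσ f c hf) (-j)
    simpa only [sub_neg_eq_add, hI, frobeniusPower_map] using this
  -- the sum over a period of the shifts of the Hilbert function of `I^[q]`
  have h2 : ∀ i, (fun x : ℕ × ℤ => (idealHilbertFn 𝒜 (frobeniusPower p x.1 I) x.2 : ℝ) -
      idealHilbertFn 𝒜 (frobeniusPower p x.1 I) (x.2 - m * (F.a i / m))) =O[⊤]
      fun x => errorBound p x ^ (e - 1) := fun i => by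
    have := isBigO_idealHilbertFn_sub_shift hp hA f c hf (z := m * (F.a i / m)) (dvd_mul_right _ _)
    rwa [hI] at this
  -- the Hilbert function of `(IB)^[q]`
  have h3 : (fun x : ℕ × ℤ => G.altSum fun b => (∑ j ∈ Finset.range m,
      (hilbertFn ℬ (x.2 - (p ^ x.1 : ℕ) * b + j) : ℝ) -
      F.r * γ * max ((x.2 - (p ^ x.1 : ℕ) * b : ℤ) : ℝ) 0 ^ e)) =O[⊤]
      fun x => errorBound p x ^ (e - 1) := by
    refine G.isBigO_altSum fun b => ?_
    have hτ := isBigO_errorBound_affine hp 1 b 0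
    simp only [one_mul, sub_zero] at hτ
    exact isBigO_comp_int (F.isBigO_window h hA hm) hτ (isBigO_one_errorBound hp)
  have h4 := ((h3.sub h1).add (IsBigO.fun_sum (s := Finset.univ)
    fun i (_ : i ∈ Finset.univ) => h2 i)).const_mul_left ((F.r : ℝ)⁻¹)
  -- restrict to the multiples of `m`
  have h5 := h4.comp_tendsto (tendsto_top (f := fun x : ℕ × ℤ => (x.1, (m : ℤ) * x.2)) (l := ⊤))
  have h6 : (fun x : ℕ × ℤ => errorBound p (x.1, (m : ℤ) * x.2)) =O[⊤] errorBound p := by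
    have h7 := isBigO_errorBound_affine hp m 0 0
    have h8 := isBigO_errorBound_affine hp 0 1 0
    refine (h7.abs_left.sub h8).congr_left fun x => ?_
    simp only [errorBound]
    push_cast
    ring_nf
  refine (h5.trans (h6.pow _)).congr_left fun x => ?_
  have hper : ∀ i, ∑ j ∈ Finset.range m,
      (idealHilbertFn 𝒜 (frobeniusPower p x.1 I) (m * x.2 + j - F.a i) : ℝ) =
      idealHilbertFn 𝒜 (frobeniusPower p x.1 I) (m * x.2 - m * (F.a i / m)) := by
    intro i
    have e1 := sum_range_add_eq_of_vanish
      (h := fun t => (idealHilbertFn 𝒜 (frobeniusPower p x.1 I) t : ℝ)) hm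
      (fun j hj => by rw [idealHilbertFn_eq_zero_of_not_dvd _ hj, Nat.cast_zero]) (m * x.2 - F.a i)
    have e2 : (m : ℤ) * x.2 - F.a i + -(m * x.2 - F.a i) % m = m * x.2 - m * (F.a i / m) := by
      rw [show -((m : ℤ) * x.2 - F.a i) = F.a i + m * (-x.2) by ring, Int.add_mul_emod_self_left]
      have := Int.emod_add_mul_ediv (F.a i) m
      linarith
    rw [e2] at e1
    rw [← e1]
    exact Finset.sum_congr rfl fun j _ => by rw [add_sub_right_comm]
  have hres : ∑ j ∈ Finset.range m,
      (idealHilbertFn ℬ (frobeniusPower p x.1 (I.map (algebraMap A B))) (m * x.2 + j) : ℝ) =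
      G.altSum fun b => ∑ j ∈ Finset.range m,
        (hilbertFn ℬ (m * x.2 - (p ^ x.1 : ℕ) * b + j) : ℝ) := by
    rw [G.altSum_sum]
    refine Finset.sum_congr rfl fun j _ => ?_
    have := congrArg (Int.cast : ℤ → ℝ) (hG x.1 (m * x.2 + j))
    rw [Int.cast_natCast] at this
    rw [this]
    simp only [GradedFreeResolution.altSum]
    push_cast
    simp only [add_sub_right_comm]
  have hr' : (F.r : ℝ) ≠ 0 := by exact_mod_cast hr.ne'
  simp only [Function.comp]
  rw [G.altSum_sub, G.altSum_const_mul, Finset.sum_sub_distrib, Finset.sum_sub_distrib,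
    Finset.sum_const, Finset.card_univ, Fintype.card_fin, nsmul_eq_mul, hres,
    Finset.sum_comm (s := Finset.range m), Finset.sum_congr rfl fun i _ => hper i]
  field_simp
  ring

end Estimate

/-! ### Convergence of the step functions -/

section Convergence

/-- Values `u n M` that are close to `q ^ e g(M / q)`, `q = p ^ n`, and vanish for `M ≥ L q`: the
piecewise linear interpolations of `u n ⌊xq⌋ / q ^ e` converge to `g` uniformly on `[0, ∞)`. -/
theorem tendstoUniformlyOn_interpolation {p e : ℕ} (hp : 1 < p) (he : 0 < e) {u : ℕ → ℕ → ℝ}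
    {g : ℝ → ℝ} (hg : Continuous g) {C : ℝ} (hC : 0 ≤ C)
    (hu : ∀ n M, |u n M - ((p : ℝ) ^ n) ^ e * g (M / (p : ℝ) ^ n)| ≤
      C * ((M : ℝ) + (p : ℝ) ^ n) ^ (e - 1))
    {L₀ : ℕ} (hL : ∀ n M, L₀ * p ^ n ≤ M → u n M = 0) :
    TendstoUniformlyOn (fun n x =>
      (1 - Int.fract (x * (p : ℝ) ^ n)) * (u n ⌊x * (p : ℝ) ^ n⌋₊ / ((p : ℝ) ^ n) ^ e) +
        Int.fract (x * (p : ℝ) ^ n) *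
          (u n ⌊(x + 1 / (p : ℝ) ^ n) * (p : ℝ) ^ n⌋₊ / ((p : ℝ) ^ n) ^ e)) g atTop (Set.Ici 0) := by
  have hp0 : (0 : ℝ) < p := by exact_mod_cast (zero_lt_one.trans hp)
  have hq : ∀ n : ℕ, (0 : ℝ) < (p : ℝ) ^ n := fun n => by positivity
  have hq1 : ∀ n : ℕ, (1 : ℝ) ≤ (p : ℝ) ^ n := fun n => one_le_pow₀ (by exact_mod_cast hp.le)
  have hqtop : Tendsto (fun n : ℕ => (p : ℝ) ^ n) atTop atTop :=
    tendsto_pow_atTop_atTop_of_one_lt (by exact_mod_cast hp)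
  have hfloor : ∀ (n : ℕ) (x : ℝ), 0 ≤ x → ⌊(x + 1 / (p : ℝ) ^ n) * (p : ℝ) ^ n⌋₊ =
      ⌊x * (p : ℝ) ^ n⌋₊ + 1 := fun n x hx => by
    rw [add_mul, one_div, inv_mul_cancel₀ (hq n).ne', Nat.floor_add_one (by positivity)]
  set s : ℕ → ℝ → ℝ := fun n x =>
      (1 - Int.fract (x * (p : ℝ) ^ n)) * (u n ⌊x * (p : ℝ) ^ n⌋₊ / ((p : ℝ) ^ n) ^ e) +
        Int.fract (x * (p : ℝ) ^ n) *
          (u n ⌊(x + 1 / (p : ℝ) ^ n) * (p : ℝ) ^ n⌋₊ / ((p : ℝ) ^ n) ^ e) with hs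
  have hu' : ∀ n M, |u n M / ((p : ℝ) ^ n) ^ e - g (M / (p : ℝ) ^ n)| ≤
      C * ((M : ℝ) / (p : ℝ) ^ n + 1) ^ (e - 1) / (p : ℝ) ^ n := by
    intro n M
    have h1 : u n M / ((p : ℝ) ^ n) ^ e - g (M / (p : ℝ) ^ n) =
        (u n M - ((p : ℝ) ^ n) ^ e * g (M / (p : ℝ) ^ n)) / ((p : ℝ) ^ n) ^ e := by
      have := (hq n).ne'
      field_simp
    rw [h1, abs_div, abs_of_pos (pow_pos (hq n) e), div_le_div_iff₀ (pow_pos (hq n) e) (hq n)]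
    have h2 : (M : ℝ) + (p : ℝ) ^ n = ((M : ℝ) / (p : ℝ) ^ n + 1) * (p : ℝ) ^ n := by
      have := (hq n).ne'
      field_simp
    have h3 := hu n M
    rw [h2, mul_pow] at h3
    have h4 : ((p : ℝ) ^ n) ^ e = ((p : ℝ) ^ n) ^ (e - 1) * (p : ℝ) ^ n := by
      rw [← pow_succ, Nat.sub_add_cancel he]
    calc _ ≤ C * (((M : ℝ) / (p : ℝ) ^ n + 1) ^ (e - 1) * ((p : ℝ) ^ n) ^ (e - 1)) * (p : ℝ) ^ n :=
          mul_le_mul_of_nonneg_right h3 (hq n).le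
      _ = _ := by rw [h4]; ring
  -- uniform convergence on bounded intervals
  have key : ∀ (L : ℝ), 0 ≤ L → ∀ ε > 0, ∀ᶠ n in atTop, ∀ x, 0 ≤ x → x ≤ L → |s n x - g x| < ε := by
    intro L hL0 ε hε
    have huc := isCompact_Icc.uniformContinuousOn_of_continuous (s := Set.Icc (0 : ℝ) (L + 1))
      hg.continuousOn
    rw [Metric.uniformContinuousOn_iff] at huc
    obtain ⟨δ, hδ, hδg⟩ := huc (ε / 2) (by positivity)
    have e1 : ∀ᶠ n : ℕ in atTop, 1 / δ < (p : ℝ) ^ n := hqtop.eventually_gt_atTop _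
    have e2 : ∀ᶠ n : ℕ in atTop, 2 * (C * (L + 2) ^ (e - 1)) / ε < (p : ℝ) ^ n :=
      hqtop.eventually_gt_atTop _
    filter_upwards [e1, e2] with n h1 h2 x hx0 hxL
    have h1' : 1 / (p : ℝ) ^ n < δ := by
      rw [div_lt_iff₀ (hq n)]
      rw [div_lt_iff₀ hδ] at h1
      linarith
    have h1'' : 1 / (p : ℝ) ^ n ≤ 1 := by
      rw [div_le_one (hq n)]; exact hq1 n
    have hf1 : (⌊x * (p : ℝ) ^ n⌋₊ : ℝ) ≤ x * (p : ℝ) ^ n := Nat.floor_le (by positivity)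
    have hf2 : x * (p : ℝ) ^ n < ⌊x * (p : ℝ) ^ n⌋₊ + 1 := Nat.lt_floor_add_one _
    have close : ∀ M : ℕ, |(M : ℝ) / (p : ℝ) ^ n - x| ≤ 1 / (p : ℝ) ^ n →
        |u n M / ((p : ℝ) ^ n) ^ e - g x| < ε := by
      intro M hM
      have hM' := abs_le.1 hM
      have hM0 : 0 ≤ (M : ℝ) / (p : ℝ) ^ n := by positivity
      have b1 : |u n M / ((p : ℝ) ^ n) ^ e - g (M / (p : ℝ) ^ n)| < ε / 2 := by
        refine (hu' n M).trans_lt ?_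
        rw [div_lt_iff₀ (hq n)]
        rw [div_lt_iff₀ hε] at h2
        have b3 : C * ((M : ℝ) / (p : ℝ) ^ n + 1) ^ (e - 1) ≤ C * (L + 2) ^ (e - 1) :=
          mul_le_mul_of_nonneg_left (pow_le_pow_left₀ (by positivity) (by linarith) _) hC
        linarith
      have b2 : |g (M / (p : ℝ) ^ n) - g x| < ε / 2 :=
        hδg _ ⟨hM0, by linarith⟩ _ ⟨hx0, by linarith⟩ (hM.trans_lt h1')
      calc _ = |(u n M / ((p : ℝ) ^ n) ^ e - g (M / (p : ℝ) ^ n)) + (g (M / (p : ℝ) ^ n) - g x)| := by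
            congr 1; ring
        _ ≤ _ := abs_add_le _ _
        _ < ε := by linarith
    have c1 := close ⌊x * (p : ℝ) ^ n⌋₊ (by
      rw [abs_le, div_sub' (hq n).ne', neg_le_iff_add_nonneg, ← add_div]
      exact ⟨div_nonneg (by nlinarith) (hq n).le, div_le_div_of_nonneg_right (by nlinarith) (hq n).le⟩)
    have c2 := close (⌊x * (p : ℝ) ^ n⌋₊ + 1) (by
      rw [abs_le, div_sub' (hq n).ne', neg_le_iff_add_nonneg, ← add_div]
      push_cast
      exact ⟨div_nonneg (by nlinarith) (hq n).le, div_le_div_of_nonneg_right (by nlinarith) (hq n).le⟩)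
    have t0 := Int.fract_nonneg (x * (p : ℝ) ^ n)
    have t1 := Int.fract_lt_one (x * (p : ℝ) ^ n)
    simp only [hs]
    rw [hfloor n x hx0]
    set t := Int.fract (x * (p : ℝ) ^ n)
    rw [abs_lt] at c1 c2 ⊢
    constructor <;> nlinarith
  have hvan : ∀ (n : ℕ) (x : ℝ), (L₀ : ℝ) + 1 ≤ x → s n x = 0 := by
    intro n x hx
    have hM : L₀ * p ^ n ≤ ⌊x * (p : ℝ) ^ n⌋₊ := by
      refine Nat.le_floor ?_
      push_cast
      have := hq n
      nlinarith
    have hx0 : (0 : ℝ) ≤ x := le_trans (by positivity) hx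
    simp only [hs]
    rw [hfloor n x hx0, hL n _ hM, hL n _ (hM.trans (Nat.le_succ _))]
    simp
  have hg0 : ∀ x : ℝ, (L₀ : ℝ) + 1 ≤ x → g x = 0 := by
    intro x hx
    have hx0 : (0 : ℝ) ≤ x := le_trans (by positivity) hx
    by_contra hne
    obtain ⟨n, hn⟩ := (key x hx0 |g x| (abs_pos.2 hne)).exists
    have := hn x hx0 le_rfl
    rw [hvan n x hx, zero_sub, abs_neg] at this
    exact lt_irrefl _ this
  rw [Metric.tendstoUniformlyOn_iff]
  intro ε hε
  filter_upwards [key (L₀ + 1) (by positivity) ε hε] with n hn x hx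
  rw [dist_comm, Real.dist_eq]
  rcases le_total x (L₀ + 1) with h | h
  · exact hn x hx h
  · rw [hvan n x h, hg0 x h, sub_zero, abs_zero]
    exact hε

end Convergence

section PiecewisePolynomial

open Polynomial

variable {k R : Type*} [Field k] [CommRing R] [Algebra k R] {ℛ : ℕ → Submodule k R} {J : Ideal R}

theorem GradedFreeResolution.natDegree_altSum_le (F : GradedFreeResolution ℛ J) {e : ℕ}
    {φ : ℤ → ℝ[X]} (h : ∀ j, (φ j).natDegree ≤ e) : (F.altSum φ).natDegree ≤ e := by
  refine natDegree_sum_le_of_forall_le _ _ fun i _ => ?_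
  refine natDegree_mul_le.trans ?_
  have h1 : ((-1 : ℝ[X]) ^ i).natDegree = 0 := by
    rcases neg_one_pow_eq_or ℝ[X] i with h | h <;> simp [h]
  rw [h1, zero_add]
  exact natDegree_sum_le_of_forall_le _ _ fun b _ => h _

theorem GradedFreeResolution.eval_altSum (F : GradedFreeResolution ℛ J) (φ : ℤ → ℝ[X]) (x : ℝ) :
    (F.altSum φ).eval x = F.altSum fun j => (φ j).eval x := by
  simp [altSum, eval_finsetSum]

theorem GradedFreeResolution.altSum_congr (F : GradedFreeResolution ℛ J) {A : Type*} [Ring A]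
    {φ ψ : ℤ → A} (h : ∀ i, i < F.len → ∀ b, φ (F.deg i b) = ψ (F.deg i b)) :
    F.altSum φ = F.altSum ψ :=
  Finset.sum_congr rfl fun i hi => by
    rw [Finset.sum_congr rfl fun b _ => h i (Finset.mem_range.1 hi) b]

/-- A function that on `[0, ∞)` is the truncated power sum of a resolution and is `c x ^ e` near `0`
is piecewise polynomial of degree `e`. The breakpoints are `0` and the positive `j / m`, where `j`
runs through the degrees in the resolution. -/
theorem GradedFreeResolution.isPiecewisePolynomial (F : GradedFreeResolution ℛ J) {d m : ℕ}
    (hd : 1 < d) {c : ℝ} (hc : c ≠ 0) {f : ℝ → ℝ}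
    (hf : ∀ x, 0 ≤ x → f x = c * F.bettiSum d m x)
    {δ : ℝ} (hδ : 0 < δ) (hf0 : ∀ x, 0 ≤ x → x < δ → f x = c * x ^ (d - 1)) :
    IsPiecewisePolynomialOfDegree f (d - 1) := by
  classical
  obtain ⟨e, rfl⟩ : ∃ e, d = e + 2 := ⟨d - 2, by omega⟩
  rw [show e + 2 - 1 = e + 1 by omega] at *
  set D : Finset ℝ := (Finset.range F.len).biUnion fun i =>
    Finset.univ.image fun b => (F.deg i b : ℝ) / m with hD
  set B : Finset ℝ := insert 0 (D.filter fun y => 0 < y) with hB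
  have hB0 : (0 : ℝ) ∈ B := Finset.mem_insert_self _ _
  have hBpos : ∀ b ∈ B, 0 ≤ b := by
    intro b hb
    rcases Finset.mem_insert.1 hb with rfl | hb
    · exact le_rfl
    · exact (Finset.mem_filter.1 hb).2.le
  obtain ⟨N, hN⟩ : ∃ N, B.card = N + 1 :=
    ⟨B.card - 1, (Nat.sub_add_cancel (Finset.card_pos.2 ⟨0, hB0⟩)).symm⟩
  set a := B.orderEmbOfFin hN with ha
  have ha0 : a 0 = 0 := by
    have h1 : a 0 = B.min' _ := Finset.orderEmbOfFin_zero hN (Nat.succ_pos N)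
    rw [h1]
    exact le_antisymm (Finset.min'_le _ _ hB0) (Finset.le_min' _ _ _ fun b hb => hBpos b hb)
  have hage : ∀ i, 0 ≤ a i := fun i => hBpos _ (Finset.orderEmbOfFin_mem _ _ _)
  set P : Fin (N + 1) → ℝ[X] := fun i => C c * (X ^ (e + 1) - F.altSum fun j =>
    if (j : ℝ) / m ≤ a i then (X - C ((j : ℝ) / m)) ^ (e + 1) else 0) with hP
  have hPdeg : ∀ i, (P i).natDegree ≤ e + 1 := by
    intro i
    refine (natDegree_C_mul_le _ _).trans ((natDegree_sub_le _ _).trans (max_le ?_ ?_))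
    · rw [natDegree_X_pow]
    · refine F.natDegree_altSum_le fun j => ?_
      split_ifs
      · exact (natDegree_pow_le_of_le _ (natDegree_X_sub_C_le _)).trans (by omega)
      · simp
  have hPf : ∀ (i : Fin (N + 1)) (x : ℝ), a i ≤ x → (∀ j, i < j → x ≤ a j) →
      f x = (P i).eval x := by
    intro i x hix hxj
    rw [hf x ((hage i).trans hix), bettiSum_eq, show e + 2 - 1 = e + 1 by omega, hP]
    simp only [eval_mul, eval_C, eval_sub, eval_pow, eval_X, F.eval_altSum]
    congr 2
    refine F.altSum_congr fun l hl b => ?_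
    split_ifs with h
    · rw [max_eq_left (by linarith)]
      simp
    · push Not at h
      have hmem : (F.deg l b : ℝ) / m ∈ B := by
        refine Finset.mem_insert_of_mem (Finset.mem_filter.2 ⟨?_, (hage i).trans_lt h⟩)
        exact Finset.mem_biUnion.2 ⟨l, Finset.mem_range.2 hl,
          Finset.mem_image_of_mem _ (Finset.mem_univ b)⟩
      have hr : (F.deg l b : ℝ) / m ∈ Set.range a := by
        rw [ha, Finset.range_orderEmbOfFin]; exact hmem
      obtain ⟨j, hj⟩ := hr
      have hij : i < j := by
        rw [← hj] at h
        exact a.lt_iff_lt.1 h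
      have hxle := hxj j hij
      rw [hj] at hxle
      rw [max_eq_right (by linarith), zero_pow (by omega), eval_zero]
  refine ⟨N, a, P, a.strictMono, ha0, hPf, hPdeg, 0, ?_⟩
  -- near `0` the first polynomial is `c X ^ e`
  have hev : ∀ᶠ x : ℝ in 𝓝[>] 0, ∀ j : Fin (N + 1), 0 < j → x ≤ a j := by
    rw [Filter.eventually_all]
    intro j
    by_cases hj : 0 < j
    · have h1 : (0 : ℝ) < a j := by rw [← ha0]; exact a.strictMono hj
      filter_upwards [nhdsWithin_le_nhds (Iio_mem_nhds h1)] with x hx _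
      exact le_of_lt hx
    · exact Eventually.of_forall fun x h => absurd h hj
  have hev2 : ∀ᶠ x : ℝ in 𝓝[>] 0, (P 0).eval x = (C c * X ^ (e + 1)).eval x := by
    filter_upwards [hev, nhdsWithin_le_nhds (Iio_mem_nhds hδ), self_mem_nhdsWithin] with x h1 h2 h3
    have h3' : (0 : ℝ) < x := h3
    rw [← hPf 0 x (by rw [ha0]; exact h3'.le) h1, hf0 x h3'.le h2]
    simp
  have hP0 : P 0 = C c * X ^ (e + 1) := by
    obtain ⟨η, hη, hsub⟩ := mem_nhdsGT_iff_exists_Ioo_subset.1 hev2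
    exact eq_of_infinite_eval_eq _ _ ((Set.Ioo_infinite hη).mono hsub)
  rw [hP0, natDegree_C_mul_X_pow _ _ hc]

end PiecewisePolynomial

/-! ### Ideals of finite colength -/

section FiniteColength

open HomogeneousIdeal

variable {k S : Type*} [Field k] [CommRing S] [Algebra k S] (𝒮 : ℕ → Submodule k S)
  [GradedAlgebra 𝒮]

theorem Ideal.IsHomogeneous.projZ_mem {I : Ideal S} (hI : I.IsHomogeneous 𝒮) (j : ℤ) {x : S}
    (hx : x ∈ I) : projZ 𝒮 j x ∈ I := by
  rcases lt_or_ge j 0 with h | h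
  · rw [projZ_of_neg 𝒮 h]; exact zero_mem _
  · rw [projZ_of_nonneg 𝒮 h]; exact hI _ hx

theorem Ideal.IsHomogeneous.exists_homogeneous_span [IsNoetherianRing S] {I : Ideal S}
    (hI : I.IsHomogeneous 𝒮) :
    ∃ (l : ℕ) (f : Fin l → S) (c : Fin l → ℤ), (∀ i, f i ∈ intPiece 𝒮 (c i)) ∧
      Ideal.span (Set.range f) = I := by
  classical
  obtain ⟨n, g, hg⟩ := Submodule.fg_iff_exists_fin_generating_family.1 (IsNoetherian.noetherian I)
  choose T hT using fun i => exists_sum_projZ 𝒮 (g i)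
  let ι := Σ i : Fin n, T i
  let e := Fintype.equivFin ι
  refine ⟨Fintype.card ι, fun j => projZ 𝒮 (e.symm j).2 (g (e.symm j).1), fun j => (e.symm j).2,
    fun j => _root_.projZ_mem 𝒮 _ _, le_antisymm ?_ ?_⟩
  · rw [Ideal.span_le]
    rintro _ ⟨j, rfl⟩
    refine hI.projZ_mem 𝒮 _ ?_
    rw [← hg]
    exact Submodule.subset_span ⟨_, rfl⟩
  · rw [← hg, Submodule.span_le]
    rintro _ ⟨i, rfl⟩
    rw [SetLike.mem_coe, ← hT i (T i) subset_rfl]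
    refine Submodule.sum_mem _ fun t ht => Submodule.subset_span ⟨e ⟨i, ⟨t, ht⟩⟩, ?_⟩
    change projZ 𝒮 (e.symm (e _)).2 (g (e.symm (e _)).1) = _
    rw [e.symm_apply_apply]

theorem exists_irrelevant_pow_le (h𝒮 : 𝒮 0 = 1) [Nontrivial S] [IsNoetherianRing S] {I : Ideal S}
    (hI : I.IsHomogeneous 𝒮) (hfin : HasFiniteColength I) :
    ∃ N, (irrelevant 𝒮).toIdeal ^ N ≤ I := by
  have hart : IsArtinian S (S ⧸ I) := (isFiniteLength_iff_isNoetherian_isArtinian.1 hfin).2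
  have hart' : IsArtinianRing (S ⧸ I) := isArtinian_of_tower S hart
  have hmax : ∀ P : Ideal S, P.IsPrime → I ≤ P → P.IsMaximal := by
    intro P hP hIP
    have h1 : (P.map (Ideal.Quotient.mk I)).IsPrime :=
      Ideal.map_isPrime_of_surjective Ideal.Quotient.mk_surjective (by rwa [Ideal.mk_ker])
    have h2 := IsArtinianRing.isMaximal_of_isPrime (P.map (Ideal.Quotient.mk I))
    have h3 := Ideal.comap_isMaximal_of_surjective (Ideal.Quotient.mk I)
      Ideal.Quotient.mk_surjective (K := P.map (Ideal.Quotient.mk I))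
    rwa [Ideal.comap_map_of_surjective' _ Ideal.Quotient.mk_surjective, Ideal.mk_ker,
      sup_eq_left.2 hIP] at h3
  have hne : (irrelevant 𝒮).toIdeal ≠ ⊤ := by
    rw [Ideal.ne_top_iff_one, mem_irrelevant_iff_projZ, projZ_of_mem 𝒮]
    · exact one_ne_zero
    · rw [intPiece_of_nonneg _ le_rfl]; exact SetLike.one_mem_graded 𝒮
  have hrad : (irrelevant 𝒮).toIdeal ≤ I.radical := by
    rw [← Ideal.sInf_minimalPrimes]
    refine le_sInf fun P hP => ?_
    have hle := le_irrelevant_of_isHomogeneous 𝒮 h𝒮 (isHomogeneous_of_mem_minimalPrimes 𝒮 hI hP)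
      hP.1.1.ne_top
    exact ((hmax P hP.1.1 hP.1.2).eq_of_le hne hle).ge
  obtain ⟨N, hN⟩ := I.exists_radical_pow_le_of_fg (IsNoetherian.noetherian _)
  exact ⟨N, (Ideal.pow_right_mono hrad N).trans hN⟩

/-- Elements of large degree lie in large powers of the irrelevant ideal. -/
theorem exists_piece_le_irrelevant_pow [IsNoetherianRing S] :
    ∃ δ : ℕ, 0 < δ ∧ ∀ (j M : ℕ), δ * j ≤ M → ∀ x ∈ 𝒮 M, x ∈ (irrelevant 𝒮).toIdeal ^ j := by
  obtain ⟨l, f, c, hf, hspan⟩ := (irrelevant 𝒮).isHomogeneous.exists_homogeneous_span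
  set δ : ℕ := (∑ i, (c i).natAbs) + 1 with hδ
  have hcδ : ∀ i, c i ≤ δ := fun i => by
    have : (c i).natAbs ≤ ∑ i, (c i).natAbs :=
      Finset.single_le_sum (f := fun i => (c i).natAbs) (fun _ _ => Nat.zero_le _)
        (Finset.mem_univ i)
    omega
  refine ⟨δ, Nat.succ_pos _, fun j => ?_⟩
  induction j with
  | zero => intro M _ x _; rw [pow_zero, Ideal.one_eq_top]; trivial
  | succ j ih =>
    intro M hM x hx
    rw [← intPiece_natCast 𝒮] at hx
    have hx0 : x ∈ (irrelevant 𝒮).toIdeal := by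
      rw [mem_irrelevant_iff_projZ]
      refine projZ_of_mem_ne 𝒮 hx ?_
      have : 0 < δ * (j + 1) := by positivity
      omega
    rw [← hspan] at hx0
    obtain ⟨a, ha⟩ := (Submodule.mem_span_range_iff_exists_fun S).1 hx0
    rw [← projZ_of_mem 𝒮 hx, ← ha, map_sum]
    refine Submodule.sum_mem _ fun i _ => ?_
    rw [smul_eq_mul, mul_comm, projZ_mul 𝒮 (hf i), mul_comm, pow_succ]
    refine Ideal.mul_mem_mul ?_ (hspan.le (Ideal.subset_span ⟨i, rfl⟩))
    have h1 : (δ * j : ℤ) ≤ M - c i := by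
      have h2 := hcδ i
      have h3 : ((δ * (j + 1) : ℕ) : ℤ) ≤ M := by exact_mod_cast hM
      push_cast at h3
      linarith
    have h4 := projZ_mem 𝒮 (M - c i) (a i)
    have h5 : (0 : ℤ) ≤ M - c i := le_trans (by positivity) h1
    rw [intPiece_of_nonneg _ h5] at h4
    refine ih _ ?_ _ h4
    have h6 : ((δ * j : ℕ) : ℤ) ≤ M - c i := by exact_mod_cast h1
    omega

theorem span_image_pow_le {ι : Type*} [DecidableEq ι] (s : Finset ι) (f : ι → S) (Q : ℕ) :
    Ideal.span (f '' s) ^ (s.card * Q + 1) ≤ Ideal.span ((fun i => f i ^ Q) '' s) := by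
  induction s using Finset.induction_on with
  | empty => simp
  | insert i s hi ih =>
    rw [Finset.card_insert_of_notMem hi, Finset.coe_insert, Set.image_insert_eq,
      Set.image_insert_eq, Ideal.span_insert, Ideal.span_insert,
      show (s.card + 1) * Q + 1 = Q + (s.card * Q + 1) by ring]
    refine Ideal.sup_pow_add_le_pow_sup_pow.trans (sup_le_sup ?_ ih)
    rw [Ideal.span_singleton_pow]

theorem span_range_pow_le {l : ℕ} (f : Fin l → S) (Q : ℕ) :
    Ideal.span (Set.range f) ^ (l * Q + 1) ≤ Ideal.span (Set.range fun i => f i ^ Q) := by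
  have := span_image_pow_le (Finset.univ : Finset (Fin l)) f Q
  simpa using this

/-- The degrees in which `S/I^[q]` does not vanish are bounded by a multiple of `q`. -/
theorem exists_piece_le_frobeniusPower (h𝒮 : 𝒮 0 = 1) [Nontrivial S] [IsNoetherianRing S] (p : ℕ)
    [ExpChar S p] (hp : 0 < p) {I : Ideal S} (hI : I.IsHomogeneous 𝒮)
    (hfin : HasFiniteColength I) :
    ∃ L : ℕ, ∀ n M, L * p ^ n ≤ M → ∀ x ∈ 𝒮 M, x ∈ frobeniusPower p n I := by
  obtain ⟨N, hN⟩ := exists_irrelevant_pow_le 𝒮 h𝒮 hI hfin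
  obtain ⟨δ, -, hδ⟩ := exists_piece_le_irrelevant_pow 𝒮
  obtain ⟨l, f, c, hf, hspan⟩ := hI.exists_homogeneous_span
  refine ⟨δ * (N * (l + 1)), fun n M hM x hx => ?_⟩
  have hq : 1 ≤ p ^ n := Nat.one_le_pow _ _ hp
  have h1 := hδ (N * (l * p ^ n + 1)) M (by
    refine le_trans ?_ hM
    rw [mul_assoc, mul_assoc]
    refine Nat.mul_le_mul_left _ (Nat.mul_le_mul_left _ ?_)
    rw [add_mul, one_mul]
    omega) x hx
  rw [pow_mul] at h1
  have h2 := Ideal.pow_right_mono hN _ h1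
  rw [← hspan] at h2 ⊢
  rw [frobeniusPower_span_range]
  exact span_range_pow_le f _ h2

/-- The Frobenius power `I^[q]` of a proper homogeneous ideal has no elements of degree less
than `q`. -/
theorem idealHilbertFn_frobeniusPower_eq_zero (h𝒮 : 𝒮 0 = 1) [IsNoetherianRing S] (p : ℕ)
    [ExpChar S p] (hp : 0 < p) {I : Ideal S} (hI : I.IsHomogeneous 𝒮) (hne : I ≠ ⊤) {n : ℕ} {t : ℤ}
    (ht : t < (p ^ n : ℕ)) : idealHilbertFn 𝒮 (frobeniusPower p n I) t = 0 := by
  obtain ⟨l, f, c, hf, hspan⟩ := hI.exists_homogeneous_span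
  have hbot : (frobeniusPower p n I).restrictScalars k ⊓ intPiece 𝒮 t = ⊥ := by
    rw [_root_.eq_bot_iff]
    rintro x ⟨hx, hxt⟩
    have hx' : x ∈ frobeniusPower p n I := hx
    rw [← hspan, frobeniusPower_span_range] at hx'
    obtain ⟨a, ha⟩ := (Submodule.mem_span_range_iff_exists_fun S).1 hx'
    rw [Submodule.mem_bot, ← projZ_of_mem 𝒮 hxt, ← ha, map_sum]
    refine Finset.sum_eq_zero fun i _ => ?_
    rw [smul_eq_mul, mul_comm, projZ_mul 𝒮 (pow_mem_intPiece 𝒮 (hf i) _)]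
    have hq : 1 ≤ p ^ n := Nat.one_le_pow _ _ hp
    rcases lt_or_ge 0 (c i) with h | h
    · rw [projZ_of_neg, mul_zero]
      have : ((p ^ n : ℕ) : ℤ) * 1 ≤ (p ^ n : ℕ) * c i := by gcongr; omega
      linarith
    · have h0 : f i = 0 := by
        have hi := hf i
        rcases h.lt_or_eq with h | h
        · rwa [intPiece_of_neg _ h, Submodule.mem_bot] at hi
        · rw [h] at hi
          have h1 := le_irrelevant_of_isHomogeneous 𝒮 h𝒮 hI hne
            (hspan.le (Ideal.subset_span ⟨i, rfl⟩))
          rwa [mem_irrelevant_iff_projZ, projZ_of_mem 𝒮 hi] at h1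
      rw [h0, zero_pow (by omega), zero_mul]
  rw [idealHilbertFn, hbot, finrank_bot]

omit [GradedAlgebra 𝒮] in
theorem quotientLength_add_idealHilbertFn [∀ n, Module.Finite k (𝒮 n)] (𝔞 : Ideal S) (n : ℕ) :
    quotientLength 𝒮 𝔞 n + idealHilbertFn 𝒮 𝔞 n = hilbertFn 𝒮 n := by
  have h := ((Ideal.Quotient.mkₐ k 𝔞).toLinearMap.domRestrict (𝒮 n)).finrank_range_add_finrank_ker
  rw [LinearMap.range_domRestrict] at h
  rw [quotientLength, hilbertFn_natCast, ← h, idealHilbertFn, intPiece_natCast]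
  congr 1
  rw [← Submodule.finrank_map_subtype_eq (𝒮 n)]
  have hker : 𝔞.restrictScalars k ⊓ 𝒮 n = (LinearMap.ker
      ((Ideal.Quotient.mkₐ k 𝔞).toLinearMap.domRestrict (𝒮 n))).map (𝒮 n).subtype := ?_
  · rw [hker]
  ext x
  constructor
  · rintro ⟨h1, h2⟩
    exact ⟨⟨x, h2⟩, (Ideal.Quotient.eq_zero_iff_mem).2 h1, rfl⟩
  · rintro ⟨⟨y, hy⟩, h1, rfl⟩
    exact ⟨(Ideal.Quotient.eq_zero_iff_mem).1 h1, hy⟩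

omit [GradedAlgebra 𝒮] in
theorem quotientLength_eq_zero_of_forall_mem {𝔞 : Ideal S} {n : ℕ} (h : ∀ x ∈ 𝒮 n, x ∈ 𝔞) :
    quotientLength 𝒮 𝔞 n = 0 := by
  have : (𝒮 n).map (Ideal.Quotient.mkₐ k 𝔞).toLinearMap = ⊥ := by
    rw [_root_.eq_bot_iff]
    rintro _ ⟨x, hx, rfl⟩
    exact (Ideal.Quotient.eq_zero_iff_mem).2 (h x hx)
  rw [quotientLength, this, finrank_bot]

omit [GradedAlgebra 𝒮] in
/-- In the sums that define the step functions, only the first term can be different from zero. -/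
theorem hkStep_eq (p d : ℕ) (I : Ideal S) (hm : 0 < degreeGcd 𝒮) (n : ℕ) (x : ℝ) :
    hkStep p d 𝒮 I n x = (quotientLength 𝒮 (frobeniusPower p n I)
      (⌊x * (p : ℝ) ^ n⌋₊ * degreeGcd 𝒮) : ℝ) / ((p : ℝ) ^ n) ^ (d - 1) := by
  rw [hkStep, Finset.sum_eq_single_of_mem 0 (Finset.mem_range.2 hm), add_zero]
  intro i hi hi0
  rw [Nat.cast_eq_zero]
  refine quotientLength_eq_zero_of_forall_mem 𝒮 fun y hy => ?_
  have hlt := Finset.mem_range.1 hi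
  have hbot : 𝒮 (⌊x * (p : ℝ) ^ n⌋₊ * degreeGcd 𝒮 + i) = ⊥ := by
    by_contra hne
    have h1 : degreeGcd 𝒮 ∣ _ := Nat.setGcd_dvd_of_mem (s := {n | 𝒮 n ≠ ⊥}) hne
    rw [Nat.dvd_add_right (dvd_mul_left _ _)] at h1
    exact hi0 (Nat.eq_zero_of_dvd_of_lt h1 hlt)
  rw [hbot, Submodule.mem_bot] at hy
  rw [hy]
  exact zero_mem _

end FiniteColength

section Density

open Asymptotics

variable {k S : Type*} [Field k] [CommRing S] [Algebra k S] {𝒮 : ℕ → Submodule k S}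
  [GradedAlgebra 𝒮] {I : Ideal S} {d : ℕ}

theorem IsGradedPair.degreeGcd_pos (h : IsGradedPair 𝒮 I d) (hd : 1 < d) : 0 < degreeGcd 𝒮 := by
  have := h.isDomain
  have := h.finiteType
  obtain ⟨e, rfl⟩ : ∃ e, d = e + 1 := ⟨d - 1, by omega⟩
  exact (exists_hasGrowth 𝒮 h.degree_zero (by omega) h.dim_eq).2.1

theorem IsGradedPair.finite_piece (h : IsGradedPair 𝒮 I d) (hd : 1 < d) (n : ℕ) :
    Module.Finite k (𝒮 n) := by
  have := h.isDomain
  have := h.finiteType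
  obtain ⟨e, rfl⟩ : ∃ e, d = e + 1 := ⟨d - 1, by omega⟩
  exact (exists_hasGrowth 𝒮 h.degree_zero (by omega) h.dim_eq).1 n

variable {R : Type*} [CommRing R] [Algebra k R] [Algebra S R] [IsScalarTower k S R]
  {ℛ : ℕ → Submodule k R} [GradedAlgebra ℛ] [Module.Finite S R]

omit [GradedAlgebra ℛ] in
theorem GradedFreeResolution.continuous_bettiSum {J : Ideal R} (F : GradedFreeResolution ℛ J)
    (d m : ℕ) : Continuous (F.bettiSum d m) := by
  have : F.bettiSum d m = fun x => x ^ (d - 1) - F.altSum fun j =>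
      (max (x - (j : ℝ) / (m : ℝ)) 0) ^ (d - 1) := funext fun x => F.bettiSum_eq d m x
  rw [this]
  simp only [altSum]
  fun_prop

/-! ### The density function in terms of a resolution -/

/-- The density function, if the Hilbert functions of the Frobenius powers of `IR` are given by the
degrees of a resolution of `IR`. -/
theorem IsGradedPair.exists_density (h : IsGradedPair 𝒮 I d) (hd : 1 < d) (p : ℕ) [Fact p.Prime]
    [CharP k p] (hinj : Function.Injective (algebraMap S R))
    (hdeg : ∀ n, ∀ s ∈ 𝒮 n, algebraMap S R s ∈ ℛ n)
    (G : GradedFreeResolution ℛ (I.map (algebraMap S R)))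
    (hG : ∀ n t, (idealHilbertFn ℛ (frobeniusPower p n (I.map (algebraMap S R))) t : ℤ) =
      G.altSum fun j => (hilbertFn ℛ (t - (p ^ n : ℕ) * j) : ℤ)) :
    ∃ c : ℝ, 0 < c ∧
      Tendsto (fun m : ℕ => (Module.finrank k (𝒮 (degreeGcd 𝒮 * m)) : ℝ) / (m : ℝ) ^ (d - 1))
        atTop (𝓝 c) ∧
      TendstoUniformlyOn (hkSeq p d 𝒮 I) (fun x => c * G.bettiSum d (degreeGcd 𝒮) x) atTop
        (Set.Ici 0) ∧
      ∀ x : ℝ, 0 ≤ x → x < 1 / degreeGcd 𝒮 → c * G.bettiSum d (degreeGcd 𝒮) x = c * x ^ (d - 1) := by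
  have hp : 1 < p := (Fact.out : p.Prime).one_lt
  have hp' : 0 < p := by omega
  have := h.isDomain
  have := h.finiteType
  have hnoeth : IsNoetherianRing S := Algebra.FiniteType.isNoetherianRing k S
  have hnt : Nontrivial R := hinj.nontrivial
  have : CharP S p := charP_of_injective_algebraMap (algebraMap k S).injective p
  have : CharP R p := charP_of_injective_algebraMap (algebraMap k R).injective p
  have : ExpChar S p := ExpChar.prime Fact.out
  have : ExpChar R p := ExpChar.prime Fact.out
  obtain ⟨e, rfl⟩ : ∃ e, d = e + 1 := ⟨d - 1, by omega⟩
  have he : 0 < e := by omega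
  obtain ⟨hfin, hm, γ, hγ, hgrow⟩ := exists_hasGrowth 𝒮 h.degree_zero he h.dim_eq
  have hRfin : ∀ n, Module.Finite k (ℛ n) := finite_piece_of_finite hdeg
  rw [show e + 1 - 1 = e by omega]
  set m := degreeGcd 𝒮 with hmdef
  obtain ⟨E⟩ := HomogeneousFrame.nonempty hdeg
  obtain ⟨l, f, c, hf, hspan⟩ := h.isHomogeneous.exists_homogeneous_span
  have hideal := E.isBigO_idealHilbertFn hp' hdeg hinj hgrow hm f c hf hspan G hG
  rw [← hmdef] at hideal
  have hmR : (0 : ℝ) < m := by exact_mod_cast hm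
  have hc : 0 < γ * (m : ℝ) ^ e := by positivity
  set g : ℝ → ℝ := fun x => G.altSum fun j => max (x - (j : ℝ) / m) 0 ^ e with hg
  have hbetti : ∀ x, G.bettiSum (e + 1) m x = x ^ e - g x := fun x => by
    rw [G.bettiSum_eq]; rfl
  have hgcont : Continuous g := by
    have : g = fun x => x ^ e - G.bettiSum (e + 1) m x := by
      funext x; rw [hbetti]; ring
    rw [this]
    exact (continuous_pow e).sub (G.continuous_bettiSum _ _)
  -- the truncated powers, scaled
  have hscale : ∀ (n M : ℕ), γ * G.altSum (fun j =>
      max (((m : ℤ) * (M : ℤ) - (p ^ n : ℕ) * j : ℤ) : ℝ) 0 ^ e) =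
      ((p : ℝ) ^ n) ^ e * (γ * (m : ℝ) ^ e * g (M / (p : ℝ) ^ n)) := by
    intro n M
    have hq : (0 : ℝ) < (p : ℝ) ^ n := by positivity
    rw [hg, ← mul_assoc, ← G.altSum_const_mul, ← G.altSum_const_mul]
    congr 1
    funext j
    have : (((m : ℤ) * (M : ℤ) - (p ^ n : ℕ) * j : ℤ) : ℝ) =
        ((p : ℝ) ^ n * m) * (M / (p : ℝ) ^ n - j / m) := by
      push_cast
      field_simp
    rw [this, ← mul_zero ((p : ℝ) ^ n * m), ← mul_max_of_nonneg _ _ (by positivity), mul_pow,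
      mul_pow]
    simp only [mul_zero]
    ring
  obtain ⟨C₁, hC₁0, hC₁⟩ := hideal.exists_nonneg
  have hC₁' : ∀ n M : ℕ, |(idealHilbertFn 𝒮 (frobeniusPower p n I) (m * M : ℤ) : ℝ) -
      ((p : ℝ) ^ n) ^ e * (γ * (m : ℝ) ^ e * g (M / (p : ℝ) ^ n))| ≤
      C₁ * ((M : ℝ) + (p : ℝ) ^ n) ^ (e - 1) := by
    intro n M
    have h1 := (isBigOWith_top.1 hC₁) (n, (M : ℤ))
    simp only at h1
    rw [hscale, Real.norm_eq_abs, Real.norm_of_nonneg (pow_nonneg (errorBound_pos hp' _).le _),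
      errorBound, Int.cast_natCast, abs_of_nonneg (Nat.cast_nonneg M : (0 : ℝ) ≤ M)] at h1
    exact h1
  obtain ⟨C₂, hC₂0, hC₂⟩ := (show HasGrowth _ _ _ _ from hgrow).exists_nonneg
  have hC₂' : ∀ n M : ℕ, |(hilbertFn 𝒮 (m * M : ℤ) : ℝ) -
      ((p : ℝ) ^ n) ^ e * (γ * (m : ℝ) ^ e * (M / (p : ℝ) ^ n) ^ e)| ≤
      (C₂ * (m : ℝ) ^ (e - 1)) * ((M : ℝ) + (p : ℝ) ^ n) ^ (e - 1) := by
    intro n M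
    have hq : (0 : ℝ) < (p : ℝ) ^ n := by positivity
    have hq1 : (1 : ℝ) ≤ (p : ℝ) ^ n := one_le_pow₀ (by exact_mod_cast hp')
    have hm1 : (1 : ℝ) ≤ m := by exact_mod_cast hm
    have h1 := (isBigOWith_top.1 hC₂) (m * M : ℤ)
    have h0 : (((m : ℤ) * (M : ℤ) : ℤ) : ℝ) = m * M := by push_cast; ring
    rw [if_pos (dvd_mul_right _ _), h0, max_eq_left (by positivity), abs_of_nonneg (by positivity),
      Real.norm_of_nonneg (by positivity : (0 : ℝ) ≤ ((m : ℝ) * M + 1) ^ (e - 1)),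
      Real.norm_eq_abs] at h1
    have h2 : ((p : ℝ) ^ n) ^ e * (γ * (m : ℝ) ^ e * (M / (p : ℝ) ^ n) ^ e) =
        γ * ((m : ℝ) * M) ^ e := by
      rw [div_pow, mul_pow]; field_simp
    rw [h2]
    refine h1.trans ?_
    rw [mul_assoc, ← mul_pow]
    refine mul_le_mul_of_nonneg_left (pow_le_pow_left₀ (by positivity) ?_ _) hC₂0
    nlinarith
  refine ⟨γ * (m : ℝ) ^ e, hc, ?_, ?_, ?_⟩
  · have hlim := tendsto_div_pow_of_isBigO (f := fun j => (hilbertFn 𝒮 j : ℝ)) he (κ := γ) m 0 (by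
      have hτ : (fun j : ℤ => ((0 + m * j : ℤ) : ℝ)) =O[⊤] fun j : ℤ => |(j : ℝ)| + 1 := by
        simp only [zero_add, Int.cast_mul]
        exact isBigO_self_abs_add_one.const_mul_left _
      refine (isBigO_comp_int hgrow hτ isBigO_one_abs_add_one).congr_left fun j => ?_
      rw [zero_add, if_pos (dvd_mul_right _ _)])
    refine hlim.congr fun n => ?_
    rw [zero_add, ← Nat.cast_mul, hilbertFn_natCast]
  · obtain ⟨L, hL⟩ := exists_piece_le_frobeniusPower 𝒮 h.degree_zero p hp' h.isHomogeneous
      h.finite_colength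
    have hconv := tendstoUniformlyOn_interpolation (p := p) (e := e) hp he
      (u := fun n M => (quotientLength 𝒮 (frobeniusPower p n I) (M * m) : ℝ))
      (g := fun x => γ * (m : ℝ) ^ e * G.bettiSum (e + 1) m x)
      (continuous_const.mul (G.continuous_bettiSum _ _)) (C := C₂ * (m : ℝ) ^ (e - 1) + C₁)
      (by positivity) (fun n M => ?_) (L₀ := L) (fun n M hM => ?_)
    · refine hconv.congr (Eventually.of_forall fun n x _ => ?_)
      simp only [hkSeq, hkStep_eq 𝒮 p (e + 1) I hm, show e + 1 - 1 = e by omega, ← hmdef]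
    · have h1 := quotientLength_add_idealHilbertFn 𝒮 (frobeniusPower p n I) (M * m)
      have h2 : (quotientLength 𝒮 (frobeniusPower p n I) (M * m) : ℝ) =
          hilbertFn 𝒮 (m * M : ℤ) - idealHilbertFn 𝒮 (frobeniusPower p n I) (m * M : ℤ) := by
        rw [eq_sub_iff_add_eq, mul_comm (m : ℤ)]
        exact_mod_cast h1
      have h3 := abs_le.1 (hC₁' n M)
      have h4 := abs_le.1 (hC₂' n M)
      rw [h2, hbetti, abs_le]
      constructor <;> nlinarith [h3.1, h3.2, h4.1, h4.2]
    · rw [Nat.cast_eq_zero]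
      refine quotientLength_eq_zero_of_forall_mem 𝒮 (hL n _ ?_)
      nlinarith
  · intro x hx0 hx
    have hqtop : Tendsto (fun n : ℕ => (p : ℝ) ^ n) atTop atTop :=
      tendsto_pow_atTop_atTop_of_one_lt (by exact_mod_cast hp)
    have h1 : Tendsto (fun n : ℕ => (⌊x * (p : ℝ) ^ n⌋₊ : ℝ) / (p : ℝ) ^ n) atTop (𝓝 x) :=
      (tendsto_nat_floor_mul_div_atTop hx0).comp hqtop
    have h2 := (hgcont.tendsto x).comp h1
    have h3 : Tendsto (fun n : ℕ => g (⌊x * (p : ℝ) ^ n⌋₊ / (p : ℝ) ^ n)) atTop (𝓝 0) := by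
      rw [tendsto_zero_iff_norm_tendsto_zero]
      refine squeeze_zero (fun _ => norm_nonneg _)
        (g := fun n : ℕ => C₁ * (x + 1) ^ (e - 1) / (γ * (m : ℝ) ^ e) / (p : ℝ) ^ n) (fun n => ?_)
        (tendsto_const_nhds.div_atTop hqtop)
      have hq : (0 : ℝ) < (p : ℝ) ^ n := by positivity
      have hfl : (⌊x * (p : ℝ) ^ n⌋₊ : ℝ) ≤ x * (p : ℝ) ^ n := Nat.floor_le (by positivity)
      have hsmall : (m : ℤ) * (⌊x * (p : ℝ) ^ n⌋₊ : ℤ) < (p ^ n : ℕ) := by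
        have : (m : ℝ) * ⌊x * (p : ℝ) ^ n⌋₊ < (p : ℝ) ^ n := by
          rw [lt_div_iff₀ hmR] at hx
          calc (m : ℝ) * ⌊x * (p : ℝ) ^ n⌋₊ ≤ m * (x * (p : ℝ) ^ n) := by gcongr
            _ = (x * m) * (p : ℝ) ^ n := by ring
            _ < 1 * (p : ℝ) ^ n := by gcongr
            _ = _ := one_mul _
        exact_mod_cast this
      have h5 := hC₁' n ⌊x * (p : ℝ) ^ n⌋₊
      rw [idealHilbertFn_frobeniusPower_eq_zero 𝒮 h.degree_zero p hp' h.isHomogeneous h.ne_top hsmall,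
        Nat.cast_zero, zero_sub, abs_neg, abs_mul, abs_mul, abs_of_pos hc,
        abs_of_pos (pow_pos hq e)] at h5
      rw [Real.norm_eq_abs, div_div, le_div_iff₀ (by positivity)]
      have h6 : C₁ * ((⌊x * (p : ℝ) ^ n⌋₊ : ℝ) + (p : ℝ) ^ n) ^ (e - 1) ≤
          C₁ * ((x + 1) ^ (e - 1) * ((p : ℝ) ^ n) ^ (e - 1)) := by
        rw [← mul_pow]
        gcongr
        linarith
      have h7 := h5.trans h6
      have h8 : ((p : ℝ) ^ n) ^ e = ((p : ℝ) ^ n) ^ (e - 1) * (p : ℝ) ^ n := by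
        rw [← pow_succ, Nat.sub_add_cancel he]
      have h9 : (0 : ℝ) < ((p : ℝ) ^ n) ^ (e - 1) := by positivity
      rw [h8] at h7
      refine le_of_mul_le_mul_left ?_ h9
      linarith
    have h4 := tendsto_nhds_unique h2 h3
    rw [hbetti, h4, sub_zero]

end Density

/-! ### The density function when the degree zero part is local -/

section DegreeZero

variable {k R : Type*} [Field k] [CommRing R] [Algebra k R] (ℛ : ℕ → Submodule k R)
  [GradedAlgebra ℛ]

theorem isArtinianRing_zero [Module.Finite k (ℛ 0)] : IsArtinianRing (ℛ 0) := by
  have : IsScalarTower k (ℛ 0) (ℛ 0) :=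
    ⟨fun a x y => Subtype.ext (smul_mul_assoc a (x : R) (y : R))⟩
  exact IsArtinianRing.of_finite k (ℛ 0)

end DegreeZero

section Extension

variable {k S R : Type*} [Field k] [CommRing S] [Algebra k S] {𝒮 : ℕ → Submodule k S}
  [GradedAlgebra 𝒮] {I : Ideal S} {d : ℕ} [CommRing R] [Algebra k R] [Algebra S R]
  [IsScalarTower k S R] {ℛ : ℕ → Submodule k R} [GradedAlgebra ℛ]

omit [IsScalarTower k S R] in
theorem Ideal.IsHomogeneous.map_algebraMap (hI : I.IsHomogeneous 𝒮)
    (hdeg : ∀ n, ∀ s ∈ 𝒮 n, algebraMap S R s ∈ ℛ n) :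
    (I.map (algebraMap S R)).IsHomogeneous ℛ := by
  obtain ⟨T, hT⟩ := (Ideal.IsHomogeneous.iff_exists 𝒮 I).1 hI
  rw [hT, Ideal.map_span]
  refine Ideal.homogeneous_span ℛ _ ?_
  rintro _ ⟨_, ⟨x, -, rfl⟩, rfl⟩
  obtain ⟨n, hn⟩ := x.2
  exact ⟨n, hdeg n _ hn⟩

omit [IsScalarTower k S R] in
/-- If `R_0` is local, every prime that contains the extension to `R` of an ideal of finite colength
contains the homogeneous maximal ideal. -/
theorem IsGradedPair.homogeneousMaximalIdeal_le [Module.Finite S R] (h : IsGradedPair 𝒮 I d)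
    (hdeg : ∀ n, ∀ s ∈ 𝒮 n, algebraMap S R s ∈ ℛ n) [∀ n, Module.Finite k (ℛ n)]
    [IsLocalRing (ℛ 0)] (P : Ideal R) (hP : P.IsPrime) (hIP : I.map (algebraMap S R) ≤ P) :
    homogeneousMaximalIdeal ℛ ≤ P := by
  have := h.isDomain
  have := h.finiteType
  have hnoeth : IsNoetherianRing S := Algebra.FiniteType.isNoetherianRing k S
  obtain ⟨N, hN⟩ := exists_irrelevant_pow_le 𝒮 h.degree_zero h.isHomogeneous h.finite_colength
  have h1 : ∀ x, projZ 𝒮 0 x = 0 → algebraMap S R x ∈ P := by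
    intro x hx
    have h2 := hN (Ideal.pow_mem_pow ((mem_irrelevant_iff_projZ 𝒮).2 hx) N)
    have h3 := hIP (Ideal.mem_map_of_mem (algebraMap S R) h2)
    rw [map_pow] at h3
    exact hP.mem_of_pow_mem N h3
  obtain ⟨m, v, b, hv, hspan⟩ := exists_homogeneous_generators (A := S) ℛ
  set B : ℕ := (∑ i, (b i).natAbs) + 1 with hB
  have hbB : ∀ i, b i < B := fun i => by
    have : (b i).natAbs ≤ ∑ i, (b i).natAbs :=
      Finset.single_le_sum (f := fun i => (b i).natAbs) (fun _ _ => Nat.zero_le _)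
        (Finset.mem_univ i)
    omega
  -- homogeneous elements of positive degree
  have hpos : ∀ (j : ℕ), 0 < j → ∀ y ∈ ℛ j, y ∈ P := by
    intro j hj y hy
    rw [← intPiece_natCast ℛ] at hy
    have hyB := pow_mem_intPiece ℛ hy B
    refine hP.mem_of_pow_mem B ?_
    have hx : y ^ B ∈ Submodule.span S (Set.range v) := by rw [hspan]; trivial
    obtain ⟨c, hc⟩ := (Submodule.mem_span_range_iff_exists_fun S).1 hx
    rw [← projZ_of_mem ℛ hyB, ← hc, map_sum]
    refine Submodule.sum_mem _ fun i _ => ?_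
    rw [projZ_smul hdeg (hv i), Algebra.smul_def]
    refine Ideal.mul_mem_right _ _ (h1 _ (projZ_of_mem_ne 𝒮 (projZ_mem 𝒮 _ _) ?_))
    have h2 := hbB i
    have h3 : (B : ℤ) * 1 ≤ B * j := by gcongr; omega
    omega
  -- the degree zero part is Artinian
  have hart : IsArtinianRing (ℛ 0) := isArtinianRing_zero ℛ
  let φ : ℛ 0 →+* R := (SetLike.GradeZero.subring ℛ).subtype
  have hPφ : (P.comap φ).IsPrime := Ideal.IsPrime.comap φ
  have hmax : P.comap φ = IsLocalRing.maximalIdeal (ℛ 0) :=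
    IsLocalRing.eq_maximalIdeal (IsArtinianRing.isMaximal_of_isPrime (P.comap φ))
  intro x hx
  have hx0 : projZ ℛ 0 x ∈ P := by
    rw [projZ_zero_eq]
    have : GradedRing.projZeroRingHom' ℛ x ∈ P.comap φ := by rw [hmax]; exact hx
    exact this
  obtain ⟨s, hs⟩ := exists_sum_projZ ℛ x
  rw [← hs s subset_rfl]
  refine Submodule.sum_mem _ fun j _ => ?_
  rcases lt_trichotomy j 0 with hj | rfl | hj
  · rw [projZ_of_neg ℛ hj]; exact zero_mem _
  · exact hx0
  · have h4 := projZ_mem ℛ j x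
    rw [intPiece_of_nonneg ℛ hj.le] at h4
    exact hpos _ (by omega) _ h4

omit [IsScalarTower k S R] in
theorem IsGradedPair.map_le_homogeneousMaximalIdeal (h : IsGradedPair 𝒮 I d)
    (hdeg : ∀ n, ∀ s ∈ 𝒮 n, algebraMap S R s ∈ ℛ n) [IsLocalRing (ℛ 0)] :
    I.map (algebraMap S R) ≤ homogeneousMaximalIdeal ℛ := by
  rw [Ideal.map_le_iff_le_comap]
  intro x hx
  have h1 := le_irrelevant_of_isHomogeneous 𝒮 h.degree_zero h.isHomogeneous h.ne_top hx
  rw [mem_irrelevant_iff_projZ] at h1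
  have h2 : projZ ℛ 0 (algebraMap S R x) = 0 := by rw [projZ_algebraMap 𝒮 ℛ hdeg, h1, map_zero]
  rw [projZ_zero_eq] at h2
  have h3 : GradedRing.projZeroRingHom' ℛ (algebraMap S R x) = 0 := Subtype.ext h2
  rw [Ideal.mem_comap, homogeneousMaximalIdeal, Ideal.mem_comap, h3]
  exact zero_mem _

/-- The density function in terms of a finite minimal graded free resolution. -/
theorem IsGradedPair.exists_density_of_minimal [Module.Finite S R] (h : IsGradedPair 𝒮 I d)
    (hd : 1 < d) (p : ℕ) [Fact p.Prime] [CharP k p] (hinj : Function.Injective (algebraMap S R))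
    (hdeg : ∀ n, ∀ s ∈ 𝒮 n, algebraMap S R s ∈ ℛ n) [IsLocalRing (ℛ 0)]
    (G : GradedFreeResolution ℛ (I.map (algebraMap S R)))
    (hG : ∀ i a b, G.d i a b ∈ homogeneousMaximalIdeal ℛ) :
    ∃ c : ℝ, 0 < c ∧
      Tendsto (fun m : ℕ => (Module.finrank k (𝒮 (degreeGcd 𝒮 * m)) : ℝ) / (m : ℝ) ^ (d - 1))
        atTop (𝓝 c) ∧
      TendstoUniformlyOn (hkSeq p d 𝒮 I) (fun x => c * G.bettiSum d (degreeGcd 𝒮) x) atTop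
        (Set.Ici 0) ∧
      ∀ x : ℝ, 0 ≤ x → x < 1 / degreeGcd 𝒮 →
        c * G.bettiSum d (degreeGcd 𝒮) x = c * x ^ (d - 1) := by
  have := h.isDomain
  have := h.finiteType
  have hnoeth : IsNoetherianRing S := Algebra.FiniteType.isNoetherianRing k S
  have hnoethR : IsNoetherianRing R := IsNoetherianRing.of_finite S R
  have hnt : Nontrivial R := hinj.nontrivial
  have : CharP R p := charP_of_injective_algebraMap (algebraMap k R).injective p
  have : ExpChar R p := ExpChar.prime Fact.out
  have := fun n => h.finite_piece hd n
  have hRfin : ∀ n, Module.Finite k (ℛ n) := finite_piece_of_finite hdeg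
  exact h.exists_density hd p hinj hdeg G fun n t =>
    G.idealHilbertFn_frobeniusPower p (homogeneousMaximalIdeal ℛ)
      (fun P hP hIP => h.homogeneousMaximalIdeal_le hdeg P hP hIP)
      (h.map_le_homogeneousMaximalIdeal hdeg) hG n t

omit [GradedAlgebra 𝒮] in
/-- The limit formula for the density function implies all its claimed properties. -/
theorem density_properties {R' : Type*} [CommRing R'] [Algebra k R'] {ℛ' : ℕ → Submodule k R'}
    {J : Ideal R'} (hd : 1 < d) (hm : 0 < degreeGcd 𝒮) {p : ℕ} {c : ℝ} (hc : 0 < c)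
    (G : GradedFreeResolution ℛ' J)
    (hunif : TendstoUniformlyOn (hkSeq p d 𝒮 I) (fun x => c * G.bettiSum d (degreeGcd 𝒮) x) atTop
      (Set.Ici 0))
    (hsmall : ∀ x : ℝ, 0 ≤ x → x < 1 / degreeGcd 𝒮 →
      c * G.bettiSum d (degreeGcd 𝒮) x = c * x ^ (d - 1)) :
    (∀ x, 0 ≤ x → hkDensity p d 𝒮 I x = c * G.bettiSum d (degreeGcd 𝒮) x) ∧
      TendstoUniformlyOn (hkSeq p d 𝒮 I) (hkDensity p d 𝒮 I) atTop (Set.Ici 0) ∧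
      IsPiecewisePolynomialOfDegree (hkDensity p d 𝒮 I) (d - 1) := by
  have h1 : ∀ x, 0 ≤ x → hkDensity p d 𝒮 I x = c * G.bettiSum d (degreeGcd 𝒮) x := fun x hx =>
    (hunif.tendsto_at hx).limUnder_eq
  refine ⟨h1, hunif.congr_right fun x hx => (h1 x hx).symm, ?_⟩
  have hm' : (0 : ℝ) < degreeGcd 𝒮 := by exact_mod_cast hm
  refine G.isPiecewisePolynomial hd hc.ne' h1 (δ := 1 / degreeGcd 𝒮) (by positivity) ?_
  intro x hx hx'
  rw [h1 x hx, hsmall x hx hx']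

end Extension

section MinimalResolution

variable {k : Type*} [Field k] {R : Type u} [CommRing R] [Algebra k R] {ℛ : ℕ → Submodule k R}
  [GradedAlgebra ℛ]

theorem exists_minimal_resolution {R₁ : Type u} [CommRing R₁] [IsNoetherianRing R]
    [IsLocalRing (ℛ 0)] [Algebra R₁ R] (hsurj : Function.Surjective (algebraMap R₁ R))
    [Module.Projective R₁ R] {J : Ideal R} (hJ : J.IsHomogeneous ℛ)
    (hpd : CategoryTheory.projectiveDimension (ModuleCat.of R₁ (R ⧸ J)) < ⊤) :
    ∃ G : GradedFreeResolution ℛ J, ∀ i a b, G.d i a b ∈ homogeneousMaximalIdeal ℛ := by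
  obtain ⟨N, hN⟩ := J.exists_minimalComplex_rank_eq_zero hsurj hJ hpd
  exact ⟨J.minimalResolution hJ N hN, J.minimalResolution_d_mem hJ N hN⟩

theorem GradedFreeResolution.isMinimal_of_mem [IsLocalRing (ℛ 0)] {J : Ideal R}
    (G : GradedFreeResolution ℛ J) (hG : ∀ i a b, G.d i a b ∈ homogeneousMaximalIdeal ℛ) :
    G.IsMinimal := fun i a b => not_isUnit_of_mem_homogeneousMaximalIdeal ℛ (hG i a b)

end MinimalResolution

/-! ### Primitive idempotents of Artinian rings -/

/-- In an Artinian ring there is an idempotent `e` that is minimal for a property passing to one of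
the two parts of any decomposition; then `eE` is local. -/
theorem IsArtinianRing.exists_idempotent_isLocal {E : Type*} [CommRing E] [IsArtinianRing E]
    (Q : E → Prop) (h1 : Q 1)
    (hQ : ∀ e f, IsIdempotentElem e → IsIdempotentElem f → e * f = f → Q e → Q f ∨ Q (e - f)) :
    ∃ e, IsIdempotentElem e ∧ Q e ∧ ∀ a, ∃ b, a * b * e = e ∨ (1 - a) * b * e = e := by
  obtain ⟨J, ⟨e, he, hQe, rfl⟩, hmin⟩ := IsArtinian.set_has_minimal
    {J : Ideal E | ∃ e, IsIdempotentElem e ∧ Q e ∧ J = Ideal.span {e}}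
    ⟨_, 1, IsIdempotentElem.one, h1, rfl⟩
  have hmin' : ∀ f, IsIdempotentElem f → e * f = f → Q f → f = e := by
    intro f hf hef hQf
    have h2 : Ideal.span {f} ≤ Ideal.span {e} :=
      (Ideal.span_singleton_le_span_singleton).2 ⟨f, hef.symm⟩
    have h3 := hmin _ ⟨f, hf, hQf, rfl⟩
    have h4 : Ideal.span {e} ≤ Ideal.span {f} := by
      by_contra h
      exact h3 (lt_of_le_not_ge h2 h)
    obtain ⟨c, hc⟩ := Ideal.span_singleton_le_span_singleton.1 h4
    calc f = e * f := hef.symm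
      _ = f * f * c := by rw [hc]; ring
      _ = e := by rw [hf.eq, ← hc]
  have hprim : ∀ f, IsIdempotentElem f → e * f = f → f = e ∨ f = 0 := by
    intro f hf hef
    rcases hQ e f he hf hef hQe with h | h
    · exact Or.inl (hmin' f hf hef h)
    · have h2 : IsIdempotentElem (e - f) := by
        have : (e - f) * (e - f) = e * e - 2 * (e * f) + f * f := by ring
        rw [IsIdempotentElem, this, he.eq, hf.eq, hef]; ring
      have h3 := hmin' (e - f) h2 (by rw [mul_sub, he.eq, hef]) h
      exact Or.inr (by simpa using h3)
  refine ⟨e, he, hQe, fun a => ?_⟩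
  obtain ⟨n, y, hy⟩ := IsArtinian.exists_pow_succ_smul_dvd a (1 : E)
  simp only [smul_eq_mul, mul_one] at hy
  -- `y` is an inverse of `a` on the part `a ^ n` of the ring
  have hu : ∀ j, a ^ n * (a * y) ^ j = a ^ n := by
    intro j
    induction j with
    | zero => simp
    | succ j ih => rw [pow_succ, ← mul_assoc, ih, ← mul_assoc, ← pow_succ, hy]
  have hf : IsIdempotentElem (e * (a ^ n * y ^ n)) := by
    have : e * (a ^ n * y ^ n) * (e * (a ^ n * y ^ n)) =
        e * e * ((a ^ n * (a * y) ^ n) * y ^ n) := by ring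
    rw [IsIdempotentElem, this, hu, he.eq]
  rcases hprim _ hf (by rw [← mul_assoc, he.eq]) with h | h
  · refine ⟨a ^ n * y ^ (n + 1), Or.inl ?_⟩
    calc a * (a ^ n * y ^ (n + 1)) * e = e * ((a ^ (n + 1) * y) * y ^ n) := by ring
      _ = e := by rw [hy, h]
  · refine ⟨∑ i ∈ Finset.range n, a ^ i, Or.inr ?_⟩
    have h2 : e * a ^ n = 0 := by
      calc e * a ^ n = e * (a ^ n * (a * y) ^ n) := by rw [hu]
        _ = e * (a ^ n * y ^ n) * a ^ n := by ring
        _ = 0 := by rw [h, zero_mul]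
    rw [mul_comm (1 - a), geom_sum_mul_neg, sub_mul, one_mul, mul_comm (a ^ n), h2, sub_zero]

section Split

/-! ### Direct factors of a graded ring -/

variable {k R R' : Type*} [Field k] [CommRing R] [Algebra k R] [CommRing R'] [Algebra k R']
  [Algebra R R'] [IsScalarTower k R R'] (ℛ : ℕ → Submodule k R)

/-- The image of the grading of a graded ring `R` in an `R`-algebra `R'`. -/
def imageGrading (R' : Type*) [CommRing R'] [Algebra k R'] [Algebra R R'] [IsScalarTower k R R']
    (n : ℕ) : Submodule k R' :=
  (ℛ n).map (IsScalarTower.toAlgHom k R R').toLinearMap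

variable {ℛ}

theorem algebraMap_mem_imageGrading {n : ℕ} {x : R} (hx : x ∈ ℛ n) :
    algebraMap R R' x ∈ imageGrading ℛ R' n := ⟨x, hx, rfl⟩

theorem algebraMap_mem_intPiece_imageGrading {n : ℤ} {x : R} (hx : x ∈ intPiece ℛ n) :
    algebraMap R R' x ∈ intPiece (imageGrading ℛ R') n := by
  rcases lt_or_ge n 0 with h | h
  · rw [intPiece_of_neg _ h, Submodule.mem_bot] at hx
    rw [hx, map_zero]; exact zero_mem _
  · rw [intPiece_of_nonneg _ h] at hx ⊢
    exact algebraMap_mem_imageGrading hx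

section

variable {σ : R' →ₗ[R] R}

theorem section_algebraMap (σ : R' →ₗ[R] R) (x : R) : σ (algebraMap R R' x) = x * σ 1 := by
  rw [Algebra.algebraMap_eq_smul_one, map_smul, smul_eq_mul]

theorem section_algebraMap_mul (σ : R' →ₗ[R] R) (x : R) (y : R') :
    σ (algebraMap R R' x * y) = x * σ y := by
  rw [← Algebra.smul_def, map_smul, smul_eq_mul]

variable [GradedAlgebra ℛ]

/-- If a direct factor `R'` of `R`, given by a section `σ` of `R → R'`, is cut out by an idempotent
`σ 1` of degree zero, then it is graded. -/
@[reducible] def imageGrading.gradedAlgebra (hσ : ∀ y, algebraMap R R' (σ y) = y)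
    (h0 : σ 1 ∈ ℛ 0) : GradedAlgebra (imageGrading ℛ R') :=
  have one_mem : (1 : R') ∈ imageGrading ℛ R' 0 := by
    rw [← map_one (algebraMap R R')]
    exact algebraMap_mem_imageGrading (SetLike.one_mem_graded ℛ)
  have mul_mem : ∀ ⦃i j : ℕ⦄ {x y : R'}, x ∈ imageGrading ℛ R' i → y ∈ imageGrading ℛ R' j →
      x * y ∈ imageGrading ℛ R' (i + j) := by
    rintro i j _ _ ⟨x, hx, rfl⟩ ⟨y, hy, rfl⟩
    exact ⟨x * y, SetLike.mul_mem_graded hx hy, map_mul (algebraMap R R') x y⟩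
  have hproj : ∀ (n : ℕ) (z : DirectSum ℕ fun n => imageGrading ℛ R' n),
      algebraMap R R' (GradedAlgebra.proj ℛ n
        (σ (DirectSum.coeAddMonoidHom (imageGrading ℛ R') z))) = z n := by
    intro n z
    induction z using DirectSum.induction_on with
    | zero => simp
    | of i y =>
      obtain ⟨x, hx, hxy⟩ := y.2
      have hxy' : algebraMap R R' x = y := hxy
      rw [DirectSum.coeAddMonoidHom_of, ← hxy', section_algebraMap]
      have hx0 : x * σ 1 ∈ ℛ i := by simpa using SetLike.mul_mem_graded hx h0
      by_cases h : n = i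
      · subst h
        rw [GradedAlgebra.proj_apply, DirectSum.decompose_of_mem_same _ hx0, map_mul, hσ, mul_one,
          DirectSum.of_eq_same, hxy']
      · rw [GradedAlgebra.proj_apply, DirectSum.decompose_of_mem_ne _ hx0 (Ne.symm h), map_zero,
          DirectSum.of_eq_of_ne _ _ _ h]
        rfl
    | add x y hx hy => simp only [map_add, hx, hy, DirectSum.add_apply, Submodule.coe_add]
  have hint : DirectSum.IsInternal (imageGrading ℛ R') := by
    refine ⟨fun x y hxy => ?_, fun y => ?_⟩
    · refine DFinsupp.ext fun n => Subtype.ext ?_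
      rw [← hproj n x, ← hproj n y, hxy]
    · suffices h : ∀ x : R, algebraMap R R' x ∈
          AddMonoidHom.mrange (DirectSum.coeAddMonoidHom (imageGrading ℛ R')) by
        have := h (σ y)
        rwa [hσ] at this
      classical
      intro x
      rw [← DirectSum.sum_support_decompose ℛ x, map_sum]
      refine sum_mem fun i _ => ⟨DirectSum.of (fun n => imageGrading ℛ R' n) i
        ⟨_, algebraMap_mem_imageGrading (DirectSum.decompose ℛ x i).2⟩, ?_⟩
      rw [DirectSum.coeAddMonoidHom_of]
  { one_mem := one_mem
    mul_mem := mul_mem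
    __ := hint.chooseDecomposition }

end

theorem Function.Exact.of_retract {N M P N' M' P' : Type*} [Zero P] [Zero P'] {f : N → M}
    {g : M → P} {f' : N' → M'} {g' : M' → P'} (h : Function.Exact f g) {iN : N' → N} {iM : M' → M}
    {iP : P' → P} {rN : N → N'} {rM : M → M'} {rP : P → P'} (hrN : ∀ x, rN (iN x) = x)
    (hrM : ∀ x, rM (iM x) = x) (hiP : iP 0 = 0) (hrP : rP 0 = 0)
    (hig : ∀ x, g (iM x) = iP (g' x))
    (hrf : ∀ x, rM (f x) = f' (rN x)) (hrg : ∀ x, rP (g x) = g' (rM x)) :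
    Function.Exact f' g' := by
  intro v
  constructor
  · intro hv
    obtain ⟨u, hu⟩ := (h (iM v)).1 (by rw [hig, hv, hiP])
    exact ⟨rN u, by rw [← hrf, hu, hrM]⟩
  · rintro ⟨u, rfl⟩
    rw [← hrN u, ← hrf, ← hrg, (h _).2 ⟨_, rfl⟩, hrP]

theorem section_mulVecLin {ι κ : Type*} [Fintype κ] (σ : R' →ₗ[R] R) (A : Matrix ι κ R)
    (v : κ → R') : A.mulVecLin (fun b => σ (v b)) =
      fun a => σ ((A.map (algebraMap R R')).mulVecLin v a) := by
  funext a
  simp only [Matrix.mulVecLin_apply, Matrix.mulVec, dotProduct, Matrix.map_apply, map_sum,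
    section_algebraMap_mul]

theorem algebraMap_mulVecLin {ι κ : Type*} [Fintype κ] (A : Matrix ι κ R) (v : κ → R) :
    (fun a => algebraMap R R' (A.mulVecLin v a)) =
      (A.map (algebraMap R R')).mulVecLin fun b => algebraMap R R' (v b) := by
  funext a
  simp only [Matrix.mulVecLin_apply, Matrix.mulVec, dotProduct, Matrix.map_apply, map_sum, map_mul]

/-- The image of a graded free resolution in a direct factor of the ring. -/
def GradedFreeResolution.mapSection {J : Ideal R} (F : GradedFreeResolution ℛ J) (σ : R' →ₗ[R] R)
    (hσ : ∀ y, algebraMap R R' (σ y) = y) :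
    GradedFreeResolution (imageGrading ℛ R') (J.map (algebraMap R R')) where
  len := F.len
  rank := F.rank
  deg := F.deg
  gen b := algebraMap R R' (F.gen b)
  d i := (F.d i).map (algebraMap R R')
  rank_eq_zero := F.rank_eq_zero
  gen_mem b := algebraMap_mem_intPiece_imageGrading (F.gen_mem b)
  d_mem i a b := algebraMap_mem_intPiece_imageGrading (F.d_mem i a b)
  span_gen := by
    have h := congrArg (Ideal.map (algebraMap R R')) F.span_gen
    rwa [Ideal.map_span, ← Set.range_comp] at h
  exact_zero := F.exact_zero.of_retract (iN := fun v b => σ (v b)) (iM := fun v b => σ (v b))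
    (iP := σ) (rN := fun v b => algebraMap R R' (v b)) (rM := fun v b => algebraMap R R' (v b))
    (rP := algebraMap R R') (fun _ => funext fun _ => hσ _) (fun _ => funext fun _ => hσ _)
    (map_zero _) (map_zero _)
    (fun v => by
      simp only [Fintype.linearCombination_apply, map_sum, smul_eq_mul]
      refine Finset.sum_congr rfl fun b _ => ?_
      rw [mul_comm (v b), section_algebraMap_mul, mul_comm])
    (algebraMap_mulVecLin _)
    (fun v => by simp only [Fintype.linearCombination_apply, map_sum, smul_eq_mul, map_mul])
  exact_succ i := (F.exact_succ i).of_retract (iN := fun v b => σ (v b))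
    (iM := fun v b => σ (v b)) (iP := fun v b => σ (v b)) (rN := fun v b => algebraMap R R' (v b))
    (rM := fun v b => algebraMap R R' (v b)) (rP := fun v b => algebraMap R R' (v b))
    (fun _ => funext fun _ => hσ _) (fun _ => funext fun _ => hσ _)
    (funext fun _ => map_zero _) (funext fun _ => map_zero _) (section_mulVecLin σ _)
    (algebraMap_mulVecLin _) (algebraMap_mulVecLin _)

theorem GradedFreeResolution.bettiSum_mapSection {J : Ideal R} (F : GradedFreeResolution ℛ J)
    (σ : R' →ₗ[R] R) (hσ : ∀ y, algebraMap R R' (σ y) = y) (d m : ℕ) (x : ℝ) :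
    (F.mapSection σ hσ).bettiSum d m x = F.bettiSum d m x := rfl

theorem isLocalRing_imageGrading_zero [GradedAlgebra ℛ] [GradedAlgebra (imageGrading ℛ R')]
    [Nontrivial R'] (hloc : ∀ a : ℛ 0, ∃ b : ℛ 0, algebraMap R R' (a * b) = 1 ∨
      algebraMap R R' ((1 - a) * b) = 1) : IsLocalRing (imageGrading ℛ R' 0) := by
  have : Nontrivial (imageGrading ℛ R' 0) :=
    ⟨0, 1, fun h => zero_ne_one (congrArg Subtype.val h)⟩
  refine IsLocalRing.of_isUnit_or_isUnit_one_sub_self fun y => ?_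
  obtain ⟨x, hx, hxy⟩ := y.2
  have hxy' : algebraMap R R' x = y := hxy
  obtain ⟨b, hb⟩ := hloc ⟨x, hx⟩
  refine hb.imp (fun h => ?_) (fun h => ?_) <;>
    refine IsUnit.of_mul_eq_one ⟨_, algebraMap_mem_imageGrading b.2⟩ (Subtype.ext ?_)
  · rw [map_mul, hxy'] at h
    exact h
  · rw [map_mul, map_sub, map_one, hxy'] at h
    exact h

end Split

section SplitDimension

variable {R R' : Type u} [CommRing R] [CommRing R'] [Algebra R R']

open CategoryTheory in
theorem projectiveDimension_quotient_lt_top_of_section (σ : R' →ₗ[R] R)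
    (hσ : ∀ y, algebraMap R R' (σ y) = y) {J : Ideal R} {J' : Ideal R'} (h1 : ∀ y ∈ J', σ y ∈ J)
    (h2 : ∀ x ∈ J, algebraMap R R' x ∈ J')
    (h : projectiveDimension (ModuleCat.of R (R ⧸ J)) < ⊤) :
    projectiveDimension (ModuleCat.of R (R' ⧸ J')) < ⊤ := by
  let e := Submodule.Quotient.restrictScalarsEquiv R J'
  let i : (R' ⧸ J') →ₗ[R] (R ⧸ J) :=
    Submodule.mapQ (J'.restrictScalars R) J σ h1 ∘ₗ e.symm.toLinearMap
  let r : (R ⧸ J) →ₗ[R] (R' ⧸ J') :=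
    e.toLinearMap ∘ₗ Submodule.mapQ J (J'.restrictScalars R) (Algebra.linearMap R R') h2
  have hri : r ∘ₗ i = LinearMap.id := by
    refine LinearMap.ext fun y => ?_
    obtain ⟨y, rfl⟩ := Submodule.Quotient.mk_surjective _ y
    exact congrArg (Submodule.Quotient.mk (p := J')) (hσ y)
  have hret : Retract (ModuleCat.of R (R' ⧸ J')) (ModuleCat.of R (R ⧸ J)) :=
    { i := ModuleCat.ofHom i
      r := ModuleCat.ofHom r
      retract := by rw [← ModuleCat.ofHom_comp, hri, ModuleCat.ofHom_id] }
  exact hret.projectiveDimension_le.trans_lt h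

theorem projectiveDimension_map_lt_top (σ : R' →ₗ[R] R) (hσ : ∀ y, algebraMap R R' (σ y) = y)
    (J : Ideal R) (h : CategoryTheory.projectiveDimension (ModuleCat.of R (R ⧸ J)) < ⊤) :
    CategoryTheory.projectiveDimension
      (ModuleCat.of R (R' ⧸ J.map (algebraMap R R'))) < ⊤ := by
  refine projectiveDimension_quotient_lt_top_of_section σ hσ (fun y hy => ?_)
    (fun x hx => Ideal.mem_map_of_mem _ hx) h
  have hy' : y ∈ Ideal.span (algebraMap R R' '' J) := hy
  clear hy
  induction hy' using Submodule.span_induction with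
  | mem y hy =>
    obtain ⟨x, hx, rfl⟩ := hy
    rw [section_algebraMap]
    exact J.mul_mem_right _ hx
  | zero => rw [map_zero]; exact zero_mem _
  | add a b _ _ ha hb => rw [map_add]; exact add_mem ha hb
  | smul a b _ hb =>
    have : a • b = algebraMap R R' (σ a) * b := by rw [hσ]; rfl
    rw [this, section_algebraMap_mul]
    exact J.mul_mem_left _ hb

end SplitDimension

/-! ### The density function of a finite graded extension -/

section Density

variable {k S : Type*} [Field k] [CommRing S] [Algebra k S] {𝒮 : ℕ → Submodule k S}
  [GradedAlgebra 𝒮] {I : Ideal S} {d : ℕ}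

/-- A finite minimal graded free resolution of `IR` determines the density function, and hence so
does every finite graded free resolution of `IR`. -/
theorem IsGradedPair.density_of_minimal {R : Type*} [CommRing R] [Algebra k R] [Algebra S R]
    [IsScalarTower k S R] {ℛ : ℕ → Submodule k R} [GradedAlgebra ℛ] [Module.Finite S R]
    (h : IsGradedPair 𝒮 I d) (hd : 1 < d) (p : ℕ) [Fact p.Prime] [CharP k p]
    (hinj : Function.Injective (algebraMap S R)) (hdeg : ∀ n, ∀ s ∈ 𝒮 n, algebraMap S R s ∈ ℛ n)
    [IsLocalRing (ℛ 0)] (G : GradedFreeResolution ℛ (I.map (algebraMap S R)))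
    (hG : ∀ i a b, G.d i a b ∈ homogeneousMaximalIdeal ℛ) :
    TendstoUniformlyOn (hkSeq p d 𝒮 I) (hkDensity p d 𝒮 I) atTop (Set.Ici 0) ∧
      IsPiecewisePolynomialOfDegree (hkDensity p d 𝒮 I) (d - 1) ∧
      DensityGivenByBetti p d 𝒮 I ℛ := by
  obtain ⟨c, hc, hlim, hunif, hsmall⟩ := h.exists_density_of_minimal hd p hinj hdeg G hG
  obtain ⟨h1, h2, h3⟩ := density_properties hd (h.degreeGcd_pos hd) hc G hunif hsmall
  have := h.isDomain
  have hnt : Nontrivial R := hinj.nontrivial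
  have := fun n => h.finite_piece hd n
  have hRfin : ∀ n, Module.Finite k (ℛ n) := finite_piece_of_finite hdeg
  refine ⟨h2, h3, c, hc, hlim, fun F x hx => ?_⟩
  rw [h1 x hx, F.bettiSum_eq, G.bettiSum_eq, F.altSum_eq_altSum G]

omit [GradedAlgebra 𝒮] in
/-- The density function can be computed over a direct factor of the extension ring. -/
theorem DensityGivenByBetti.of_section {R R' : Type*} [CommRing R] [Algebra k R] [Algebra S R]
    [CommRing R'] [Algebra k R'] [Algebra R R'] [IsScalarTower k R R'] [Algebra S R']
    [IsScalarTower S R R'] {ℛ : ℕ → Submodule k R} (σ : R' →ₗ[R] R)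
    (hσ : ∀ y, algebraMap R R' (σ y) = y) {p : ℕ}
    (h : DensityGivenByBetti p d 𝒮 I (imageGrading ℛ R')) : DensityGivenByBetti p d 𝒮 I ℛ := by
  obtain ⟨c, hc, hlim, hF⟩ := h
  refine ⟨c, hc, hlim, fun F x hx => ?_⟩
  obtain ⟨F', hF'⟩ : ∃ F' : GradedFreeResolution (imageGrading ℛ R') (I.map (algebraMap S R')),
      F'.bettiSum d (degreeGcd 𝒮) x = F.bettiSum d (degreeGcd 𝒮) x := by
    rw [IsScalarTower.algebraMap_eq S R R', ← Ideal.map_map]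
    exact ⟨F.mapSection σ hσ, F.bettiSum_mapSection σ hσ _ _ _⟩
  rw [hF F' x hx, hF']

/-- The density function, computed over a direct factor `R'` of `R` whose degree zero part is
local. -/
theorem IsGradedPair.density_of_section {R R' : Type u} [CommRing R] [Algebra k R] [Algebra S R]
    [IsScalarTower k S R] {ℛ : ℕ → Submodule k R} [GradedAlgebra ℛ] [Module.Finite S R]
    [CommRing R'] [Algebra k R'] [Algebra R R'] [IsScalarTower k R R'] [Algebra S R']
    [IsScalarTower S R R'] [IsScalarTower k S R'] (h : IsGradedPair 𝒮 I d) (hd : 1 < d) (p : ℕ)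
    [Fact p.Prime] [CharP k p] (hinj : Function.Injective (algebraMap S R'))
    (hdeg : ∀ n, ∀ s ∈ 𝒮 n, algebraMap S R s ∈ ℛ n)
    (hpd : CategoryTheory.projectiveDimension
      (ModuleCat.of R (R ⧸ I.map (algebraMap S R))) < ⊤)
    (σ : R' →ₗ[R] R) (hσ : ∀ y, algebraMap R R' (σ y) = y) (h0 : σ 1 ∈ ℛ 0)
    (hloc : ∀ a : ℛ 0, ∃ b : ℛ 0, algebraMap R R' (a * b) = 1 ∨
      algebraMap R R' ((1 - a) * b) = 1) :
    TendstoUniformlyOn (hkSeq p d 𝒮 I) (hkDensity p d 𝒮 I) atTop (Set.Ici 0) ∧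
      IsPiecewisePolynomialOfDegree (hkDensity p d 𝒮 I) (d - 1) ∧
      DensityGivenByBetti p d 𝒮 I ℛ := by
  have := h.isDomain
  have := h.finiteType
  have hnoeth : IsNoetherianRing S := Algebra.FiniteType.isNoetherianRing k S
  have hnt : Nontrivial R' := hinj.nontrivial
  have hsurj : Function.Surjective (algebraMap R R') := fun y => ⟨σ y, hσ y⟩
  have : Module.Finite R R' :=
    Module.Finite.of_surjective (Algebra.linearMap R R') hsurj
  have : Module.Finite S R' := Module.Finite.trans R R'
  have hnoethR : IsNoetherianRing R' := IsNoetherianRing.of_finite S R'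
  have : Module.Projective R R' :=
    Module.Projective.of_split σ (Algebra.linearMap R R') (LinearMap.ext hσ)
  let _ : GradedAlgebra (imageGrading ℛ R') := imageGrading.gradedAlgebra hσ h0
  have : IsLocalRing (imageGrading ℛ R' 0) := isLocalRing_imageGrading_zero hloc
  have hdeg' : ∀ n, ∀ s ∈ 𝒮 n, algebraMap S R' s ∈ imageGrading ℛ R' n := fun n s hs => by
    rw [IsScalarTower.algebraMap_apply S R R']
    exact algebraMap_mem_imageGrading (hdeg n s hs)
  have hJ := h.isHomogeneous.map_algebraMap hdeg'
  have hpd' := projectiveDimension_map_lt_top σ hσ _ hpd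
  rw [Ideal.map_map, ← IsScalarTower.algebraMap_eq S R R'] at hpd'
  obtain ⟨G, hG⟩ := exists_minimal_resolution hsurj hJ hpd'
  obtain ⟨h1, h2, h3⟩ := h.density_of_minimal hd p hinj hdeg' G hG
  exact ⟨h1, h2, h3.of_section σ hσ⟩

/-- The density function of a graded pair with a finite graded extension `R` such that `R/IR` has
finite projective dimension. Some primitive idempotent `e` of the Artinian ring `R_0` is not
annihilated by any nonzero element of the domain `S`; then `R` can be replaced by its direct factor
`eR`, whose degree zero part is local. -/
theorem IsGradedPair.density_of_projectiveDimension_lt_top {R : Type u} [CommRing R] [Algebra k R]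
    [Algebra S R] [IsScalarTower k S R] {ℛ : ℕ → Submodule k R} [GradedAlgebra ℛ]
    [Module.Finite S R] (h : IsGradedPair 𝒮 I d) (hd : 1 < d) (p : ℕ)
    [Fact p.Prime] [CharP k p] (hinj : Function.Injective (algebraMap S R))
    (hdeg : ∀ n, ∀ s ∈ 𝒮 n, algebraMap S R s ∈ ℛ n)
    (hpd : CategoryTheory.projectiveDimension
      (ModuleCat.of R (R ⧸ I.map (algebraMap S R))) < ⊤) :
    TendstoUniformlyOn (hkSeq p d 𝒮 I) (hkDensity p d 𝒮 I) atTop (Set.Ici 0) ∧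
      IsPiecewisePolynomialOfDegree (hkDensity p d 𝒮 I) (d - 1) ∧
      DensityGivenByBetti p d 𝒮 I ℛ := by
  have := h.isDomain
  have := fun n => h.finite_piece hd n
  have hRfin : ∀ n, Module.Finite k (ℛ n) := finite_piece_of_finite hdeg
  have := isArtinianRing_zero ℛ
  obtain ⟨e, he, hQ, hloc⟩ := IsArtinianRing.exists_idempotent_isLocal
    (fun e : ℛ 0 => ∀ s : S, algebraMap S R s * e = 0 → s = 0)
    (fun s hs => hinj (by rw [map_zero, ← hs]; exact (mul_one _).symm))
    (by
      intro e f _ _ _ hQ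
      by_contra! hcon
      obtain ⟨⟨s, hs, hs0⟩, t, ht, ht0⟩ := hcon
      refine mul_ne_zero hs0 ht0 (hQ _ ?_)
      have ht' : algebraMap S R t * ((e : R) - f) = 0 := ht
      rw [map_mul]
      linear_combination algebraMap S R t * hs + algebraMap S R s * ht')
  have heR : (e : R) * e = e := congrArg Subtype.val he
  let K : Ideal R := Ideal.span {1 - (e : R)}
  let σ : (R ⧸ K) →ₗ[R] R := Submodule.liftQ K (LinearMap.toSpanSingleton R R (e : R)) (by
    rw [Submodule.span_le, Set.singleton_subset_iff]
    change (1 - (e : R)) * e = 0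
    rw [sub_mul, heR, one_mul, sub_self])
  have hmk : ∀ x : R, algebraMap R (R ⧸ K) (x * e) = algebraMap R (R ⧸ K) x := fun x => by
    refine Ideal.Quotient.eq.2 (Ideal.mem_span_singleton.2 ⟨-x, by ring⟩)
  have hσmk : ∀ x : R, σ (algebraMap R (R ⧸ K) x) = x * e := fun x => rfl
  have hσ : ∀ y, algebraMap R (R ⧸ K) (σ y) = y := by
    intro y
    obtain ⟨x, rfl⟩ := Ideal.Quotient.mk_surjective y
    exact hmk x
  have hσ1 : σ 1 = e := by
    have := hσmk 1
    rwa [map_one, one_mul] at this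
  refine h.density_of_section hd p (R' := R ⧸ K) ?_ hdeg hpd σ hσ (hσ1 ▸ e.2) fun a => ?_
  · rw [injective_iff_map_eq_zero]
    intro s hs
    refine hQ s ?_
    rw [← hσmk, ← IsScalarTower.algebraMap_apply S R (R ⧸ K), hs, map_zero]
  · obtain ⟨b, hb⟩ := hloc a
    refine ⟨b, hb.imp (fun h => ?_) (fun h => ?_)⟩
    · have h' : (a : R) * b * e = e := congrArg Subtype.val h
      rw [← hmk, h', ← one_mul (e : R), hmk, map_one]
    · have h' : (1 - (a : R)) * b * e = e := congrArg Subtype.val h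
      rw [← hmk, h', ← one_mul (e : R), hmk, map_one]

/-- A graded extension with local degree zero part has a finite minimal resolution of `IR`. -/
theorem IsGradedPair.exists_isMinimal {R : Type u} [CommRing R] [Algebra k R]
    [Algebra S R] {ℛ : ℕ → Submodule k R} [GradedAlgebra ℛ] [Module.Finite S R]
    (h : IsGradedPair 𝒮 I d) (hdeg : ∀ n, ∀ s ∈ 𝒮 n, algebraMap S R s ∈ ℛ n)
    (hpd : CategoryTheory.projectiveDimension
      (ModuleCat.of R (R ⧸ I.map (algebraMap S R))) < ⊤) [IsLocalRing (ℛ 0)] :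
    ∃ F : GradedFreeResolution ℛ (I.map (algebraMap S R)), F.IsMinimal := by
  have := h.finiteType
  have hnoeth : IsNoetherianRing S := Algebra.FiniteType.isNoetherianRing k S
  have hnoethR : IsNoetherianRing R := IsNoetherianRing.of_finite S R
  obtain ⟨G, hG⟩ := exists_minimal_resolution (R₁ := R) Function.surjective_id
    (h.isHomogeneous.map_algebraMap hdeg) hpd
  exact ⟨G, G.isMinimal_of_mem hG⟩

end Density

/-! ### Graded subrings over which a polynomial ring is integral -/

section IntegralDimension

variable {A B : Type*} [CommRing A] [CommRing B] [Algebra A B]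

theorem ringKrullDim_eq_of_isIntegral [Algebra.IsIntegral A B]
    (hinj : Function.Injective (algebraMap A B)) : ringKrullDim A = ringKrullDim B := by
  apply le_antisymm
  · refine iSup_le fun l => ?_
    obtain ⟨Q, -, hQ, hQl⟩ := Ideal.exists_ideal_over_prime_of_isIntegral (S := B)
      l.head.asIdeal ⊥ (by
        rw [← RingHom.ker_eq_comap_bot, (RingHom.injective_iff_ker_eq_bot _).1 hinj]
        exact bot_le)
    have : Q.LiesOver l.head.asIdeal := ⟨hQl.symm⟩
    obtain ⟨L, hL, -, -⟩ := Ideal.exists_ltSeries_of_hasGoingUp l Q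
    rw [← hL]
    exact Order.le_krullDim_iff.2 ⟨L, rfl⟩
  · exact Order.krullDim_le_of_strictMono (PrimeSpectrum.comap (algebraMap A B))
      fun p q hpq => Ideal.IsIntegral.comap_lt_comap hpq

end IntegralDimension

section PolynomialRing

open MvPolynomial

variable (k : Type*) [Field k] (d : ℕ)

attribute [local instance] MvPolynomial.gradedAlgebra

instance : IsLocalRing (homogeneousSubmodule (Fin d) k 0) := by
  have : Nontrivial (homogeneousSubmodule (Fin d) k 0) :=
    ⟨0, 1, fun h => zero_ne_one (congrArg Subtype.val h)⟩
  refine IsLocalRing.of_surjective' (algebraMap k (homogeneousSubmodule (Fin d) k 0)) ?_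
  rintro ⟨f, hf⟩
  have h1 := totalDegree_eq_zero_iff_eq_C.1 ((totalDegree_zero_iff_isHomogeneous _).2 hf)
  exact ⟨coeff 0 f, Subtype.ext h1.symm⟩

variable {k d}

theorem mem_span_X_of_mem_homogeneousMaximalIdeal {f : MvPolynomial (Fin d) k}
    (hf : f ∈ homogeneousMaximalIdeal (homogeneousSubmodule (Fin d) k)) :
    f ∈ Ideal.span (Set.range (X : Fin d → MvPolynomial (Fin d) k)) := by
  have h0 : coeff 0 f = 0 := by
    by_contra h
    refine (IsLocalRing.mem_maximalIdeal _).1 (Ideal.mem_comap.1 hf) ?_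
    have h1 : GradedRing.projZeroRingHom' (homogeneousSubmodule (Fin d) k) f =
        algebraMap k (homogeneousSubmodule (Fin d) k 0) (coeff 0 f) := by
      refine Subtype.ext ?_
      rw [SetLike.GradeZero.coe_algebraMap, algebraMap_eq, ← homogeneousComponent_zero]
      exact decomposition.decompose'_apply f 0
    rw [h1]
    exact (IsUnit.mk0 _ h).map _
  rw [← Set.image_univ, mem_ideal_span_X_image]
  intro m hm
  have hm0 : m ≠ 0 := by
    rintro rfl
    exact mem_support_iff.1 hm h0
  obtain ⟨i, hi⟩ := Finsupp.ne_iff.1 hm0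
  exact ⟨i, trivial, hi⟩

/-- Hilbert's syzygy theorem for homogeneous ideals: the minimal graded free resolution is
finite, as it stays exact modulo the variables in high positions. -/
theorem exists_minimal_resolution_mvPolynomial {J : Ideal (MvPolynomial (Fin d) k)}
    (hJ : J.IsHomogeneous (homogeneousSubmodule (Fin d) k)) :
    ∃ G : GradedFreeResolution (homogeneousSubmodule (Fin d) k) J,
      ∀ i a b, G.d i a b ∈ homogeneousMaximalIdeal (homogeneousSubmodule (Fin d) k) := by
  set s := J.toGradedSubmodule hJ
  have hN : ∀ i, d + 1 < i → s.minimalComplex.rank i = 0 := by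
    intro i hi
    obtain ⟨i, rfl⟩ : ∃ j, i = j + 1 := ⟨i - 1, by omega⟩
    refine rank_eq_zero_of_isRegular (fun i => (s.exactAt_minimalComplex i).mul_eq_zero)
      (fun i a b => s.minimalComplex_d_mem i a b) _ _ (isRegular_ofFn_X k d) (fun a ha m => ?_) 0
      (fun i _ => s.exactAt_minimalComplex i) i (by simp; omega) (by omega)
    have h1 : Ideal.ofList (List.ofFn fun i : Fin d => (X i : MvPolynomial (Fin d) k)) =
        Ideal.span (Set.range (X : Fin d → MvPolynomial (Fin d) k)) := by
      rw [Ideal.ofList]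
      congr 1
      ext x
      simp [List.mem_ofFn]
    rw [h1]
    exact Submodule.smul_mem_smul (mem_span_X_of_mem_homogeneousMaximalIdeal ha) trivial
  exact ⟨J.minimalResolution hJ (d + 1) hN, J.minimalResolution_d_mem hJ (d + 1) hN⟩

end PolynomialRing

section Subring

open MvPolynomial

attribute [local instance] MvPolynomial.gradedAlgebra

variable {k : Type*} [Field k] {d : ℕ} {B : Subalgebra k (MvPolynomial (Fin d) k)}
  [GradedAlgebra (inducedGrading B)] [Algebra.IsIntegral B (MvPolynomial (Fin d) k)]
  {I : Ideal B}

instance Subalgebra.finite_of_isIntegral : Module.Finite B (MvPolynomial (Fin d) k) := by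
  have : Algebra.FiniteType B (MvPolynomial (Fin d) k) :=
    Algebra.FiniteType.of_restrictScalars_finiteType k B _
  exact Algebra.IsIntegral.finite

theorem isGradedPair_inducedGrading (hI : I.IsHomogeneous (inducedGrading B)) (hI1 : I ≠ ⊤)
    (hI2 : HasFiniteColength I) : IsGradedPair (inducedGrading B) I d where
  isDomain := inferInstance
  finiteType := ⟨fg_of_fg_of_fg k B (MvPolynomial (Fin d) k) Algebra.FiniteType.out
    Module.Finite.fg_top Subtype.val_injective⟩
  degree_zero := by
    ext b
    rw [Submodule.mem_one]
    constructor
    · intro hb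
      have h1 := totalDegree_eq_zero_iff_eq_C.1
        ((totalDegree_zero_iff_isHomogeneous _).2 (show IsHomogeneous (b : MvPolynomial (Fin d) k) 0
          from hb))
      exact ⟨_, Subtype.ext h1.symm⟩
    · rintro ⟨c, rfl⟩
      exact isHomogeneous_C (Fin d) c
  dim_eq := by
    rw [ringKrullDim_eq_of_isIntegral (B := MvPolynomial (Fin d) k) Subtype.val_injective,
      MvPolynomial.ringKrullDim_of_isNoetherianRing, ringKrullDim_eq_zero_of_field, zero_add,
      Nat.card_eq_fintype_card, Fintype.card_fin]
  isHomogeneous := hI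
  ne_top := hI1
  finite_colength := hI2

/-- The density function of a graded subring over which the polynomial ring is integral. -/
theorem density_inducedGrading (hd : 1 < d) (p : ℕ) [Fact p.Prime] [CharP k p]
    (hI : I.IsHomogeneous (inducedGrading B)) (hI1 : I ≠ ⊤) (hI2 : HasFiniteColength I) :
    IsGradedPair (inducedGrading B) I d ∧
      TendstoUniformlyOn (hkSeq p d (inducedGrading B) I) (hkDensity p d (inducedGrading B) I)
        atTop (Set.Ici 0) ∧
      IsPiecewisePolynomialOfDegree (hkDensity p d (inducedGrading B) I) (d - 1) ∧
      DensityGivenByBetti p d (inducedGrading B) I (homogeneousSubmodule (Fin d) k) ∧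
      ∃ F : GradedFreeResolution (homogeneousSubmodule (Fin d) k)
        (I.map (algebraMap B (MvPolynomial (Fin d) k))), F.IsMinimal := by
  have h := isGradedPair_inducedGrading hI hI1 hI2
  have hdeg : ∀ n, ∀ s ∈ inducedGrading B n,
      algebraMap B (MvPolynomial (Fin d) k) s ∈ homogeneousSubmodule (Fin d) k n := fun n s hs => hs
  obtain ⟨G, hG⟩ := exists_minimal_resolution_mvPolynomial (hI.map_algebraMap hdeg)
  obtain ⟨h1, h2, h3⟩ := h.density_of_minimal hd p Subtype.val_injective hdeg G hG
  exact ⟨h, h1, h2, h3, G, G.isMinimal_of_mem hG⟩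

end Subring

/-! ### Integrality over the invariants of a finite group -/

section GroupInvariants

open MvPolynomial

variable {k : Type*} [Field k] {d : ℕ}

theorem linearSubst_one : linearSubst (1 : Matrix (Fin d) (Fin d) k) = AlgHom.id k _ := by
  refine MvPolynomial.algHom_ext fun i => ?_
  simp [linearSubst, Matrix.one_apply]

theorem linearSubst_mul (M N : Matrix (Fin d) (Fin d) k) :
    linearSubst (M * N) = (linearSubst M).comp (linearSubst N) := by
  refine MvPolynomial.algHom_ext fun i => ?_
  simp only [linearSubst, AlgHom.comp_apply, aeval_X, map_sum, map_mul, aeval_C, Matrix.mul_apply,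
    algebraMap_eq, Finset.mul_sum, Finset.sum_mul]
  rw [Finset.sum_comm]
  exact Finset.sum_congr rfl fun j _ => Finset.sum_congr rfl fun l _ => by ring

instance groupInvariants.isIntegral {G : Type*} [Group G] [Finite G]
    (ρ : G →* Matrix.GeneralLinearGroup (Fin d) k) :
    Algebra.IsIntegral (groupInvariants ρ) (MvPolynomial (Fin d) k) := by
  let φ : G →* (MvPolynomial (Fin d) k →+* MvPolynomial (Fin d) k) :=
    { toFun := fun g => (linearSubst (ρ g : Matrix (Fin d) (Fin d) k)).toRingHom
      map_one' := by rw [map_one, Units.val_one, linearSubst_one]; rfl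
      map_mul' := fun g h => by rw [map_mul, Units.val_mul, linearSubst_mul]; rfl }
  let _ : MulSemiringAction G (MvPolynomial (Fin d) k) := MulSemiringAction.compHom _ φ
  have : Algebra.IsInvariant (groupInvariants ρ) (MvPolynomial (Fin d) k) G := by
    refine ⟨fun f hf => ⟨⟨f, ?_⟩, rfl⟩⟩
    simp only [groupInvariants, Algebra.mem_iInf, AlgHom.mem_equalizer, AlgHom.coe_id, id_eq]
    exact hf
  exact Algebra.IsInvariant.isIntegral _ _ G

end GroupInvariants

/-! ### Integrality over the invariants of a finite group scheme -/

section FiniteFree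

variable {k A : Type*} [Field k] [CommRing A] [Algebra k A] [Module.Finite k A]

/-- The characteristic polynomial over `Q` of the multiplication by an element of `Q ⊗ A`. -/
def tensorCharpoly {Q : Type*} [CommRing Q] [Algebra k Q] (u : Q ⊗[k] A) : Polynomial Q :=
  (Algebra.lmul Q (Q ⊗[k] A) u).charpoly

theorem tensorCharpoly_map {Q Q' : Type*} [CommRing Q] [Algebra k Q] [CommRing Q'] [Algebra k Q']
    (φ : Q →ₐ[k] Q') (u : Q ⊗[k] A) :
    (tensorCharpoly u).map (φ : Q →+* Q') =
      tensorCharpoly (Algebra.TensorProduct.map φ (AlgHom.id k A) u) := by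
  classical
  let b := Module.finBasis k A
  rw [tensorCharpoly, tensorCharpoly, ← LinearMap.charpoly_toMatrix _ (b.baseChange Q),
    ← LinearMap.charpoly_toMatrix _ (b.baseChange Q'), ← Matrix.charpoly_map]
  congr 1
  ext i j
  rw [Matrix.map_apply, LinearMap.toMatrix_apply, LinearMap.toMatrix_apply]
  induction u with
  | zero => simp
  | tmul q a => simp [Module.Basis.baseChange_repr_tmul]
  | add u v hu hv => simp only [map_add, LinearMap.add_apply, Finsupp.add_apply, hu, hv]

theorem tensorCharpoly_algEquiv {Q : Type*} [CommRing Q] [Algebra k Q]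
    (ψ : Q ⊗[k] A ≃ₐ[Q] Q ⊗[k] A) (u : Q ⊗[k] A) : tensorCharpoly (ψ u) = tensorCharpoly u := by
  rw [tensorCharpoly, tensorCharpoly,
    ← LinearEquiv.charpoly_conj ψ.toLinearEquiv (Algebra.lmul Q (Q ⊗[k] A) u)]
  congr 1
  ext v
  simp [LinearEquiv.conj_apply_apply]

theorem aeval_tensorCharpoly {Q : Type*} [CommRing Q] [Algebra k Q] (u : Q ⊗[k] A) :
    Polynomial.aeval u (tensorCharpoly u) = 0 := by
  have h := LinearMap.aeval_self_charpoly (Algebra.lmul Q (Q ⊗[k] A) u)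
  rw [Polynomial.aeval_algHom_apply] at h
  exact Algebra.lmul_injective (by rw [map_zero]; exact h)

end FiniteFree

section SchemeInvariants

open MvPolynomial Coalgebra

variable {k A : Type*} [Field k] [CommRing A] [HopfAlgebra k A]

/-- The translation by a point `h` of the group scheme `Spec A` with values in `Q`, an endomorphism
of `Spec (Q ⊗ A)`. -/
def translation {Q : Type*} [CommRing Q] [Algebra k Q] (h : A →ₐ[k] Q) :
    Q ⊗[k] A →ₐ[Q] Q ⊗[k] A :=
  Algebra.TensorProduct.lift (Algebra.ofId Q (Q ⊗[k] A))
    ((Algebra.TensorProduct.map h (AlgHom.id k A)).comp (Bialgebra.comulAlgHom k A))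
    fun _ _ => Commute.all _ _

theorem translation_tmul {Q : Type*} [CommRing Q] [Algebra k Q] (h : A →ₐ[k] Q) (q : Q) (b : A) :
    translation h (q ⊗ₜ b) = q • h.toLinearMap.rTensor A (comul b) := by
  rw [translation, Algebra.TensorProduct.lift_tmul, Algebra.ofId_apply, Algebra.smul_def]
  rfl

theorem translation_bijective {Q : Type*} [CommRing Q] [Algebra k Q] [Module.Finite k A]
    (h : A →ₐ[k] Q) : Function.Bijective (translation h) := by
  have hsurj : Function.Surjective (translation h).toLinearMap := by
    rw [← LinearMap.range_eq_top, eq_top_iff]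
    rintro x -
    induction x with
    | zero => exact zero_mem _
    | add x y hx hy => exact add_mem hx hy
    | tmul q b =>
      suffices h1 : (1 : Q) ⊗ₜ[k] b ∈ LinearMap.range (translation h).toLinearMap by
        have := Submodule.smul_mem _ q h1
        rwa [TensorProduct.smul_tmul', smul_eq_mul, mul_one] at this
      refine ⟨(h.toLinearMap ∘ₗ HopfAlgebra.antipode k).rTensor A (comul b), ?_⟩
      -- `Λ (a ⊗ (b ⊗ c)) = h (S a * b) ⊗ c`
      let Λ : A ⊗[k] (A ⊗[k] A) →ₗ[k] Q ⊗[k] A :=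
        (h.toLinearMap ∘ₗ LinearMap.mul' k A ∘ₗ (HopfAlgebra.antipode k).rTensor A).rTensor A ∘ₗ
          (TensorProduct.assoc k A A A).symm.toLinearMap
      have hΛ : ∀ t : A ⊗[k] A, (translation h).toLinearMap
          ((h.toLinearMap ∘ₗ HopfAlgebra.antipode k).rTensor A t) = Λ (comul.lTensor A t) := by
        intro t
        induction t with
        | zero => simp
        | add x y hx hy => simp only [map_add, hx, hy]
        | tmul a c =>
          rw [LinearMap.rTensor_tmul, LinearMap.lTensor_tmul]
          rw [AlgHom.toLinearMap_apply, translation_tmul]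
          generalize comul (R := k) c = s
          induction s with
          | zero => simp
          | add x y hx hy => simp only [map_add, smul_add, TensorProduct.tmul_add, hx, hy]
          | tmul x y => simp [Λ, TensorProduct.smul_tmul']
      rw [hΛ, ← coassoc_apply]
      have h2 : Λ (TensorProduct.assoc k A A A (comul.rTensor A (comul b))) =
          (h.toLinearMap ∘ₗ Algebra.linearMap k A).rTensor A (counit.rTensor A (comul b)) := by
        simp only [Λ, LinearMap.comp_apply, LinearEquiv.coe_coe, LinearEquiv.symm_apply_apply]
        rw [← LinearMap.rTensor_comp_apply, ← LinearMap.rTensor_comp_apply, LinearMap.comp_assoc,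
          LinearMap.comp_assoc, LinearMap.comp_assoc, HopfAlgebra.mul_antipode_rTensor_comul]
      rw [h2, rTensor_counit_comul]
      simp
  exact ⟨OrzechProperty.injective_of_surjective_endomorphism _ hsurj, hsurj⟩

variable {d : ℕ} {a : Matrix (Fin d) (Fin d) A}

theorem coaction_X (i : Fin d) : coaction k a (X i) =
    ∑ j, (X j : MvPolynomial (Fin d) k) ⊗ₜ[k] a j i := by rw [coaction, aeval_X]

theorem IsLinearCoaction.coassoc (ha : IsLinearCoaction (k := k) a) (f : MvPolynomial (Fin d) k) :
    Algebra.TensorProduct.map (coaction k a) (AlgHom.id k A) (coaction k a f) =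
      translation (Q := MvPolynomial (Fin d) k ⊗[k] A) Algebra.TensorProduct.includeRight
        (Algebra.TensorProduct.map (Algebra.TensorProduct.includeLeft (S := k)) (AlgHom.id k A)
          (coaction k a f)) := by
  let T := translation (Q := MvPolynomial (Fin d) k ⊗[k] A) (k := k) (A := A)
    Algebra.TensorProduct.includeRight
  suffices h : (Algebra.TensorProduct.map (coaction k a) (AlgHom.id k A)).comp (coaction k a) =
      (T.restrictScalars k).comp ((Algebra.TensorProduct.map
        (Algebra.TensorProduct.includeLeft (S := k)) (AlgHom.id k A)).comp (coaction k a)) from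
    DFunLike.congr_fun h f
  refine MvPolynomial.algHom_ext fun i => ?_
  simp only [AlgHom.comp_apply, coaction_X, map_sum, Algebra.TensorProduct.map_tmul,
    AlgHom.restrictScalars_apply, T, translation_tmul, ha.comul, AlgHom.id_apply,
    TensorProduct.sum_tmul, LinearMap.rTensor_tmul, Finset.smul_sum]
  rw [Finset.sum_comm]
  refine Finset.sum_congr rfl fun j _ => Finset.sum_congr rfl fun l _ => ?_
  simp [TensorProduct.smul_tmul']

theorem IsLinearCoaction.counit_coaction (ha : IsLinearCoaction (k := k) a)
    (f : MvPolynomial (Fin d) k) :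
    Algebra.TensorProduct.lift (Algebra.ofId (MvPolynomial (Fin d) k) (MvPolynomial (Fin d) k))
      ((Algebra.ofId k (MvPolynomial (Fin d) k)).comp (Bialgebra.counitAlgHom k A))
      (fun _ _ => Commute.all _ _) (coaction k a f) = f := by
  set E := Algebra.TensorProduct.lift
    (Algebra.ofId (MvPolynomial (Fin d) k) (MvPolynomial (Fin d) k))
      ((Algebra.ofId k (MvPolynomial (Fin d) k)).comp (Bialgebra.counitAlgHom k A))
      (fun _ _ => Commute.all _ _)
  suffices h : (E.restrictScalars k).comp (coaction k a) = AlgHom.id k _ from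
    DFunLike.congr_fun h f
  refine MvPolynomial.algHom_ext fun i => ?_
  simp only [AlgHom.comp_apply, coaction_X, map_sum, AlgHom.restrictScalars_apply, E,
    Algebra.TensorProduct.lift_tmul, Bialgebra.counitAlgHom_apply, ha.counit, AlgHom.id_apply]
  simp

/-- A polynomial `f` is a root of the characteristic polynomial of the multiplication by its
coaction. As the coaction of `f` over `k[X] ⊗ A` is the translate of a tensor that is constant
along `A`, the coefficients of this characteristic polynomial are invariant. -/
theorem IsLinearCoaction.isIntegral [Module.Finite k A] (ha : IsLinearCoaction (k := k) a) :
    Algebra.IsIntegral (schemeInvariants k a) (MvPolynomial (Fin d) k) := by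
  refine ⟨fun f => ?_⟩
  let T := AlgEquiv.ofBijective
    (translation (Q := MvPolynomial (Fin d) k ⊗[k] A) (k := k) (A := A)
      Algebra.TensorProduct.includeRight) (translation_bijective _)
  set χ := tensorCharpoly (coaction k a f) with hχ
  have h1 : χ.map (coaction k a : MvPolynomial (Fin d) k →+* MvPolynomial (Fin d) k ⊗[k] A) =
      χ.map ((Algebra.TensorProduct.includeLeft (S := k) :
        MvPolynomial (Fin d) k →ₐ[k] MvPolynomial (Fin d) k ⊗[k] A) :
        MvPolynomial (Fin d) k →+* MvPolynomial (Fin d) k ⊗[k] A) := by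
    rw [hχ, tensorCharpoly_map, tensorCharpoly_map, ha.coassoc]
    exact tensorCharpoly_algEquiv T _
  have h2 : ∀ n, χ.coeff n ∈ schemeInvariants k a := fun n => by
    have := congrArg (Polynomial.coeff · n) h1
    simp only [Polynomial.coeff_map] at this
    exact this
  have h3 : χ.Monic := LinearMap.charpoly_monic _
  obtain ⟨P, hP, -, hPm⟩ := Polynomial.lifts_and_natDegree_eq_and_monic
    (f := algebraMap (schemeInvariants k a) (MvPolynomial (Fin d) k))
    ((Polynomial.lifts_iff_coeff_lifts χ).2 fun n => ⟨⟨_, h2 n⟩, rfl⟩) h3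
  refine ⟨P, hPm, ?_⟩
  rw [← Polynomial.eval_map, hP, ← Polynomial.coe_aeval_eq_eval]
  conv_lhs => rw [← ha.counit_coaction f]
  rw [Polynomial.aeval_algHom_apply, hχ, aeval_tensorCharpoly, map_zero]

end SchemeInvariants

end

theorem corollary1p3 (k : Type*) [Field k] [PerfectField k] (p : ℕ) [Fact p.Prime] [CharP k p]
    (d : ℕ) (hd : 1 < d) :
    -- a graded pair `(S, I)` with a finite graded extension `S ⊆ R`, `proj dim_R (R/IR) < ∞`
    (∀ (S : Type*) [CommRing S] [Algebra k S] (𝒮 : ℕ → Submodule k S) [GradedAlgebra 𝒮]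
        (I : Ideal S), IsGradedPair 𝒮 I d →
      ∀ (R : Type*) [CommRing R] [Algebra k R] (ℛ : ℕ → Submodule k R) [GradedAlgebra ℛ]
        [Algebra S R] [IsScalarTower k S R] [Module.Finite S R],
        Function.Injective (algebraMap S R) →
        (∀ n, ∀ s ∈ 𝒮 n, algebraMap S R s ∈ ℛ n) →
        CategoryTheory.projectiveDimension
          (ModuleCat.of R (R ⧸ I.map (algebraMap S R))) < ⊤ →
        TendstoUniformlyOn (hkSeq p d 𝒮 I) (hkDensity p d 𝒮 I) atTop (Set.Ici 0) ∧
        IsPiecewisePolynomialOfDegree (hkDensity p d 𝒮 I) (d - 1) ∧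
        DensityGivenByBetti p d 𝒮 I ℛ ∧
        (IsLocalRing (ℛ 0) →
          ∃ F : GradedFreeResolution ℛ (I.map (algebraMap S R)), F.IsMinimal)) ∧
    -- invariants of a finite group acting linearly on `k[X_1, …, X_d]`
    (∀ (G : Type*) [Group G] [Finite G] (ρ : G →* Matrix.GeneralLinearGroup (Fin d) k)
        (I : Ideal (groupInvariants ρ)),
        I.IsHomogeneous (inducedGrading (groupInvariants ρ)) → I ≠ ⊤ →
        HasFiniteColength I →
        IsGradedPair (inducedGrading (groupInvariants ρ)) I d ∧
        TendstoUniformlyOn (hkSeq p d (inducedGrading (groupInvariants ρ)) I)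
          (hkDensity p d (inducedGrading (groupInvariants ρ)) I) atTop (Set.Ici 0) ∧
        IsPiecewisePolynomialOfDegree
          (hkDensity p d (inducedGrading (groupInvariants ρ)) I) (d - 1) ∧
        DensityGivenByBetti p d (inducedGrading (groupInvariants ρ)) I
          (MvPolynomial.homogeneousSubmodule (Fin d) k) ∧
        ∃ F : GradedFreeResolution (MvPolynomial.homogeneousSubmodule (Fin d) k)
          (I.map (algebraMap (groupInvariants ρ) (MvPolynomial (Fin d) k))), F.IsMinimal) ∧
    -- invariants of a finite group scheme `Spec A` acting linearly on `k[X_1, …, X_d]`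
    (∀ (A : Type*) [CommRing A] [HopfAlgebra k A] [Module.Finite k A]
        (a : Matrix (Fin d) (Fin d) A), IsLinearCoaction (k := k) a →
      ∀ I : Ideal (schemeInvariants k a),
        I.IsHomogeneous (inducedGrading (schemeInvariants k a)) → I ≠ ⊤ →
        HasFiniteColength I →
        IsGradedPair (inducedGrading (schemeInvariants k a)) I d ∧
        TendstoUniformlyOn (hkSeq p d (inducedGrading (schemeInvariants k a)) I)
          (hkDensity p d (inducedGrading (schemeInvariants k a)) I) atTop (Set.Ici 0) ∧
        IsPiecewisePolynomialOfDegree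
          (hkDensity p d (inducedGrading (schemeInvariants k a)) I) (d - 1) ∧
        DensityGivenByBetti p d (inducedGrading (schemeInvariants k a)) I
          (MvPolynomial.homogeneousSubmodule (Fin d) k) ∧
        ∃ F : GradedFreeResolution (MvPolynomial.homogeneousSubmodule (Fin d) k)
          (I.map (algebraMap (schemeInvariants k a) (MvPolynomial (Fin d) k))),
          F.IsMinimal) := by
  refine ⟨?_, ?_, ?_⟩
  · intro S _ _ 𝒮 _ I h R _ _ ℛ _ _ _ _ hinj hdeg hpd
    obtain ⟨h1, h2, h3⟩ := h.density_of_projectiveDimension_lt_top hd p hinj hdeg hpd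
    exact ⟨h1, h2, h3, fun _ => h.exists_isMinimal hdeg hpd⟩
  · intro G _ _ ρ I hI hI1 hI2
    exact density_inducedGrading hd p hI hI1 hI2
  · intro A _ _ _ a ha I hI hI1 hI2
    have := ha.isIntegral
    exact density_inducedGrading hd p hI hI1 hI2
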